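/- **Setting.** Let $F$ be an infinite field. Let $K_q^M(F)$ be the Milnor $K$-groups, with symbols $\{c_1,\dots,c_q\}$, and put $K_3^{\rm ind}(F)=\operatorname{coker}(K_3^M(F)\to K_3(F))$. For $n\ge 3$ let $$F^{\times\otimes 3}\otimes K_{n-3}^M(F)\xrightarrow{\ \delta_3\ }F^{\times\otimes 2}\otimes K_{n-2}^M(F)\xrightarrow{\ \delta_2\ }F^\times\otimes K_{n-1}^M(F)$$ be the homomorphisms $$\delta_i(a_1\otimes\cdots\otimes a_i\otimes\{b_1,\dots,b_{n-i}\})=\sum_{j=1}^i a_1\otimes\cdots\widehat{a_j}\cdots\otimes a_i\otimes\{a_j,b_1,\dots,b_{n-i}\}.$$ Set $B_1(F)=0$, $B_2(F)=K_3^{\rm ind}(F)$ and $B_n(F)=\ker(\delta_2)/\operatorname{im}(\delta_3)$ for $n\ge3$. The map $\mathrm{GL}_{n-1}(F)\to\mathrm{GL}_n(F)$ is $A\mapsto\operatorname{diag}(A,1)$. For pairwise commuting elements $g_1,\dots,g_n$ of a group put $\mathbf c(g_1,\dots,g_n)=\sum_{\sigma\in\Sigma_n}\operatorname{sign}(\sigma)[g_{\sigma(1)}|\cdots|g_{\sigma(n)}]$,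 a cycle in the bar complex. For $c\in F^\times$ let $C_{1,r}(c)=\operatorname{diag}(c,I_{r-1})$ and $C_{i,r}(c)=\operatorname{diag}(cI_{i-1},c^{-(i-1)},I_{r-i})$ for $2\le i\le r$. For $n\ge3$ and a finite sum $x=\sum a\otimes b\otimes\{c_1,\dots,c_{n-2}\}\in F^{\times\otimes 2}\otimes K^M_{n-2}(F)$, with $C_{i,n-1}=C_{i,n-1}(c_i)$, let $$w(x)=-\sum\Big(\mathbf c\big(\operatorname{diag}(I_{n-2},b),\operatorname{diag}(aI_{n-2},1),C_{1,n-1},\dots,C_{n-2,n-1}\big)+\mathbf c\big(\operatorname{diag}(I_{n-2},a),\operatorname{diag}(bI_{n-2},1),C_{1,n-1},\dots,C_{n-2,n-1}\big)\Big),$$ a cycle in the bar complex of $\mathrm{GL}_{n-1}(F)$. **Proposition.** (i) For any positive integer $n$ there is a homomorphism $$\varphi_n:B_n(F)\to\ker\big(H_n(\mathrm{GL}_{n-1}(F),\mathbb Z)\to H_n(\mathrm{GL}_n(F),\mathbb Z)\big),$$ natural with respect to homomorphisms of infinite fields, which is zero for $n\le 2$ and which for $n\ge3$ sends the class of every $x=\sum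 a\otimes b\otimes\{c_1,\dots,c_{n-2}\}\in\ker(\delta_2)$ to the class of $w(x)$. The map $\varphi_n$ factors through the multiplication map $n-2:B_n(F)\to(n-2)B_n(F)$, and $(n-1)\cdot\operatorname{im}(\varphi_n)=0$. (ii) For any positive integer $n$ put $R_n=\mathbb Z\big[\tfrac1{(n-2)!}\big]$ (and $R_1=\mathbb Z$). There is an $R_n$-linear map $$\kappa_n:B_n(F)\otimes_{\mathbb Z}R_n\to\ker\big(H_n(\mathrm{GL}_{n-1}(F),R_n)\to H_n(\mathrm{GL}_n(F),R_n)\big),$$ natural with respect to homomorphisms of infinite fields, which is zero for $n\le 2$ and which for $n\ge3$ sends $[x]\otimes1$, for every $x\in\ker(\delta_2)$ as above, to the class of $\frac{(-1)^{n-2}}{(n-2)!}\,w(x)$. Moreover $(n-1)\cdot\operatorname{im}(\kappa_n)=0$. -/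

import Mathlib

open CategoryTheory TensorProduct

universe u

namespace GLHom

noncomputable section

/-! ### The two differentials, for a general pairing `μ : A ⊗ K → K'` -/

section Pairing

/-- Bilinear pairings `A × K → K'`. -/
abbrev Pairing (R A K K' : Type*) [CommRing R] [AddCommGroup A] [AddCommGroup K] [AddCommGroup K']
    [Module R A] [Module R K] [Module R K'] := A →ₗ[R] K →ₗ[R] K'

/-- The module `A ⊗ A ⊗ K`. -/
abbrev Tensor₂ (R A K : Type*) [CommRing R] [AddCommGroup A] [AddCommGroup K] [Module R A]
    [Module R K] := A ⊗[R] (A ⊗[R] K)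

variable {R : Type*} [CommRing R] {A K₀ K₁ K₂ : Type*} [AddCommGroup A] [AddCommGroup K₀]
  [AddCommGroup K₁] [AddCommGroup K₂] [Module R A] [Module R K₀] [Module R K₁] [Module R K₂]

/-- The map `A ⊗ A ⊗ K₀ → A ⊗ K₁`, `a ⊗ b ⊗ κ ↦ b ⊗ a κ + a ⊗ b κ`. -/
def delta₂ (μ : Pairing R A K₀ K₁) : A ⊗[R] (A ⊗[R] K₀) →ₗ[R] A ⊗[R] K₁ :=
  (TensorProduct.lift μ).lTensor A ∘ₗ (TensorProduct.leftComm R A A K₀).toLinearMap +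
    (TensorProduct.lift μ).lTensor A

/-- The map `A ⊗ A ⊗ A ⊗ K₀ → A ⊗ A ⊗ K₁`,
`a ⊗ b ⊗ c ⊗ κ ↦ b ⊗ c ⊗ a κ + a ⊗ c ⊗ b κ + a ⊗ b ⊗ c κ`. -/
def delta₃ (μ : Pairing R A K₀ K₁) :
    A ⊗[R] (A ⊗[R] (A ⊗[R] K₀)) →ₗ[R] A ⊗[R] (A ⊗[R] K₁) :=
  ((TensorProduct.lift μ).lTensor A).lTensor A ∘ₗ
      (TensorProduct.leftComm R A A K₀).toLinearMap.lTensor A ∘ₗ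
      (TensorProduct.leftComm R A A (A ⊗[R] K₀)).toLinearMap +
    (delta₂ μ).lTensor A

theorem delta₂_tmul (μ : Pairing R A K₀ K₁) (a b : A) (κ : K₀) :
    delta₂ μ (a ⊗ₜ (b ⊗ₜ κ)) = b ⊗ₜ μ a κ + a ⊗ₜ μ b κ := by
  simp [delta₂]

theorem delta₃_tmul (μ : Pairing R A K₀ K₁) (a b c : A) (κ : K₀) :
    delta₃ μ (a ⊗ₜ (b ⊗ₜ (c ⊗ₜ κ))) =
      b ⊗ₜ (c ⊗ₜ μ a κ) + a ⊗ₜ (c ⊗ₜ μ b κ) + a ⊗ₜ (b ⊗ₜ μ c κ) := by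
  simp [delta₃, delta₂_tmul, TensorProduct.tmul_add, add_assoc]

/-- The homology `ker(δ₂) / im(δ₃)` at `A ⊗ A ⊗ K₁`. -/
abbrev DeltaHomology (μ : Pairing R A K₀ K₁) (ν : Pairing R A K₁ K₂) :=
  LinearMap.ker (delta₂ ν) ⧸ (LinearMap.range (delta₃ μ)).submoduleOf (LinearMap.ker (delta₂ ν))

variable {A' K₀' K₁' K₂' : Type*} [AddCommGroup A'] [AddCommGroup K₀']
  [AddCommGroup K₁'] [AddCommGroup K₂'] [Module R A'] [Module R K₀'] [Module R K₁'] [Module R K₂']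

theorem delta₂_map {μ : Pairing R A K₀ K₁} {μ' : Pairing R A' K₀' K₁'} {f : A →ₗ[R] A'}
    {g₀ : K₀ →ₗ[R] K₀'} {g₁ : K₁ →ₗ[R] K₁'} (h : ∀ a κ, g₁ (μ a κ) = μ' (f a) (g₀ κ))
    (x : A ⊗[R] (A ⊗[R] K₀)) :
    delta₂ μ' (TensorProduct.map f (TensorProduct.map f g₀) x) =
      TensorProduct.map f g₁ (delta₂ μ x) := by
  induction x with
  | zero => simp
  | add x y hx hy => simp only [map_add, hx, hy]
  | tmul a x =>
    induction x with
    | zero => simp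
    | add x y hx hy => simp only [TensorProduct.tmul_add, map_add, hx, hy]
    | tmul b κ => simp only [TensorProduct.map_tmul, delta₂_tmul, map_add, h]

theorem delta₃_map {μ : Pairing R A K₀ K₁} {μ' : Pairing R A' K₀' K₁'} {f : A →ₗ[R] A'}
    {g₀ : K₀ →ₗ[R] K₀'} {g₁ : K₁ →ₗ[R] K₁'} (h : ∀ a κ, g₁ (μ a κ) = μ' (f a) (g₀ κ))
    (x : A ⊗[R] (A ⊗[R] (A ⊗[R] K₀))) :
    delta₃ μ' (TensorProduct.map f (TensorProduct.map f (TensorProduct.map f g₀)) x) =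
      TensorProduct.map f (TensorProduct.map f g₁) (delta₃ μ x) := by
  induction x with
  | zero => simp
  | add x y hx hy => simp only [map_add, hx, hy]
  | tmul a x =>
    induction x with
    | zero => simp
    | add x y hx hy => simp only [TensorProduct.tmul_add, map_add, hx, hy]
    | tmul b x =>
      induction x with
      | zero => simp
      | add x y hx hy => simp only [TensorProduct.tmul_add, map_add, hx, hy]
      | tmul c κ => simp only [TensorProduct.map_tmul, delta₃_tmul, map_add, h]

/-- Functoriality of `ker(δ₂) / im(δ₃)`. -/
def DeltaHomology.map {μ : Pairing R A K₀ K₁} {ν : Pairing R A K₁ K₂}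
    {μ' : Pairing R A' K₀' K₁'} {ν' : Pairing R A' K₁' K₂'} (f : A →ₗ[R] A')
    (g₀ : K₀ →ₗ[R] K₀') (g₁ : K₁ →ₗ[R] K₁') (g₂ : K₂ →ₗ[R] K₂')
    (h : ∀ a κ, g₁ (μ a κ) = μ' (f a) (g₀ κ)) (h' : ∀ a κ, g₂ (ν a κ) = ν' (f a) (g₁ κ)) :
    DeltaHomology μ ν →ₗ[R] DeltaHomology μ' ν' :=
  Submodule.mapQ _ _
    ((TensorProduct.map f (TensorProduct.map f g₁)).restrict
      (p := LinearMap.ker (delta₂ ν)) (q := LinearMap.ker (delta₂ ν'))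
      fun x hx => by rw [LinearMap.mem_ker, delta₂_map h', LinearMap.mem_ker.mp hx, map_zero]) <| by
    rintro ⟨_, hx⟩ ⟨y, rfl⟩
    exact ⟨_, delta₃_map h y⟩

end Pairing

/-! ### Milnor K-groups and the groups `B_n(F)` for `n ≥ 3` -/

/-- The abelian group `Fˣ`, written additively. -/
abbrev Ab (F : Type u) [Field F] : Type u := Additive Fˣ

/-- The Steinberg relations in degree `q`: the subgroup of `(Fˣ)^{⊗ q}` generated by the pure tensors
`c_1 ⊗ ⋯ ⊗ c_q` with `c_i + c_{i+1} = 1` for some `i`. -/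
def steinberg (F : Type u) [Field F] (q : ℕ) : Submodule ℤ (⨂[ℤ] _ : Fin q, Ab F) :=
  Submodule.span ℤ {t | ∃ (c : Fin q → Fˣ) (i j : Fin q), j.val = i.val + 1 ∧
    (c i : F) + (c j : F) = 1 ∧ t = PiTensorProduct.tprod ℤ (fun l => Additive.ofMul (c l))}

/-- The Milnor `K`-group `K_q^M(F)`: the degree `q` part of the tensor algebra of `Fˣ` modulo the
two-sided ideal generated by the elements `a ⊗ (1 - a)`. -/
def KM (F : Type u) [Field F] (q : ℕ) : Type u := (⨂[ℤ] _ : Fin q, Ab F) ⧸ steinberg F q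

instance (F : Type u) [Field F] (q : ℕ) : AddCommGroup (KM F q) :=
  inferInstanceAs (AddCommGroup ((⨂[ℤ] _ : Fin q, Ab F) ⧸ steinberg F q))

/-- The projection `(Fˣ)^{⊗ q} → K_q^M(F)`. -/
def KM.mk (F : Type u) [Field F] (q : ℕ) : (⨂[ℤ] _ : Fin q, Ab F) →+ KM F q :=
  (steinberg F q).mkQ.toAddMonoidHom

/-- A homomorphism on `(Fˣ)^{⊗ q}` that kills the Steinberg relations descends to `K_q^M(F)`. -/
def KM.desc {F : Type u} [Field F] {q : ℕ} {M : Type*} [AddCommGroup M]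
    (φ : (⨂[ℤ] _ : Fin q, Ab F) →+ M)
    (h : ∀ (c : Fin q → Fˣ) (i j : Fin q), j.val = i.val + 1 → (c i : F) + (c j : F) = 1 →
      φ (PiTensorProduct.tprod ℤ fun l => Additive.ofMul (c l)) = 0) : KM F q →+ M :=
  QuotientAddGroup.lift (steinberg F q).toAddSubgroup φ fun x hx => by
    induction (hx : x ∈ steinberg F q) using Submodule.span_induction with
    | mem x hx => obtain ⟨c, i, j, hij, h1, rfl⟩ := hx; exact h c i j hij h1
    | zero => exact map_zero φ
    | add x y _ _ hx hy => exact add_mem hx hy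
    | smul r x _ hx => exact zsmul_mem hx r

/-- The symbol `{c_1, …, c_q}`. -/
def KM.symbol {F : Type u} [Field F] {q : ℕ} (c : Fin q → Fˣ) : KM F q :=
  KM.mk F q (PiTensorProduct.tprod ℤ fun l => Additive.ofMul (c l))

theorem KM.symbol_eq_zero {F : Type u} [Field F] {q : ℕ} (c : Fin q → Fˣ) (i j : Fin q)
    (hij : j.val = i.val + 1) (h : (c i : F) + (c j : F) = 1) : KM.symbol c = 0 :=
  (Submodule.Quotient.mk_eq_zero _).mpr (Submodule.subset_span ⟨c, i, j, hij, h, rfl⟩)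

theorem KM.desc_symbol {F : Type u} [Field F] {q : ℕ} {M : Type*} [AddCommGroup M]
    (φ : (⨂[ℤ] _ : Fin q, Ab F) →+ M) (h) (c : Fin q → Fˣ) :
    KM.desc φ h (KM.symbol c) = φ (PiTensorProduct.tprod ℤ fun l => Additive.ofMul (c l)) :=
  rfl

theorem KM.symbol_induction {F : Type u} [Field F] {q : ℕ} {p : KM F q → Prop} (x : KM F q)
    (h1 : ∀ c, p (KM.symbol c)) (h2 : ∀ (r : ℤ) x, p x → p (r • x))
    (h3 : ∀ x y, p x → p y → p (x + y)) : p x := by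
  obtain ⟨t, rfl⟩ : ∃ t, KM.mk F q t = x := Submodule.mkQ_surjective _ x
  induction t using PiTensorProduct.induction_on with
  | smul_tprod r c => rw [map_zsmul]; exact h2 _ _ (h1 fun l => (c l).toMul)
  | add x y hx hy => rw [map_add]; exact h3 _ _ hx hy

/-- The homomorphism `(Fˣ)^{⊗ q} → (Fˣ)^{⊗ (q+1)}`, `c_1 ⊗ ⋯ ⊗ c_q ↦ a ⊗ c_1 ⊗ ⋯ ⊗ c_q`. -/
def consTensor {F : Type u} [Field F] (q : ℕ) (a : Ab F) :
    (⨂[ℤ] _ : Fin q, Ab F) →+ (⨂[ℤ] _ : Fin (q + 1), Ab F) :=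
  (PiTensorProduct.lift ((PiTensorProduct.tprod ℤ (s := fun _ : Fin (q + 1) => Ab F)).curryLeft
    a)).toAddMonoidHom

theorem consTensor_tprod {F : Type u} [Field F] (q : ℕ) (a : Ab F) (c : Fin q → Ab F) :
    consTensor q a (PiTensorProduct.tprod ℤ c) =
      PiTensorProduct.tprod ℤ (Fin.cons a c : Fin (q + 1) → Ab F) :=
  PiTensorProduct.lift.tprod _

theorem mk_consTensor {F : Type u} [Field F] {q : ℕ} (a : Ab F) (c : Fin q → Fˣ) :
    KM.mk F (q + 1) (consTensor q a (PiTensorProduct.tprod ℤ fun l => Additive.ofMul (c l))) =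
      KM.symbol (Fin.cons a.toMul c : Fin (q + 1) → Fˣ) := by
  rw [consTensor_tprod, KM.symbol]
  refine congrArg (KM.mk F (q + 1)) (congrArg (PiTensorProduct.tprod ℤ) (funext fun l => ?_))
  refine Fin.cases ?_ (fun l => ?_) l <;> simp

/-- Left multiplication by an element of `Fˣ`: `{c_1, …, c_q} ↦ {a, c_1, …, c_q}`. -/
def KM.mulLeft {F : Type u} [Field F] (q : ℕ) (a : Ab F) : KM F q →+ KM F (q + 1) :=
  KM.desc ((KM.mk F (q + 1)).comp (consTensor q a)) fun c i j hij h => by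
    rw [AddMonoidHom.comp_apply, mk_consTensor]
    exact KM.symbol_eq_zero _ i.succ j.succ (by simp [hij]) (by simpa using h)

theorem KM.mulLeft_symbol {F : Type u} [Field F] {q : ℕ} (a : Ab F) (c : Fin q → Fˣ) :
    KM.mulLeft q a (KM.symbol c) = KM.symbol (Fin.cons a.toMul c : Fin (q + 1) → Fˣ) :=
  (KM.desc_symbol _ _ c).trans (mk_consTensor a c)

theorem KM.mulLeft_add {F : Type u} [Field F] {q : ℕ} (a b : Ab F) (x : KM F q) :
    KM.mulLeft q (a + b) x = KM.mulLeft q a x + KM.mulLeft q b x := by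
  induction x using KM.symbol_induction with
  | h1 c =>
    refine (KM.desc_symbol _ _ c).trans (Eq.trans ?_ (congrArg₂ (· + ·)
      (KM.desc_symbol _ _ c).symm (KM.desc_symbol _ _ c).symm))
    simp only [AddMonoidHom.comp_apply, consTensor_tprod, ← map_add]
    exact congrArg (KM.mk F (q + 1)) (MultilinearMap.cons_add _ _ _ _)
  | h2 r x hx => simp only [map_zsmul, hx, smul_add]
  | h3 x y hx hy => simp only [map_add, hx, hy]; abel

/-- The product `Fˣ × K_q^M(F) → K_{q+1}^M(F)`. -/
def KM.mul (F : Type u) [Field F] (q : ℕ) : Pairing ℤ (Ab F) (KM F q) (KM F (q + 1)) :=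
  LinearMap.mk₂ ℤ (fun a x => KM.mulLeft q a x) KM.mulLeft_add
    (fun r a x => map_zsmul (AddMonoidHom.mk' (fun b => KM.mulLeft q b x)
      fun b c => KM.mulLeft_add b c x) r a)
    (fun _ x y => map_add _ x y) (fun r _ x => map_zsmul _ r x)

theorem KM.mul_symbol {F : Type u} [Field F] {q : ℕ} (a : Ab F) (c : Fin q → Fˣ) :
    KM.mul F q a (KM.symbol c) = KM.symbol (Fin.cons a.toMul c : Fin (q + 1) → Fˣ) :=
  KM.mulLeft_symbol a c

/-- The differential `Fˣ ⊗ Fˣ ⊗ K_{q}^M(F) → Fˣ ⊗ K_{q+1}^M(F)`. -/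
abbrev δ₂ (F : Type u) [Field F] (q : ℕ) := delta₂ (KM.mul F q)

/-- The differential `Fˣ ⊗ Fˣ ⊗ Fˣ ⊗ K_{q}^M(F) → Fˣ ⊗ Fˣ ⊗ K_{q+1}^M(F)`. -/
abbrev δ₃ (F : Type u) [Field F] (q : ℕ) := delta₃ (KM.mul F q)

/-- The group `ker(δ₂) / im(δ₃)` at `Fˣ ⊗ Fˣ ⊗ K_{q+1}^M(F)`; this is `B_{q+3}(F)`. -/
abbrev BMilnor (F : Type u) [Field F] (q : ℕ) : Type u :=
  DeltaHomology (KM.mul F q) (KM.mul F (q + 1))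

/-- The map `Fˣ → F'ˣ` induced by a field homomorphism. -/
def abMap {F F' : Type u} [Field F] [Field F'] (f : F →+* F') : Ab F →ₗ[ℤ] Ab F' :=
  (MonoidHom.toAdditive (Units.map (f : F →* F'))).toIntLinearMap

theorem map_tprod {F F' : Type u} [Field F] [Field F'] (f : F →+* F') {q : ℕ} (c : Fin q → Fˣ) :
    KM.mk F' q (PiTensorProduct.map (fun _ => abMap f)
      (PiTensorProduct.tprod ℤ fun l => Additive.ofMul (c l))) =
      KM.symbol fun l => Units.map (f : F →* F') (c l) :=
  congrArg (KM.mk F' q) (PiTensorProduct.map_tprod _ _)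

/-- The map `K_q^M(F) → K_q^M(F')` induced by a field homomorphism. -/
def KM.map {F F' : Type u} [Field F] [Field F'] (f : F →+* F') (q : ℕ) : KM F q →ₗ[ℤ] KM F' q :=
  (KM.desc ((KM.mk F' q).comp (PiTensorProduct.map fun _ => abMap f).toAddMonoidHom)
    fun c i j hij h => (map_tprod f c).trans <| KM.symbol_eq_zero _ i j hij <| by
      simpa using congrArg f h).toIntLinearMap

theorem KM.map_symbol {F F' : Type u} [Field F] [Field F'] (f : F →+* F') {q : ℕ}
    (c : Fin q → Fˣ) :
    KM.map f q (KM.symbol c) = KM.symbol fun l => Units.map (f : F →* F') (c l) :=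
  map_tprod f c

theorem KM.map_mul {F F' : Type u} [Field F] [Field F'] (f : F →+* F') (q : ℕ) (a : Ab F)
    (x : KM F q) : KM.map f (q + 1) (KM.mul F q a x) = KM.mul F' q (abMap f a) (KM.map f q x) := by
  induction x using KM.symbol_induction with
  | h1 c =>
    rw [KM.mul_symbol, KM.map_symbol, KM.map_symbol, KM.mul_symbol]
    congr 1
    funext l
    refine Fin.cases ?_ (fun l => ?_) l
    · rfl
    · simp
  | h2 r x hx => simp only [map_zsmul, hx]
  | h3 x y hx hy => simp only [map_add, hx, hy]

/-- The map `B_{q+3}(F) → B_{q+3}(F')` induced by a field homomorphism. -/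
def BMilnor.map {F F' : Type u} [Field F] [Field F'] (f : F →+* F') (q : ℕ) :
    BMilnor F q →ₗ[ℤ] BMilnor F' q :=
  DeltaHomology.map (abMap f) (KM.map f q) (KM.map f (q + 1)) (KM.map f (q + 2)) (KM.map_mul f q)
    (KM.map_mul f (q + 1))

section KTheory

open Simplicial

/-! ### Third homotopy groups of pointed simplicial sets -/

/-- The point of the geometric realization given by a vertex. -/
def vertexPt (X : SSet.{u}) (x : X.obj (Opposite.op ⦋0⦌)) : SSet.toTop.obj X :=
  TopCat.toSSetObj₀Equiv ((sSetTopAdj.unit.app X).app (Opposite.op ⦋0⦌) x)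

theorem map_vertexPt {X Y : SSet.{u}} (f : X ⟶ Y) (x : X.obj (Opposite.op ⦋0⦌)) :
    (SSet.toTop.map f).hom (vertexPt X x) = vertexPt Y (f.app (Opposite.op ⦋0⦌) x) := by
  have h := congrArg (fun g => g.app (Opposite.op ⦋0⦌) x) (sSetTopAdj.unit.naturality f)
  exact (congrArg TopCat.toSSetObj₀Equiv h).symm

/-- The map on spheroids induced by a continuous map. -/
def genLoopMap {X Y : Type u} [TopologicalSpace X] [TopologicalSpace Y] {x : X} {y : Y}
    (f : C(X, Y)) (h : f x = y) (γ : GenLoop (Fin 3) X x) : GenLoop (Fin 3) Y y :=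
  ⟨f.comp γ.1, fun t ht => by rw [ContinuousMap.comp_apply, γ.2 t ht, h]⟩

/-- The homomorphism of third homotopy groups induced by a continuous map. -/
def piMap {X Y : Type u} [TopologicalSpace X] [TopologicalSpace Y] {x : X} {y : Y}
    (f : C(X, Y)) (h : f x = y) : HomotopyGroup.Pi 3 X x →* HomotopyGroup.Pi 3 Y y :=
  MonoidHom.mk'
    (Quotient.map (genLoopMap f h) fun γ γ' ⟨H⟩ => ⟨H.compContinuousMap f⟩) <| by
    rintro ⟨p⟩ ⟨q⟩
    have e : genLoopMap f h (GenLoop.transAt 0 q p) =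
        GenLoop.transAt 0 (genLoopMap f h q) (genLoopMap f h p) := by
      refine GenLoop.ext _ _ fun t => ?_
      change f (GenLoop.transAt 0 q p t) = _
      simp only [GenLoop.transAt, GenLoop.coe_copy]
      split_ifs <;> rfl
    refine (congrArg _ (HomotopyGroup.mul_spec (i := (0 : Fin 3)) (p := p) (q := q))).trans ?_
    refine Eq.trans ?_ (HomotopyGroup.mul_spec (i := (0 : Fin 3))
      (p := genLoopMap f h p) (q := genLoopMap f h q)).symm
    exact congrArg (Quotient.mk _) e

/-- `π_3` of the geometric realization of a simplicial set at a vertex, written additively. -/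
abbrev Pi3 (X : SSet.{u}) (x : X.obj (Opposite.op ⦋0⦌)) : Type u :=
  Additive (HomotopyGroup.Pi 3 (SSet.toTop.obj X) (vertexPt X x))

/-- The map on `π_3` induced by a map of pointed simplicial sets. -/
def Pi3.map {X Y : SSet.{u}} (f : X ⟶ Y) {x : X.obj (Opposite.op ⦋0⦌)}
    {y : Y.obj (Opposite.op ⦋0⦌)} (h : f.app (Opposite.op ⦋0⦌) x = y) : Pi3 X x →+ Pi3 Y y :=
  MonoidHom.toAdditive (piMap (SSet.toTop.map f).hom (by rw [map_vertexPt, h]))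

theorem Pi3.map_map {X Y Z : SSet.{u}} (f : X ⟶ Y) (g : Y ⟶ Z) {x : X.obj (Opposite.op ⦋0⦌)}
    {y : Y.obj (Opposite.op ⦋0⦌)} {z : Z.obj (Opposite.op ⦋0⦌)}
    (h : f.app (Opposite.op ⦋0⦌) x = y) (h' : g.app (Opposite.op ⦋0⦌) y = z)
    (h'' : (f ≫ g).app (Opposite.op ⦋0⦌) x = z) (α : Pi3 X x) :
    Pi3.map g h' (Pi3.map f h α) = Pi3.map (f ≫ g) h'' α := by
  obtain ⟨γ⟩ := α
  refine congrArg (Quotient.mk _) (GenLoop.ext _ _ fun t => ?_)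
  change (SSet.toTop.map g).hom ((SSet.toTop.map f).hom (γ t)) = (SSet.toTop.map (f ≫ g)).hom (γ t)
  rw [SSet.toTop.map_comp]
  rfl

/-! ### Classifying spaces and the `K`-theory space of a field -/

/-- The `k`-simplices of the nerve `BG` of a group `G`: families `g i j` for `0 ≤ i, j ≤ k` with
`g i j * g j l = g i l`. -/
def Cocycle (G : Type u) [Group G] (k : ℕ) : Type u :=
  {g : Fin (k + 1) → Fin (k + 1) → G // ∀ i j l, g i j * g j l = g i l}

namespace Cocycle

variable {G H L : Type u} [Group G] [Group H] [Group L]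

/-- Simplicial operators on `BG`. -/
def pull {k l : ℕ} (θ : Fin (l + 1) → Fin (k + 1)) (g : Cocycle G k) : Cocycle G l :=
  ⟨fun i j => g.1 (θ i) (θ j), fun _ _ _ => g.2 _ _ _⟩

/-- The map `BG → BH` induced by a homomorphism. -/
def map (φ : G →* H) {k : ℕ} (g : Cocycle G k) : Cocycle H k :=
  ⟨fun i j => φ (g.1 i j), fun i j l => by rw [← map_mul, g.2]⟩

/-- The isomorphism `BG × BH → B(G × H)`. -/
def prod {k : ℕ} (g : Cocycle G k) (h : Cocycle H k) : Cocycle (G × H) k :=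
  ⟨fun i j => (g.1 i j, h.1 i j), fun i j l => by rw [Prod.mk_mul_mk, g.2, h.2]⟩

/-- The degenerate simplex at the base point. -/
def triv (G : Type u) [Group G] (k : ℕ) : Cocycle G k := ⟨fun _ _ => 1, fun _ _ _ => mul_one 1⟩

end Cocycle

/-- The block sum `GL_m(F) × GL_n(F) → GL_{m+n}(F)`. -/
def blockSum (F : Type u) [Field F] (m n : ℕ) :
    GL (Fin m) F × GL (Fin n) F →* GL (Fin (m + n)) F :=
  (Units.map
    { toFun := fun p => Matrix.reindex finSumFinEquiv finSumFinEquiv (Matrix.fromBlocks p.1 0 0 p.2)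
      map_one' := by simp
      map_mul' := fun p q => by
        simp [Matrix.submatrix_mul_equiv, Matrix.fromBlocks_multiply] :
      Matrix (Fin m) (Fin m) F × Matrix (Fin n) (Fin n) F →*
        Matrix (Fin (m + n)) (Fin (m + n)) F }).comp MulEquiv.prodUnits.symm.toMonoidHom

/-- `k`-simplices of the disjoint union of the `BGL_n(F)`, `n ≥ 0`. -/
abbrev GLSimplex (F : Type u) [Field F] (k : ℕ) : Type u := Σ n : ℕ, Cocycle (GL (Fin n) F) k

/-- Block sum of simplices, making the disjoint union of the `BGL_n(F)` a simplicial monoid. -/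
def GLSimplex.add {F : Type u} [Field F] {k : ℕ} (x y : GLSimplex F k) : GLSimplex F k :=
  ⟨x.1 + y.1, (x.2.prod y.2).map (blockSum F x.1 y.1)⟩

/-- The relations `[x ⊕ y] = [x] [y]`. -/
def addRels (F : Type u) [Field F] (k : ℕ) : Set (FreeGroup (GLSimplex F k)) :=
  {r | ∃ x y : GLSimplex F k,
    r = FreeGroup.of (x.add y) * (FreeGroup.of x * FreeGroup.of y)⁻¹}

/-- The group completion of the monoid of `k`-simplices of the disjoint union of the `BGL_n(F)`. -/
abbrev KSimplex (F : Type u) [Field F] (k : ℕ) : Type u := PresentedGroup (addRels F k)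

/-- A map of generators compatible with block sum induces a homomorphism of group completions. -/
def KSimplex.lift {F F' : Type u} [Field F] [Field F'] {k l : ℕ}
    (θ : GLSimplex F k → GLSimplex F' l) (h : ∀ x y, θ (x.add y) = (θ x).add (θ y)) :
    KSimplex F k →* KSimplex F' l :=
  PresentedGroup.toGroup (f := fun x => PresentedGroup.of (θ x)) <| by
    rintro _ ⟨x, y, rfl⟩
    simp only [map_mul, map_inv, FreeGroup.lift_apply_of, h]
    exact PresentedGroup.one_of_mem (rels := addRels F' l) ⟨θ x, θ y, rfl⟩

theorem KSimplex.lift_of {F F' : Type u} [Field F] [Field F'] {k l : ℕ}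
    (θ : GLSimplex F k → GLSimplex F' l) (h : ∀ x y, θ (x.add y) = (θ x).add (θ y))
    (x : GLSimplex F k) :
    KSimplex.lift θ h (PresentedGroup.of x) = PresentedGroup.of (θ x) :=
  PresentedGroup.toGroup.of _

/-- Simplicial operators on group completions. -/
def KSimplex.pull {F : Type u} [Field F] {k l : ℕ} (θ : Fin (l + 1) → Fin (k + 1)) :
    KSimplex F k →* KSimplex F l :=
  KSimplex.lift (fun x => ⟨x.1, x.2.pull θ⟩) fun _ _ => rfl

/-- The algebraic `K`-theory space of `F`, as a simplicial group (only the underlying simplicial set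
is recorded): the degreewise group completion of the simplicial monoid `∐ₙ BGL_n(F)` under block
sum.  As each monoid of `k`-simplices is free (a tuple of matrices is uniquely a block sum of
indecomposable tuples), this is a model of the group completion `Ω B (∐ₙ BGL_n(F))`, that is, of
`ℤ × BGL(F)⁺`. -/
def KSpace (F : Type u) [Field F] : SSet.{u} where
  obj Δ := KSimplex F Δ.unop.len
  map θ := TypeCat.ofHom (KSimplex.pull θ.unop.toOrderHom)
  map_id Δ := by
    ext x
    exact DFunLike.congr_fun (PresentedGroup.ext (φ := KSimplex.pull _) (ψ := MonoidHom.id _)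
      fun x => KSimplex.lift_of _ _ x) x
  map_comp {Δ Δ' Δ''} θ θ' := by
    ext x
    refine DFunLike.congr_fun (PresentedGroup.ext (φ := KSimplex.pull _)
      (ψ := (KSimplex.pull θ'.unop.toOrderHom).comp (KSimplex.pull θ.unop.toOrderHom))
      fun x => ?_) x
    simp only [MonoidHom.comp_apply, KSimplex.pull]
    rfl

/-- The base point of the `K`-theory space. -/
def KSpace.pt (F : Type u) [Field F] : (KSpace F).obj (Opposite.op ⦋0⦌) := (1 : KSimplex F 0)

/-- The third algebraic `K`-group `K_3(F)`. -/
abbrev K3 (F : Type u) [Field F] : Type u := Pi3 (KSpace F) (KSpace.pt F)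

/-! ### Products `K_1 × K_1 × K_1 → K_3` and the indecomposable part of `K_3` -/

/-- A triple of simplices of `BG` is degenerate if one of its entries is at the base point. -/
def Degenerate {G : Type u} [Group G] {k : ℕ} (t : Cocycle G k × Cocycle G k × Cocycle G k) : Prop :=
  t.1 = Cocycle.triv G k ∨ t.2.1 = Cocycle.triv G k ∨ t.2.2 = Cocycle.triv G k

/-- `k`-simplices of the smash product `BG ∧ BG ∧ BG`: triples of simplices, with all the
degenerate triples identified with each other. -/
abbrev SmashSimplex (G : Type u) [Group G] (k : ℕ) : Type u :=
  Quot fun t t' : Cocycle G k × Cocycle G k × Cocycle G k => Degenerate t ∧ Degenerate t'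

theorem Degenerate.pull {G : Type u} [Group G] {k l : ℕ} (θ : Fin (l + 1) → Fin (k + 1))
    {t : Cocycle G k × Cocycle G k × Cocycle G k} (h : Degenerate t) :
    Degenerate (t.1.pull θ, t.2.1.pull θ, t.2.2.pull θ) := by
  rcases h with h | h | h
  · exact Or.inl (by rw [h]; rfl)
  · exact Or.inr (Or.inl (by rw [h]; rfl))
  · exact Or.inr (Or.inr (by rw [h]; rfl))

theorem Degenerate.map {G H : Type u} [Group G] [Group H] (φ : G →* H) {k : ℕ}
    {t : Cocycle G k × Cocycle G k × Cocycle G k} (h : Degenerate t) :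
    Degenerate (t.1.map φ, t.2.1.map φ, t.2.2.map φ) := by
  have e : (Cocycle.triv G k).map φ = Cocycle.triv H k :=
    Subtype.ext (funext fun _ => funext fun _ => map_one φ)
  rcases h with h | h | h
  · exact Or.inl (by rw [h]; exact e)
  · exact Or.inr (Or.inl (by rw [h]; exact e))
  · exact Or.inr (Or.inr (by rw [h]; exact e))

/-- The simplicial set `BG ∧ BG ∧ BG`. -/
def Smash (G : Type u) [Group G] : SSet.{u} where
  obj Δ := SmashSimplex G Δ.unop.len
  map θ := TypeCat.ofHom (Quot.map (fun t => (t.1.pull θ.unop.toOrderHom,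
    t.2.1.pull θ.unop.toOrderHom, t.2.2.pull θ.unop.toOrderHom)) fun _ _ h => ⟨h.1.pull _, h.2.pull _⟩)
  map_id Δ := by
    ext ⟨t⟩
    rfl
  map_comp θ θ' := by
    ext ⟨t⟩
    rfl

/-- The base point of `BG ∧ BG ∧ BG`. -/
def Smash.pt (G : Type u) [Group G] : (Smash G).obj (Opposite.op ⦋0⦌) :=
  (Quot.mk _ (Cocycle.triv G 0, Cocycle.triv G 0, Cocycle.triv G 0) : SmashSimplex G 0)

/-- The map `BG ∧ BG ∧ BG → BH ∧ BH ∧ BH` induced by a homomorphism `G → H`. -/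
def Smash.map {G H : Type u} [Group G] [Group H] (φ : G →* H) : Smash G ⟶ Smash H where
  app _ := TypeCat.ofHom (Quot.map (fun t => (t.1.map φ, t.2.1.map φ, t.2.2.map φ))
    fun _ _ h => ⟨h.1.map φ, h.2.map φ⟩)
  naturality _ _ θ := by
    ext ⟨t⟩
    rfl

section Symbol

variable {F : Type u} [Field F] {k : ℕ}

/-- The class in the `K`-theory space of the simplex `x y z` of `B Fˣ = BGL_1(F)`. -/
def unitClass (x y z : Cocycle Fˣ k) : KSimplex F k :=
  PresentedGroup.of (rels := addRels F k) ⟨1,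
    ⟨fun i j => Matrix.GeneralLinearGroup.scalar (Fin 1) (x.1 i j * y.1 i j * z.1 i j),
      fun i j l => by
        refine (map_mul _ _ _).symm.trans (congrArg _ (Eq.trans ?_ (congrArg₂ (· * ·)
          (congrArg₂ (· * ·) (x.2 i j l) (y.2 i j l)) (z.2 i j l))))
        simp only [mul_mul_mul_comm]⟩⟩

/-- The product `([x] - [1]) ([y] - [1]) ([z] - [1])` in the `K`-theory space (written
multiplicatively), where the product of the classes of `x`, `y`, `z` is the class of their tensor
product `x y z`. -/
def tripleProduct (x y z : Cocycle Fˣ k) : KSimplex F k :=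
  let e : Cocycle Fˣ k := Cocycle.triv Fˣ k
  let p (x y z : Cocycle Fˣ k) : KSimplex F k := unitClass x y z * (unitClass e y z)⁻¹
  let q (x y z : Cocycle Fˣ k) : KSimplex F k := p x y z * (p x e z)⁻¹
  q x y z * (q x y e)⁻¹

theorem tripleProduct_eq_one {t : Cocycle Fˣ k × Cocycle Fˣ k × Cocycle Fˣ k} (h : Degenerate t) :
    tripleProduct t.1 t.2.1 t.2.2 = 1 := by
  rcases h with h | h | h
  · simp [tripleProduct, h]
  · simp [tripleProduct, h]
  · simp only [tripleProduct, h, mul_inv_cancel]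

theorem tripleProduct_pull {l : ℕ} (θ : Fin (l + 1) → Fin (k + 1)) (x y z : Cocycle Fˣ k) :
    KSimplex.pull θ (tripleProduct x y z) = tripleProduct (x.pull θ) (y.pull θ) (z.pull θ) := by
  have h (x y z : Cocycle Fˣ k) : KSimplex.pull θ (unitClass x y z) =
      unitClass (x.pull θ) (y.pull θ) (z.pull θ) := KSimplex.lift_of _ _ _
  simp only [tripleProduct, map_mul, map_inv, h]
  rfl

/-- The product map `B Fˣ ∧ B Fˣ ∧ B Fˣ → K(F)`.  On `π_3` it is the map
`Fˣ ⊗ Fˣ ⊗ Fˣ → K_3(F)` given by the product in `K`-theory. -/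
def productMap (F : Type u) [Field F] : Smash Fˣ ⟶ KSpace F where
  app Δ := TypeCat.ofHom (Quot.lift (fun t => (tripleProduct t.1 t.2.1 t.2.2 : KSimplex F Δ.unop.len))
    fun _ _ h => (tripleProduct_eq_one h.1).trans (tripleProduct_eq_one h.2).symm)
  naturality _ _ θ := by
    ext ⟨t⟩
    exact (tripleProduct_pull θ.unop.toOrderHom t.1 t.2.1 t.2.2).symm

theorem productMap_pt (F : Type u) [Field F] :
    (productMap F).app (Opposite.op ⦋0⦌) (Smash.pt Fˣ) = KSpace.pt F :=
  tripleProduct_eq_one (t := (Cocycle.triv Fˣ 0, Cocycle.triv Fˣ 0, Cocycle.triv Fˣ 0)) (Or.inl rfl)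

/-- The image of `K_3^M(F) → K_3(F)`: the subgroup of `K_3(F)` generated by the products of three
elements of `K_1(F) = Fˣ`. -/
def K3dec (F : Type u) [Field F] : AddSubgroup (K3 F) :=
  (Pi3.map (productMap F) (productMap_pt F)).range

/-- The indecomposable part of `K_3(F)`: the cokernel of `K_3^M(F) → K_3(F)`. -/
abbrev K3ind (F : Type u) [Field F] : Type u := K3 F ⧸ K3dec F

end Symbol

section Functoriality

variable {F F' : Type u} [Field F] [Field F'] (f : F →+* F')

theorem blockSum_map (m n : ℕ) (p : GL (Fin m) F × GL (Fin n) F) :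
    Matrix.GeneralLinearGroup.map f (blockSum F m n p) =
      blockSum F' m n (Matrix.GeneralLinearGroup.map f p.1, Matrix.GeneralLinearGroup.map f p.2) := by
  refine Units.ext (Matrix.ext fun i j => ?_)
  refine Fin.addCases (fun i => ?_) (fun i => ?_) i <;>
    refine Fin.addCases (fun j => ?_) (fun j => ?_) j <;>
    simp [blockSum, MulEquiv.prodUnits, Matrix.GeneralLinearGroup.map]

/-- The map of `k`-simplices of `K`-theory spaces induced by a field homomorphism. -/
def KSimplex.map (k : ℕ) : KSimplex F k →* KSimplex F' k :=
  KSimplex.lift (fun x => ⟨x.1, x.2.map (Matrix.GeneralLinearGroup.map f)⟩) fun x y =>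
    congrArg (Sigma.mk (x.1 + y.1)) <| Subtype.ext <| funext fun i => funext fun j =>
      blockSum_map f x.1 y.1 (x.2.1 i j, y.2.1 i j)

/-- The map of `K`-theory spaces induced by a field homomorphism. -/
def KSpace.map : KSpace F ⟶ KSpace F' where
  app Δ := TypeCat.ofHom (KSimplex.map f Δ.unop.len)
  naturality Δ Δ' θ := by
    ext x
    refine DFunLike.congr_fun (PresentedGroup.ext
      (φ := (KSimplex.map f Δ'.unop.len).comp (KSimplex.pull θ.unop.toOrderHom))
      (ψ := (KSimplex.pull θ.unop.toOrderHom).comp (KSimplex.map f Δ.unop.len)) fun x => ?_) x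
    rfl

theorem KSpace.map_pt : (KSpace.map f).app (Opposite.op ⦋0⦌) (KSpace.pt F) = KSpace.pt F' :=
  map_one (KSimplex.map f 0)

theorem tripleProduct_map {k : ℕ} (x y z : Cocycle Fˣ k) :
    KSimplex.map f k (tripleProduct x y z) =
      tripleProduct (x.map (Units.map (f : F →* F'))) (y.map (Units.map (f : F →* F')))
        (z.map (Units.map (f : F →* F'))) := by
  have e : (Cocycle.triv Fˣ k).map (Units.map (f : F →* F')) = Cocycle.triv F'ˣ k :=
    Subtype.ext (funext fun _ => funext fun _ => map_one _)
  have h (x y z : Cocycle Fˣ k) : KSimplex.map f k (unitClass x y z) =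
      unitClass (x.map (Units.map (f : F →* F'))) (y.map (Units.map (f : F →* F')))
        (z.map (Units.map (f : F →* F'))) := by
    refine (KSimplex.lift_of _ _ _).trans (congrArg PresentedGroup.of (congrArg (Sigma.mk 1) ?_))
    refine Subtype.ext (funext fun i => funext fun j => Units.ext (Matrix.ext fun a b => ?_))
    obtain rfl := Subsingleton.elim a b
    simp [Cocycle.map, Matrix.GeneralLinearGroup.map, Matrix.GeneralLinearGroup.scalar]
  simp only [tripleProduct, map_mul, map_inv, h, e]

theorem productMap_map :
    productMap F ≫ KSpace.map f = Smash.map (Units.map (f : F →* F')) ≫ productMap F' := by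
  ext Δ ⟨t⟩
  exact tripleProduct_map f t.1 t.2.1 t.2.2

/-- The map of indecomposable parts induced by a field homomorphism. -/
def K3ind.map : K3ind F →+ K3ind F' :=
  QuotientAddGroup.map _ _ (Pi3.map (KSpace.map f) (KSpace.map_pt f)) <| by
    rintro _ ⟨α, rfl⟩
    have hpt : (Smash.map (Units.map (f : F →* F'))).app (Opposite.op ⦋0⦌) (Smash.pt Fˣ) =
        Smash.pt F'ˣ :=
      Quot.sound ⟨Degenerate.map _ (Or.inl rfl), Or.inl rfl⟩
    refine ⟨Pi3.map (Smash.map (Units.map (f : F →* F'))) hpt α, ?_⟩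
    have h₁ : (productMap F ≫ KSpace.map f).app (Opposite.op ⦋0⦌) (Smash.pt Fˣ) = KSpace.pt F' :=
      (congrArg ((KSpace.map f).app (Opposite.op ⦋0⦌)) (productMap_pt F)).trans (KSpace.map_pt f)
    have h₂ : (Smash.map (Units.map (f : F →* F')) ≫ productMap F').app (Opposite.op ⦋0⦌)
        (Smash.pt Fˣ) = KSpace.pt F' := by
      rw [← productMap_map]; exact h₁
    rw [Pi3.map_map _ _ _ _ h₂, Pi3.map_map _ _ _ _ h₁]
    congr 1
    simp only [productMap_map]

end Functoriality

end KTheory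

/-! ### Homology of general linear groups -/

/-- The homology group `H_n(GL_r(F), k)` with trivial coefficients `k`. -/
abbrev HGL (k : Type u) [CommRing k] (F : Type u) [Field F] (r n : ℕ) : ModuleCat.{u} k :=
  groupHomology (Rep.trivial k (GL (Fin r) F) k) n

/-- The map on homology with trivial coefficients induced by a group homomorphism. -/
def homologyMap (k : Type u) [CommRing k] {G H : Type u} [Group G] [Group H] (φ : G →* H) (n : ℕ) :
    groupHomology (Rep.trivial k G k) n →ₗ[k] groupHomology (Rep.trivial k H k) n :=
  (groupHomology.map (A := Rep.trivial k G k) (B := Rep.trivial k H k) φ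
    (𝟙 (Rep.trivial k G k)) n).hom

/-- The embedding `GL_r(F) → GL_{r+1}(F)`, `A ↦ diag(A, 1)`. -/
def stab (F : Type u) [Field F] (r : ℕ) : GL (Fin r) F →* GL (Fin (r + 1)) F :=
  Units.map
    { toFun := fun A => Matrix.reindex finSumFinEquiv finSumFinEquiv
        (Matrix.fromBlocks A 0 0 (1 : Matrix (Fin 1) (Fin 1) F))
      map_one' := by simp
      map_mul' := fun A B => by simp [Matrix.submatrix_mul_equiv, Matrix.fromBlocks_multiply] }

/-- The kernel of `H_n(GL_{n-1}(F), k) → H_n(GL_n(F), k)`, for `n ≥ 1`. -/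
def StabKer (k : Type u) [CommRing k] (F : Type u) [Field F] (n : ℕ) : Type u :=
  LinearMap.ker (homologyMap k (stab F (n - 1)) n)

section StabKer

variable (k : Type u) [CommRing k] (F : Type u) [Field F] (n : ℕ)

instance : AddCommGroup (StabKer k F n) :=
  inferInstanceAs (AddCommGroup (LinearMap.ker (homologyMap k (stab F (n - 1)) n)))

instance : Module k (StabKer k F n) :=
  inferInstanceAs (Module k (LinearMap.ker (homologyMap k (stab F (n - 1)) n)))

/-- The inclusion of the kernel into `H_n(GL_{n-1}(F), k)`. -/
def StabKer.incl : StabKer k F n →ₗ[k] HGL k F (n - 1) n :=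
  (LinearMap.ker (homologyMap k (stab F (n - 1)) n)).subtype

end StabKer

/-- The invertible diagonal matrix with diagonal `d`. -/
def diagGL {F : Type u} [Field F] {r : ℕ} (d : Fin r → Fˣ) : GL (Fin r) F where
  val := Matrix.diagonal fun i => (d i : F)
  inv := Matrix.diagonal fun i => ((d i)⁻¹ : Fˣ)
  val_inv := by simp [Matrix.diagonal_mul_diagonal]
  inv_val := by simp [Matrix.diagonal_mul_diagonal]

/-- The matrix `C_{i+1,r}(c)` of size `r`: the matrix `diag(c, 1, …, 1)` for `i = 0`, and
`diag(c, …, c, c^{-i}, 1, …, 1)`, with `i` entries `c`, for `i ≥ 1`. -/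
def hurewiczMatrix {F : Type u} [Field F] (r i : ℕ) (c : Fˣ) : GL (Fin r) F :=
  diagGL fun j => if j.val < i then c else if j.val = i then (if i = 0 then c else c ^ (-(i : ℤ)))
    else 1

/-- The bar chain `𝐜(g_1, …, g_n) = ∑_σ sign(σ) [g_{σ(1)} | ⋯ | g_{σ(n)}]`. -/
def cChain (k : Type u) [CommRing k] {G : Type u} [Group G] {n : ℕ} (g : Fin n → G) :
    (Fin n → G) →₀ k :=
  ∑ σ : Equiv.Perm (Fin n), Finsupp.single (g ∘ σ) ((Equiv.Perm.sign σ : ℤ) : k)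

/-- The homology class `h` is represented by the bar chain `z` (which, in particular, is a
cycle). -/
def IsRepresentedBy {k : Type u} [CommRing k] {G : Type u} [Group G] {n : ℕ}
    (h : groupHomology (Rep.trivial k G k) n) (z : (Fin n → G) →₀ k) : Prop :=
  ∃ y : groupHomology.cycles (Rep.trivial k G k) n,
    groupHomology.iCycles (Rep.trivial k G k) n y = z ∧ groupHomology.π (Rep.trivial k G k) n y = h

/-- The list of `q + 3` commuting matrices
`diag(1, …, 1, b), diag(a, …, a, 1), C_{1,q+2}(c_1), …, C_{q+1,q+2}(c_{q+1})` of size `q + 2`. -/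
def commutingTuple {F : Type u} [Field F] {q : ℕ} (a b : Fˣ) (c : Fin (q + 1) → Fˣ) :
    Fin (q + 3) → GL (Fin (q + 2)) F :=
  Fin.cons (diagGL fun j => if j = Fin.last (q + 1) then b else 1) <|
    Fin.cons (diagGL fun j => if j = Fin.last (q + 1) then 1 else a) fun i =>
      hurewiczMatrix (q + 2) i (c i)

/-- For `n = q + 3`, the bar chain
`-∑ (𝐜(diag(I_{n-2}, b), diag(a I_{n-2}, 1), C_{1,n-1}, …, C_{n-2,n-1})
    + 𝐜(diag(I_{n-2}, a), diag(b I_{n-2}, 1), C_{1,n-1}, …, C_{n-2,n-1}))`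
of `GL_{n-1}(F)` attached to a finite sum `∑ a ⊗ b ⊗ {c_1, …, c_{n-2}}`. -/
def wChain (k : Type u) [CommRing k] {F : Type u} [Field F] {q m : ℕ} (a b : Fin m → Fˣ)
    (c : Fin m → Fin (q + 1) → Fˣ) : (Fin (q + 3) → GL (Fin (q + 2)) F) →₀ k :=
  -∑ i, (cChain k (commutingTuple (a i) (b i) (c i)) + cChain k (commutingTuple (b i) (a i) (c i)))

/-! ### The groups `B_n(F)` -/

/-- The group `B_n(F)` for `n ≥ 1`, as an object of the category of abelian groups: it is `0` for
`n = 1`, `K_3^ind(F)` for `n = 2` and `ker(δ₂) / im(δ₃)` for `n ≥ 3`.  The value at `n = 0` is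
irrelevant. -/
def BObj (F : Type u) [Field F] : ℕ → AddCommGrpCat.{u}
  | 0 => AddCommGrpCat.of PUnit
  | 1 => AddCommGrpCat.of PUnit
  | 2 => AddCommGrpCat.of (K3ind F)
  | q + 3 => AddCommGrpCat.of (BMilnor F q)

/-- The group `B_n(F)`. -/
def BGroup (F : Type u) [Field F] (n : ℕ) : Type u := BObj F n

instance (F : Type u) [Field F] (n : ℕ) : AddCommGroup (BGroup F n) :=
  inferInstanceAs (AddCommGroup (BObj F n))

/-- The map `B_n(F) → B_n(F')` induced by a field homomorphism. -/
def BGroup.map {F F' : Type u} [Field F] [Field F'] (f : F →+* F') :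
    ∀ n : ℕ, BGroup F n →+ BGroup F' n
  | 0 => 0
  | 1 => 0
  | 2 => K3ind.map f
  | q + 3 => (BMilnor.map f q).toAddMonoidHom

/-- Multiplication by `n - 2` on `B_n(F)`; its range is `(n - 2) B_n(F)`. -/
def BGroup.mulSubTwo (F : Type u) [Field F] (n : ℕ) : BGroup F n →+ BGroup F n :=
  zsmulAddGroupHom ((n : ℤ) - 2)

/-- The element `∑ a ⊗ b ⊗ {c_1, …, c_p}` of `Fˣ ⊗ Fˣ ⊗ K_p^M(F)`. -/
def milnorSum {F : Type u} [Field F] {p m : ℕ} (a b : Fin m → Fˣ) (c : Fin m → Fin p → Fˣ) :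
    Tensor₂ ℤ (Ab F) (KM F p) :=
  ∑ i, Additive.ofMul (a i) ⊗ₜ (Additive.ofMul (b i) ⊗ₜ KM.symbol (c i))

/-- The class in `B_{q+3}(F)` of an element of the kernel of `δ₂`. -/
def BGroup.mk {F : Type u} [Field F] {q : ℕ} (x : Tensor₂ ℤ (Ab F) (KM F (q + 1)))
    (hx : δ₂ F (q + 1) x = 0) : BGroup F (q + 3) :=
  (Submodule.Quotient.mk (⟨x, hx⟩ : LinearMap.ker (δ₂ F (q + 1))) : BMilnor F q)

/-! ### Coefficient rings -/

/-- The ring `ℤ`, in the universe of the field. -/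
abbrev ZCoeff : Type u := ULift.{u} ℤ

/-- The ring `ℤ[1/m]`, in the universe of the field. -/
def ZInv (m : ℕ) : Type u := ULift.{u} (Localization.Away (m : ℤ))

instance (m : ℕ) : CommRing (ZInv.{u} m) :=
  inferInstanceAs (CommRing (ULift.{u} (Localization.Away (m : ℤ))))

/-- The isomorphism of `ZInv m` with the localization `ℤ[1/m]`. -/
def ZInv.equiv (m : ℕ) : ZInv.{u} m ≃+* Localization.Away (m : ℤ) := ULift.ringEquiv

/-- The element `1/m` of `ℤ[1/m]`. -/
def ZInv.inv (m : ℕ) : ZInv.{u} m :=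
  (ZInv.equiv m).symm (IsLocalization.Away.invSelf (m : ℤ))

theorem ZInv.natCast_mul_inv (m : ℕ) : (m : ZInv.{u} m) * ZInv.inv m = 1 := by
  apply (ZInv.equiv.{u} m).injective
  have h := IsLocalization.Away.mul_invSelf (S := Localization.Away (m : ℤ)) (m : ℤ)
  simpa [ZInv.inv] using h

end

end GLHom

/-! The chain `𝐜(g_1, …, g_n)` of diagonal matrices is a cycle, and modulo boundaries it is
multilinear and alternating in the `g_i`. This gives the alternating map `torusSymb` on the torus of
`GL_r(F)`, with values in chains modulo boundaries, into which homology embeds (`homologyToQuot`).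
Conjugation by permutation matrices shows that it does not change when the coordinates of all
arguments are permuted simultaneously (`torusSymb_perm`).

The other input is the Steinberg relation: for `a + b = 1` the chain `𝐜(diag(a, 1), diag(b, b⁻¹))`
bounds in `GL_2(F)` (`symb_steinberg_two`). It says that lifts of the two matrices commute in the
central extension with cocycle `(g, h) ↦ [g | h]`, which follows from a computation with Weyl
elements, as in Matsumoto's theorem (`central_steinberg`). From these two facts alone, the value of
`torusSymb` on `C_1(c_1), …, C_p(c_p)`, together with further arguments that are constant on the
first `p` coordinates, depends only on the symbol `{c_1, …, c_p}` (`symbolValue_perm`,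
`symbolValue_steinberg`, `symbolHom`).

The rest is linear algebra with cocharacters. Let `n = q + 3`, let `e` be the last coordinate of
`GL_{n-1}`, let `C` be the cocharacter of `C_{n-1,n-1}`, and let `G` be `torusSymb` as a form in two
arguments, the others being `C_1(c_1), …, C_{n-2}(c_{n-2})`. The cocharacter `diag(a I_{n-2}, 1)` is
`C + (n-2)e`, and the scalar one is `C + (n-1)e`. After symmetrization in `a` and `b` the terms
`G(C, C)` and `G(e, e)` cancel, so that `-w(x)` is the symmetrization of `G(e(a), C(b))`, and
pairing `δ₂ x` with scalar matrices gives `n - 1` times it. Hence `(n-1) w(x) = 0` on `ker δ₂`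
(`smul_wHom`), and `w` equals `n - 2` times a map (`wHom_eq`) that kills the image of `δ₃`
(`wHom'_delta₃`). In `GL_n` there is one more coordinate; exchanging it with the previous one shows
that the stabilization of `w(x)` depends only on `δ₂ x` (`symPhi_eq_psi`, `map_stab_wBar`), so it
vanishes on `ker δ₂`.

Therefore `φ_n` is `n - 2` times a homomorphism defined on all of `B_n(F)`, which gives the
factorization. The map `κ_n` is a scalar multiple of the base change of `φ_n`, constructed with
coefficients in `R_n`. -/

namespace GLHom
noncomputable section

/-! ### The bar complex with trivial coefficients -/

/-- Inhomogeneous chains of degree `n` with trivial coefficients. -/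
abbrev Bar (k : Type u) [CommRing k] (G : Type u) (n : ℕ) : Type u := (Fin n → G) →₀ k

namespace Bar

variable (k : Type u) [CommRing k] {G H : Type u} [Group G] [Group H]

/-- The generator `[x_1 | ⋯ | x_n]`. -/
abbrev word {G : Type u} {n : ℕ} (x : Fin n → G) : Bar k G n := Finsupp.single x 1

/-- The linear map prescribed on the generators. -/
abbrev ofWords {G : Type u} {M : Type*} [AddCommGroup M] [Module k M] {n : ℕ}
    (f : (Fin n → G) → M) : Bar k G n →ₗ[k] M := Finsupp.linearCombination k f

variable {k} in
theorem ofWords_word {G : Type u} {M : Type*} [AddCommGroup M] [Module k M] {n : ℕ}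
    (f : (Fin n → G) → M) (x : Fin n → G) : ofWords k f (word k x) = f x := by simp

variable {k} in
theorem hom_ext {G : Type u} {M : Type*} [AddCommGroup M] [Module k M] {n : ℕ}
    {f g : Bar k G n →ₗ[k] M} (h : ∀ x, f (word k x) = g (word k x)) : f = g :=
  Finsupp.lhom_ext' fun x => LinearMap.ext_ring (h x)

/-- The boundary of the bar complex. -/
def d (G : Type u) [Group G] (n : ℕ) : Bar k G (n + 1) →ₗ[k] Bar k G n :=
  (groupHomology.inhomogeneousChains.d (Rep.trivial k G k) n).hom

/-- The boundary without its first face. -/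
def dInner (G : Type u) [Group G] (n : ℕ) : Bar k G (n + 1) →ₗ[k] Bar k G n :=
  ofWords k fun x => ∑ j : Fin (n + 1), (-1 : k) ^ ((j : ℕ) + 1) • word k (Fin.contractNth j (· * ·) x)

/-- Prefixing a letter. -/
def cons {G : Type u} (n : ℕ) (g : G) : Bar k G n →ₗ[k] Bar k G (n + 1) :=
  ofWords k fun x => word k (Fin.cons g x : Fin (n + 1) → G)

/-- Dropping the first letter. -/
def tail (G : Type u) (n : ℕ) : Bar k G (n + 1) →ₗ[k] Bar k G n :=
  ofWords k fun x => word k (Fin.tail x)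

/-- Multiplying the first letter by a group element. -/
def merge (g : G) : ∀ n : ℕ, Bar k G n →ₗ[k] Bar k G n
  | 0 => LinearMap.id
  | _ + 1 => ofWords k fun x => word k (Fin.cons (g * x 0) (Fin.tail x))

/-- The chain map induced by a homomorphism. -/
def map (f : G →* H) (n : ℕ) : Bar k G n →ₗ[k] Bar k H n :=
  ofWords k fun x => word k (f ∘ x)

variable {k} {n : ℕ}

@[simp] theorem cons_word {G : Type u} (g : G) (x : Fin n → G) :
    cons k n g (word k x) = word k (Fin.cons g x : Fin (n + 1) → G) := ofWords_word _ _

@[simp] theorem tail_cons {G : Type u} (g : G) (z : Bar k G n) : tail k G n (cons k n g z) = z := by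
  refine DFunLike.congr_fun (hom_ext (f := tail k G n ∘ₗ cons k n g) (g := LinearMap.id)
    fun x => ?_) z
  simp [tail]

@[simp] theorem merge_cons (g g' : G) (z : Bar k G n) :
    merge k g (n + 1) (cons k n g' z) = cons k n (g * g') z := by
  refine DFunLike.congr_fun (hom_ext (f := merge k g (n + 1) ∘ₗ cons k n g')
    (g := cons k n (g * g')) fun x => ?_) z
  simp [merge]

@[simp] theorem merge_zero (g : G) (z : Bar k G 0) : merge k g 0 z = z := rfl

@[simp] theorem map_word (f : G →* H) (x : Fin n → G) : map k f n (word k x) = word k (f ∘ x) :=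
  ofWords_word _ _

@[simp] theorem map_cons (f : G →* H) (g : G) (z : Bar k G n) :
    map k f (n + 1) (cons k n g z) = cons k n (f g) (map k f n z) := by
  refine DFunLike.congr_fun (hom_ext (f := map k f (n + 1) ∘ₗ cons k n g)
    (g := cons k n (f g) ∘ₗ map k f n) fun x => ?_) z
  simp [Fin.comp_cons]

/-- Chains of positive degree are spanned by the chains `[g | z]`. -/
theorem hom_ext_cons {G : Type u} {M : Type*} [AddCommGroup M] [Module k M]
    {f g : Bar k G (n + 1) →ₗ[k] M} (h : ∀ a z, f (cons k n a z) = g (cons k n a z)) : f = g :=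
  hom_ext fun x => by simpa using h (x 0) (word k (Fin.tail x))

theorem d_word (x : Fin (n + 1) → G) : d k G n (word k x) = word k (Fin.tail x) +
    ∑ j : Fin (n + 1), (-1 : k) ^ ((j : ℕ) + 1) • word k (Fin.contractNth j (· * ·) x) :=
  groupHomology.inhomogeneousChains.d_single (A := Rep.trivial k G k) n x 1

/-- `dInner` obeys a recursion in the first letter that involves only itself and `merge`
(`dInner_cons`). The homotopy formulas below are proved by induction for `tail` and `dInner`
separately and then added. -/
theorem d_eq (z : Bar k G (n + 1)) : d k G n z = tail k G n z + dInner k G n z := by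
  refine DFunLike.congr_fun (hom_ext (f := d k G n) (g := tail k G n + dInner k G n)
    fun x => ?_) z
  rw [d_word, LinearMap.add_apply, tail, dInner, ofWords_word, ofWords_word]

/-- In degree one the only face besides the first is the last one, which deletes the single letter;
hence there is no `merge` term as in `dInner_cons`. -/
theorem dInner_zero (g : G) (z : Bar k G 0) : dInner k G 0 (cons k 0 g z) = -z := by
  refine DFunLike.congr_fun (hom_ext (f := dInner k G 0 ∘ₗ cons k 0 g) (g := -LinearMap.id)
    fun x => ?_) z
  simp only [LinearMap.comp_apply, cons_word, dInner, ofWords_word]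
  simp [Subsingleton.elim (Fin.contractNth 0 (· * ·) (Fin.cons g x : Fin 1 → G)) x]

theorem contractNth_zero_cons (g : G) (x : Fin (n + 1) → G) :
    Fin.contractNth 0 (· * ·) (Fin.cons g x : Fin (n + 2) → G) =
      Fin.cons (g * x 0) (Fin.tail x) := by
  funext i
  refine Fin.cases ?_ (fun i => ?_) i
  · rw [Fin.contractNth_apply_of_eq _ _ _ _ (by simp)]; simp
  · rw [Fin.contractNth_apply_of_gt _ _ _ _ (by simp)]; simp [Fin.tail]

theorem contractNth_succ_cons (j : Fin (n + 1)) (g : G) (x : Fin (n + 1) → G) :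
    Fin.contractNth j.succ (· * ·) (Fin.cons g x : Fin (n + 2) → G) =
      Fin.cons g (Fin.contractNth j (· * ·) x) := by
  funext i
  refine Fin.cases ?_ (fun i => ?_) i
  · rw [Fin.contractNth_apply_of_lt _ _ _ _ (by simp)]; simp
  · rw [Fin.cons_succ]
    rcases lt_trichotomy (i : ℕ) j with h | h | h
    · rw [Fin.contractNth_apply_of_lt _ _ _ _ (by simpa using h),
        Fin.contractNth_apply_of_lt _ _ _ _ h, ← Fin.succ_castSucc, Fin.cons_succ]
    · rw [Fin.contractNth_apply_of_eq _ _ _ _ (by simpa using h),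
        Fin.contractNth_apply_of_eq _ _ _ _ h, ← Fin.succ_castSucc, Fin.cons_succ, Fin.cons_succ]
    · rw [Fin.contractNth_apply_of_gt _ _ _ _ (by simpa using h),
        Fin.contractNth_apply_of_gt _ _ _ _ h, Fin.cons_succ]

theorem dInner_cons (g : G) (z : Bar k G (n + 1)) : dInner k G (n + 1) (cons k (n + 1) g z) =
    -merge k g (n + 1) z - cons k n g (dInner k G n z) := by
  refine DFunLike.congr_fun (hom_ext (f := dInner k G (n + 1) ∘ₗ cons k (n + 1) g)
    (g := -merge k g (n + 1) - cons k n g ∘ₗ dInner k G n) fun x => ?_) z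
  simp only [LinearMap.comp_apply, cons_word, dInner, ofWords_word, LinearMap.sub_apply,
    LinearMap.neg_apply, merge, map_sum, map_smul]
  rw [Fin.sum_univ_succ, contractNth_zero_cons]
  simp only [contractNth_succ_cons, Fin.val_zero, Fin.val_succ, zero_add, pow_one, neg_smul,
    one_smul, pow_succ (-1 : k) (_ + 1), mul_neg, mul_one, Finset.sum_neg_distrib, sub_eq_add_neg]

theorem map_merge (f : G →* H) (g : G) : ∀ {n : ℕ} (z : Bar k G n),
    map k f n (merge k g n z) = merge k (f g) n (map k f n z)
  | 0, _ => rfl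
  | n + 1, z => by
    refine DFunLike.congr_fun (hom_ext_cons (f := map k f (n + 1) ∘ₗ merge k g (n + 1))
      (g := merge k (f g) (n + 1) ∘ₗ map k f (n + 1)) fun a z => ?_) z
    simp

theorem map_dInner (f : G →* H) : ∀ {n : ℕ} (z : Bar k G (n + 1)),
    map k f n (dInner k G n z) = dInner k H n (map k f (n + 1) z)
  | 0, z => by
    refine DFunLike.congr_fun (hom_ext_cons (f := map k f 0 ∘ₗ dInner k G 0)
      (g := dInner k H 0 ∘ₗ map k f 1) fun a z => ?_) z
    simp [dInner_zero]
  | n + 1, z => by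
    refine DFunLike.congr_fun (hom_ext_cons (f := map k f (n + 1) ∘ₗ dInner k G (n + 1))
      (g := dInner k H (n + 1) ∘ₗ map k f (n + 2)) fun a z => ?_) z
    simp [dInner_cons, map_merge, map_dInner f]

theorem map_tail (f : G →* H) (z : Bar k G (n + 1)) :
    map k f n (tail k G n z) = tail k H n (map k f (n + 1) z) := by
  refine DFunLike.congr_fun (hom_ext_cons (f := map k f n ∘ₗ tail k G n)
    (g := tail k H n ∘ₗ map k f (n + 1)) fun a z => ?_) z
  simp

theorem map_d (f : G →* H) (z : Bar k G (n + 1)) :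
    map k f n (d k G n z) = d k H n (map k f (n + 1) z) := by
  rw [d_eq, d_eq, map_add, map_dInner, map_tail]

/-! ### Prism operators -/

variable (k) in
/-- The prism operator
`[g_1 | ⋯ | g_n] ↦ ∑ (-1)^i [f g_1 | ⋯ | f g_i | h | f' g_{i+1} | ⋯ | f' g_n]`. -/
def prism (f f' : G →* H) (h : H) : ∀ n : ℕ, Bar k G n →ₗ[k] Bar k H (n + 1)
  | 0 => cons k 0 h ∘ₗ map k f' 0
  | n + 1 => cons k (n + 1) h ∘ₗ map k f' (n + 1) -
      ofWords k fun x => cons k (n + 1) (f (x 0)) (prism f f' h n (word k (Fin.tail x)))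

theorem prism_cons (f f' : G →* H) (h : H) (g : G) (z : Bar k G n) :
    prism k f f' h (n + 1) (cons k n g z) =
      cons k (n + 1) h (cons k n (f' g) (map k f' n z)) -
        cons k (n + 1) (f g) (prism k f f' h n z) := by
  refine DFunLike.congr_fun (hom_ext (f := prism k f f' h (n + 1) ∘ₗ cons k n g)
    (g := cons k (n + 1) h ∘ₗ cons k n (f' g) ∘ₗ map k f' n -
      cons k (n + 1) (f g) ∘ₗ prism k f f' h n) fun x => ?_) z
  simp only [LinearMap.comp_apply, LinearMap.sub_apply, prism, ← map_cons, cons_word, ofWords_word,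
    Fin.cons_zero, Fin.tail_cons]

theorem prism_zero (f f' : G →* H) (h : H) (z : Bar k G 0) :
    prism k f f' h 0 z = cons k 0 h (map k f' 0 z) := rfl

theorem tail_prism (f f' : G →* H) (h : H) (z : Bar k G (n + 1)) :
    tail k H (n + 1) (prism k f f' h (n + 1) z) =
      map k f' (n + 1) z - prism k f f' h n (tail k G n z) := by
  refine DFunLike.congr_fun (hom_ext_cons (f := tail k H (n + 1) ∘ₗ prism k f f' h (n + 1))
    (g := map k f' (n + 1) - prism k f f' h n ∘ₗ tail k G n) fun a z => ?_) z
  simp [prism_cons]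

/-- Multiplying the first letter of the prism by `f g` gives the wrong leading word, with first
letter `f g * h`. By `hc` it is cancelled by the first term, and the second term supplies the right
one, in which `h` precedes the merged letter. -/
theorem prism_merge {f f' : G →* H} {h : H} (hc : ∀ g, h * f' g = f g * h) (g : G) :
    ∀ {n : ℕ} (z : Bar k G n), prism k f f' h n (merge k g n z) =
      -cons k n (h * f' g) (map k f' n z) + cons k n h (merge k (f' g) n (map k f' n z)) +
        merge k (f g) (n + 1) (prism k f f' h n z)
  | 0, z => by simp [prism_zero, hc]
  | n + 1, z => by
    refine DFunLike.congr_fun (hom_ext_cons (f := prism k f f' h (n + 1) ∘ₗ merge k g (n + 1))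
      (g := -(cons k (n + 1) (h * f' g) ∘ₗ map k f' (n + 1)) +
        cons k (n + 1) h ∘ₗ merge k (f' g) (n + 1) ∘ₗ map k f' (n + 1) +
        merge k (f g) (n + 2) ∘ₗ prism k f f' h (n + 1)) fun a z => ?_) z
    simp only [LinearMap.comp_apply, LinearMap.add_apply, LinearMap.neg_apply, merge_cons,
      prism_cons, map_cons, map_mul, map_sub, hc]
    abel

theorem dInner_prism_zero (f f' : G →* H) (h : H) (z : Bar k G 0) :
    dInner k H 0 (prism k f f' h 0 z) = -map k f' 0 z := by
  rw [prism_zero, dInner_zero]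

theorem map_zero_eq (f f' : G →* H) (z : Bar k G 0) : map k f 0 z = map k f' 0 z := by
  refine DFunLike.congr_fun (hom_ext (f := map k f 0) (g := map k f' 0) fun x => ?_) z
  rw [map_word, map_word, Subsingleton.elim (f ∘ x) (f' ∘ x)]

theorem dInner_prism {f f' : G →* H} {h : H} (hc : ∀ g, h * f' g = f g * h) :
    ∀ {n : ℕ} (z : Bar k G (n + 1)), dInner k H (n + 1) (prism k f f' h (n + 1) z) =
      -map k f (n + 1) z - prism k f f' h n (dInner k G n z)
  | 0, z => by
    refine DFunLike.congr_fun (hom_ext_cons (f := dInner k H 1 ∘ₗ prism k f f' h 1)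
      (g := -map k f 1 - prism k f f' h 0 ∘ₗ dInner k G 0) fun a z => ?_) z
    simp only [LinearMap.comp_apply, LinearMap.sub_apply, LinearMap.neg_apply, prism_cons, map_sub,
      dInner_cons, merge_cons, dInner_zero, prism_zero, map_cons, map_neg, hc,
      map_zero_eq (k := k) f' f]
    abel
  | n + 1, z => by
    refine DFunLike.congr_fun (hom_ext_cons (f := dInner k H (n + 2) ∘ₗ prism k f f' h (n + 2))
      (g := -map k f (n + 2) - prism k f f' h (n + 1) ∘ₗ dInner k G (n + 1)) fun a z => ?_) z
    simp only [LinearMap.comp_apply, LinearMap.sub_apply, LinearMap.neg_apply, prism_cons, map_sub,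
      dInner_cons, merge_cons, map_cons, map_neg, prism_merge hc, map_dInner, dInner_prism hc z]
    abel

/-- The homotopy formula for the prism operator. -/
theorem d_prism {f f' : G →* H} {h : H} (hc : ∀ g, h * f' g = f g * h) (z : Bar k G (n + 1)) :
    d k H (n + 1) (prism k f f' h (n + 1) z) =
      map k f' (n + 1) z - map k f (n + 1) z - prism k f f' h n (d k G n z) := by
  rw [d_eq, d_eq, dInner_prism hc, tail_prism, map_add]
  abel

theorem d_prism_zero (f f' : G →* H) (h : H) (z : Bar k G 0) :
    d k H 0 (prism k f f' h 0 z) = 0 := by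
  rw [d_eq, dInner_prism_zero, prism_zero, tail_cons, add_neg_cancel]

variable (k) in
/-- The shuffle product with the chain `[h | h']`. -/
def doublePrism (h h' : G) : ∀ n : ℕ, Bar k G n →ₗ[k] Bar k G (n + 2)
  | 0 => cons k 1 h ∘ₗ prism k (.id G) (.id G) h' 0
  | n + 1 => cons k (n + 2) h ∘ₗ prism k (.id G) (.id G) h' (n + 1) +
      ofWords k fun x => cons k (n + 2) (x 0) (doublePrism h h' n (word k (Fin.tail x)))

@[simp] theorem map_id (z : Bar k G n) : map k (.id G) n z = z := by
  refine DFunLike.congr_fun (hom_ext (f := map k (.id G) n) (g := LinearMap.id) fun x => ?_) z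
  simp only [map_word, LinearMap.id_apply]
  rfl

theorem doublePrism_cons (h h' g : G) (z : Bar k G n) :
    doublePrism k h h' (n + 1) (cons k n g z) =
      cons k (n + 2) h (prism k (.id G) (.id G) h' (n + 1) (cons k n g z)) +
        cons k (n + 2) g (doublePrism k h h' n z) := by
  refine DFunLike.congr_fun (hom_ext (f := doublePrism k h h' (n + 1) ∘ₗ cons k n g)
    (g := cons k (n + 2) h ∘ₗ prism k (.id G) (.id G) h' (n + 1) ∘ₗ cons k n g +
      cons k (n + 2) g ∘ₗ doublePrism k h h' n) fun x => ?_) z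
  simp only [LinearMap.comp_apply, LinearMap.add_apply, doublePrism, cons_word, ofWords_word,
    Fin.cons_zero, Fin.tail_cons]

theorem doublePrism_zero (h h' : G) (z : Bar k G 0) :
    doublePrism k h h' 0 z = cons k 1 h (prism k (.id G) (.id G) h' 0 z) := rfl

theorem tail_doublePrism (h h' : G) (z : Bar k G (n + 1)) :
    tail k G (n + 2) (doublePrism k h h' (n + 1) z) =
      prism k (.id G) (.id G) h' (n + 1) z + doublePrism k h h' n (tail k G n z) := by
  refine DFunLike.congr_fun (hom_ext_cons (f := tail k G (n + 2) ∘ₗ doublePrism k h h' (n + 1))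
    (g := prism k (.id G) (.id G) h' (n + 1) + doublePrism k h h' n ∘ₗ tail k G n)
    fun a z => ?_) z
  simp [doublePrism_cons]

theorem dInner_doublePrism_zero (h h' : G) (z : Bar k G 0) :
    dInner k G 1 (doublePrism k h h' 0 z) =
      prism k (.id G) (.id G) h 0 z - prism k (.id G) (.id G) (h * h') 0 z := by
  simp only [doublePrism_zero, prism_zero, dInner_cons, dInner_zero, merge_cons, map_id, map_neg]
  abel

end Bar

/-! ### Homotopies for products, and alternating chains -/

namespace Bar

variable {k : Type u} [CommRing k] {G H : Type u} [Group G] [Group H] {n : ℕ}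

theorem doublePrism_merge (h h' g : G) : ∀ {n : ℕ} (z : Bar k G n),
    doublePrism k h h' n (merge k g n z) =
      cons k (n + 1) h (prism k (.id G) (.id G) h' n (merge k g n z)) +
        merge k g (n + 2) (doublePrism k h h' n z) -
        cons k (n + 1) (g * h) (prism k (.id G) (.id G) h' n z)
  | 0, z => by simp [doublePrism_zero]
  | n + 1, z => by
    refine DFunLike.congr_fun (hom_ext_cons (f := doublePrism k h h' (n + 1) ∘ₗ merge k g (n + 1))
      (g := cons k (n + 2) h ∘ₗ prism k (.id G) (.id G) h' (n + 1) ∘ₗ merge k g (n + 1) +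
        merge k g (n + 3) ∘ₗ doublePrism k h h' (n + 1) -
        cons k (n + 2) (g * h) ∘ₗ prism k (.id G) (.id G) h' (n + 1)) fun a z => ?_) z
    simp only [LinearMap.comp_apply, LinearMap.add_apply, LinearMap.sub_apply, merge_cons,
      doublePrism_cons, map_add]
    abel

theorem dInner_doublePrism {h h' : G} (hh : ∀ g, h * g = g * h) (hh' : ∀ g, h' * g = g * h')
    (z : Bar k G (n + 1)) : dInner k G (n + 2) (doublePrism k h h' (n + 1) z) =
      prism k (.id G) (.id G) h (n + 1) z - prism k (.id G) (.id G) (h * h') (n + 1) z +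
        doublePrism k h h' n (dInner k G n z) := by
  induction n with
  | zero =>
    refine DFunLike.congr_fun (hom_ext_cons (f := dInner k G 2 ∘ₗ doublePrism k h h' 1)
      (g := prism k (.id G) (.id G) h 1 - prism k (.id G) (.id G) (h * h') 1 +
        doublePrism k h h' 0 ∘ₗ dInner k G 0) fun a z => ?_) z
    simp only [LinearMap.comp_apply, LinearMap.add_apply, LinearMap.sub_apply,
      doublePrism_cons, map_add, map_sub, map_neg, dInner_cons, dInner_zero, prism_cons, merge_cons,
      map_id, MonoidHom.id_apply, doublePrism_zero, prism_zero, hh, hh' a]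
    abel
  | succ n ih =>
    refine DFunLike.congr_fun (hom_ext_cons (f := dInner k G (n + 3) ∘ₗ doublePrism k h h' (n + 2))
      (g := prism k (.id G) (.id G) h (n + 2) - prism k (.id G) (.id G) (h * h') (n + 2) +
        doublePrism k h h' (n + 1) ∘ₗ dInner k G (n + 1)) fun a z => ?_) z
    have hm : doublePrism k h h' (n + 1) (merge k a (n + 1) z) =
        cons k (n + 2) h (prism k (.id G) (.id G) h' (n + 1) (merge k a (n + 1) z)) +
          merge k a (n + 2 + 1) (doublePrism k h h' (n + 1) z) -
          cons k (n + 2) (a * h) (prism k (.id G) (.id G) h' (n + 1) z) :=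
      doublePrism_merge h h' a z
    simp only [LinearMap.comp_apply, LinearMap.add_apply, LinearMap.sub_apply,
      doublePrism_cons, hm, prism_merge (f := .id G) (f' := .id G) hh', map_add, map_sub, map_neg, dInner_cons, ih,
      dInner_prism (f := .id G) (f' := .id G) hh', prism_cons,
      merge_cons, map_id, MonoidHom.id_apply, hh]
    abel

/-- The Leibniz rule for the shuffle product with `[h | h']`, whose own boundary is `[h] + [h'] - [h
h']`. The last sign is positive because `[h | h']` has even degree. -/
theorem d_doublePrism {h h' : G} (hh : ∀ g, h * g = g * h) (hh' : ∀ g, h' * g = g * h')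
    (z : Bar k G (n + 1)) : d k G (n + 2) (doublePrism k h h' (n + 1) z) =
      prism k (.id G) (.id G) h (n + 1) z + prism k (.id G) (.id G) h' (n + 1) z -
        prism k (.id G) (.id G) (h * h') (n + 1) z + doublePrism k h h' n (d k G n z) := by
  rw [d_eq, d_eq, dInner_doublePrism hh hh', tail_doublePrism, map_add]
  abel

theorem d_doublePrism_zero (h h' : G) (z : Bar k G 0) : d k G 1 (doublePrism k h h' 0 z) =
      prism k (.id G) (.id G) h 0 z + prism k (.id G) (.id G) h' 0 z -
        prism k (.id G) (.id G) (h * h') 0 z := by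
  rw [d_eq, dInner_doublePrism_zero, doublePrism_zero, tail_cons]
  abel

/-! ### Alternating chains -/

theorem prism_id_word (h : G) : ∀ {n : ℕ} (x : Fin n → G),
    prism k (.id G) (.id G) h n (word k x) =
      ∑ i : Fin (n + 1), (-1 : k) ^ (i : ℕ) • word k (i.insertNth h x : Fin (n + 1) → G)
  | 0, x => by
    rw [prism_zero, map_id, cons_word, Fin.sum_univ_one, Fin.insertNth_zero']
    simp
  | n + 1, x => by
    obtain ⟨a, y, rfl⟩ : ∃ a y, x = Fin.cons a y := ⟨x 0, Fin.tail x, (Fin.cons_self_tail x).symm⟩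
    rw [← cons_word, prism_cons, prism_id_word h y, Fin.sum_univ_succ (n := n + 1), Fin.insertNth_zero']
    simp only [map_id, MonoidHom.id_apply, cons_word, map_sum, map_smul, Fin.insertNth_succ_cons,
      Fin.val_zero, pow_zero, one_smul, Fin.val_succ, pow_succ, mul_neg, mul_one, neg_smul,
      Finset.sum_neg_distrib, sub_eq_add_neg]

/-- The permutation of `Fin (n + 1)` that takes `i` to `0` and is `τ` on the other elements. -/
def permOfPosition (p : Fin (n + 1) × Equiv.Perm (Fin n)) : Equiv.Perm (Fin (n + 1)) :=
  Equiv.Perm.decomposeFin.symm (0, p.2) * p.1.cycleRange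

theorem permOfPosition_self (i : Fin (n + 1)) (τ : Equiv.Perm (Fin n)) :
    permOfPosition (i, τ) i = 0 := by
  simp [permOfPosition, Equiv.Perm.decomposeFin_symm_apply_zero]

theorem permOfPosition_succAbove (i : Fin (n + 1)) (τ : Equiv.Perm (Fin n)) (j : Fin n) :
    permOfPosition (i, τ) (i.succAbove j) = (τ j).succ := by
  simp [permOfPosition]

theorem sign_permOfPosition (i : Fin (n + 1)) (τ : Equiv.Perm (Fin n)) :
    Equiv.Perm.sign (permOfPosition (i, τ)) = (-1) ^ (i : ℕ) * Equiv.Perm.sign τ := by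
  simp [permOfPosition, Fin.sign_cycleRange, mul_comm]

theorem permOfPosition_bijective :
    Function.Bijective (permOfPosition : Fin (n + 1) × Equiv.Perm (Fin n) → _) := by
  rw [Fintype.bijective_iff_injective_and_card]
  constructor
  · rintro ⟨i, τ⟩ ⟨i', τ'⟩ h
    have hi : i = i' := (permOfPosition (i', τ')).injective <| by
      rw [permOfPosition_self, ← h, permOfPosition_self]
    subst hi
    refine Prod.ext rfl (Equiv.ext fun j => Fin.succ_injective _ ?_)
    rw [← permOfPosition_succAbove i, h, permOfPosition_succAbove]
  · simp [Fintype.card_perm, Nat.factorial_succ]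

/-- Sort the permutations by the position `i` at which the letter `h` appears; bringing it there
costs the sign `(-1)^i`, as in the prism operator. Alternating chains are thus iterated shuffle
products, and the prism formulas apply to them. -/
theorem cChain_cons (h : G) (g : Fin n → G) :
    cChain k (Fin.cons h g : Fin (n + 1) → G) = prism k (.id G) (.id G) h n (cChain k g) := by
  simp only [cChain, map_sum]
  rw [← Function.Bijective.sum_comp permOfPosition_bijective, Fintype.sum_prod_type,
    Finset.sum_comm]
  refine Finset.sum_congr rfl fun τ _ => ?_
  rw [← Finsupp.smul_single_one, map_smul, prism_id_word, Finset.smul_sum]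
  refine Finset.sum_congr rfl fun i _ => ?_
  have e : (Fin.cons h g : Fin (n + 1) → G) ∘ permOfPosition (i, τ) = i.insertNth h (g ∘ τ) := by
    rw [Fin.eq_insertNth_iff]
    refine ⟨by simp [permOfPosition_self], funext fun j => ?_⟩
    simp [Fin.removeNth, permOfPosition_succAbove]
  rw [e, sign_permOfPosition, smul_smul, ← Finsupp.smul_single_one]
  simp [mul_comm]

theorem map_cChain (f : G →* H) (g : Fin n → G) : map k f n (cChain k g) = cChain k (f ∘ g) := by
  simp only [cChain, map_sum]
  refine Finset.sum_congr rfl fun σ _ => ?_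
  rw [← Finsupp.smul_single_one, map_smul, map_word, Finsupp.smul_single_one, Function.comp_assoc]

theorem cChain_comp_perm (g : Fin n → G) (σ : Equiv.Perm (Fin n)) :
    cChain k (g ∘ σ) = (Equiv.Perm.sign σ : ℤ) • cChain k g := by
  simp only [cChain]
  rw [Finset.smul_sum]
  conv_rhs => rw [← Equiv.sum_comp (Equiv.mulLeft σ)]
  refine Finset.sum_congr rfl fun τ _ => ?_
  rw [Finsupp.smul_single, Equiv.coe_mulLeft, map_mul, Equiv.Perm.coe_mul, ← Function.comp_assoc]
  congr 1
  rcases Int.units_eq_one_or (Equiv.Perm.sign σ) with h | h <;> simp [h]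

/-- Composition with the transposition of `i` and `j` pairs equal words with opposite signs.
Antisymmetry alone would not suffice, since `2` need not be invertible in `k`. -/
theorem cChain_eq_zero (g : Fin n → G) {i j : Fin n} (hij : i ≠ j) (h : g i = g j) :
    cChain k g = 0 := by
  refine Finset.sum_involution (fun σ _ => Equiv.swap i j * σ) (fun σ _ => ?_) (fun σ _ _ e => ?_)
    (fun _ _ => Finset.mem_univ _) fun σ _ => by rw [← mul_assoc, Equiv.swap_mul_self, one_mul]
  · have e : g ∘ (Equiv.swap i j * σ) = g ∘ σ := by
      funext l
      simp only [Function.comp_apply, Equiv.Perm.mul_apply, Equiv.swap_apply_def]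
      split_ifs with h1 h2
      · rw [h1, h]
      · rw [h2, h]
      · rfl
    rw [e, ← Finsupp.single_add, map_mul, Equiv.Perm.sign_swap hij]
    simp
  · exact hij (Equiv.swap_eq_one_iff.mp (mul_eq_right.mp e))

/-- Every letter is central, so both homomorphisms in `d_prism` can be the identity and the prism
anticommutes with the boundary. -/
theorem d_cChain_of_comm {A : Type u} [CommGroup A] :
    ∀ {n : ℕ} (g : Fin (n + 1) → A), d k A n (cChain k g) = 0
  | 0, g => by rw [← Fin.cons_self_tail g, cChain_cons, d_prism_zero]
  | n + 1, g => by
    rw [← Fin.cons_self_tail g, cChain_cons, d_prism (fun a => mul_comm _ a), d_cChain_of_comm]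
    simp

end Bar

/-! ### Chains modulo boundaries -/

/-- Chains of degree `n` modulo boundaries. -/
def BarQuot (k : Type u) [CommRing k] (G : Type u) [Group G] (n : ℕ) : Type u :=
  Bar k G n ⧸ LinearMap.range (Bar.d k G n)

namespace BarQuot

variable (k : Type u) [CommRing k] (G : Type u) [Group G] (n : ℕ)

instance : AddCommGroup (BarQuot k G n) :=
  inferInstanceAs (AddCommGroup (Bar k G n ⧸ LinearMap.range (Bar.d k G n)))

instance : Module k (BarQuot k G n) :=
  inferInstanceAs (Module k (Bar k G n ⧸ LinearMap.range (Bar.d k G n)))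

/-- The class of a chain. -/
def mk : Bar k G n →ₗ[k] BarQuot k G n := (LinearMap.range (Bar.d k G n)).mkQ

variable {k G n} {H : Type u} [Group H]

theorem mk_eq_zero {z : Bar k G n} : mk k G n z = 0 ↔ ∃ y, Bar.d k G n y = z :=
  (Submodule.Quotient.mk_eq_zero _).trans LinearMap.mem_range

theorem mk_d (y : Bar k G (n + 1)) : mk k G n (Bar.d k G n y) = 0 := mk_eq_zero.mpr ⟨y, rfl⟩

/-- The map induced by a homomorphism. -/
def map (f : G →* H) : BarQuot k G n →ₗ[k] BarQuot k H n :=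
  Submodule.mapQ _ _ (Bar.map k f n) <| by
    rintro _ ⟨y, rfl⟩
    exact ⟨Bar.map k f (n + 1) y, (Bar.map_d f y).symm⟩

theorem map_mk (f : G →* H) (z : Bar k G n) :
    map f (mk k G n z) = mk k H n (Bar.map k f n z) := rfl

/-- The class of the alternating chain attached to a tuple of group elements. -/
def symb (k : Type u) [CommRing k] (g : Fin n → G) : BarQuot k G n := mk k G n (cChain k g)

theorem map_symb (f : G →* H) (g : Fin n → G) : map f (symb k g) = symb k (f ∘ g) := by
  rw [symb, map_mk, Bar.map_cChain, symb]

theorem symb_comp_perm (g : Fin n → G) (σ : Equiv.Perm (Fin n)) :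
    symb k (g ∘ σ) = (Equiv.Perm.sign σ : ℤ) • symb k g := by
  rw [symb, Bar.cChain_comp_perm, map_zsmul, symb]

/-- Shuffling with a central letter takes boundaries to boundaries, up to sign. -/
theorem symb_cons_eq_zero {h : G} (hh : ∀ g, h * g = g * h) {g : Fin (n + 1) → G}
    (hg : symb k g = 0) : symb k (Fin.cons h g : Fin (n + 2) → G) = 0 := by
  obtain ⟨y, hy⟩ := mk_eq_zero.mp hg
  refine mk_eq_zero.mpr ⟨-Bar.prism k (.id G) (.id G) h (n + 2) y, ?_⟩
  rw [Bar.cChain_cons, ← hy, map_neg, Bar.d_prism (f := .id G) (f' := .id G) hh]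
  simp

variable {A : Type u} [CommGroup A]

/-- The double prism of the alternating chain of `g` bounds the defect of additivity. The remaining
term of `d_doublePrism` vanishes because that chain is closed. -/
theorem symb_cons_mul (a b : A) : ∀ {n : ℕ} (g : Fin n → A),
    symb k (Fin.cons (a * b) g : Fin (n + 1) → A) =
      symb k (Fin.cons a g : Fin (n + 1) → A) + symb k (Fin.cons b g : Fin (n + 1) → A)
  | 0, g => by
    simp only [symb, Bar.cChain_cons]
    rw [eq_comm, ← sub_eq_zero, ← map_add, ← map_sub, ← Bar.d_doublePrism_zero, mk_d]
  | n + 1, g => by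
    simp only [symb, Bar.cChain_cons]
    rw [eq_comm, ← sub_eq_zero, ← map_add, ← map_sub]
    have h := Bar.d_doublePrism (k := k) (mul_comm a) (mul_comm b) (cChain k g)
    rw [Bar.d_cChain_of_comm, map_zero, add_zero] at h
    rw [← h, mk_d]

/-- Exchanging slot `i` with slot `0` reduces multilinearity in an arbitrary slot to
`symb_cons_mul`. -/
theorem symb_update (g : Fin (n + 1) → A) (i : Fin (n + 1)) (a : A) :
    symb k (Function.update g i a) = (Equiv.Perm.sign (Equiv.swap 0 i) : ℤ) •
      symb k (Fin.cons a (Fin.tail (g ∘ Equiv.swap 0 i)) : Fin (n + 1) → A) := by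
  rw [← symb_comp_perm]
  congr 1
  funext l
  by_cases hl : l = i
  · subst hl; simp
  · rw [Function.update_of_ne hl]
    obtain ⟨m, hm⟩ : ∃ m : Fin n, Equiv.swap 0 i l = m.succ := by
      obtain ⟨m, hm⟩ := Fin.exists_succ_eq.mpr fun h : Equiv.swap 0 i l = 0 =>
        hl (by simpa using Equiv.swap_apply_eq_iff.mp h)
      exact ⟨m, hm.symm⟩
    simp only [Function.comp_apply, hm, Fin.cons_succ, Fin.tail]
    rw [← hm, Equiv.swap_apply_self]

theorem symb_update_mul : ∀ {n : ℕ} (g : Fin n → A) (i : Fin n) (a b : A),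
    symb k (Function.update g i (a * b)) =
      symb k (Function.update g i a) + symb k (Function.update g i b)
  | 0, _, i, _, _ => i.elim0
  | n + 1, g, i, a, b => by simp only [symb_update, symb_cons_mul, smul_add]

/-- The prism operator is a homotopy between the chain maps of `f` and `f'`, and the alternating
chain of commuting elements is closed. -/
theorem map_conj {f f' : A →* H} {h : H} (hc : ∀ g, h * f' g = f g * h) :
    ∀ {n : ℕ} (g : Fin n → A), symb k (f ∘ g) = symb k (f' ∘ g)
  | 0, g => by rw [Subsingleton.elim (f ∘ g) (f' ∘ g)]
  | n + 1, g => by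
    have := Bar.d_prism (k := k) hc (cChain k g)
    rw [Bar.d_cChain_of_comm, map_zero, sub_zero, Bar.map_cChain, Bar.map_cChain] at this
    rw [eq_comm, ← sub_eq_zero, symb, symb, ← map_sub, ← this, mk_d]

end BarQuot

/-! ### The Steinberg relation in central extensions -/

section Steinberg

variable {F : Type u} [Field F]

/-- A biadditive map on an infinite field that is invariant under simultaneous scaling of its
arguments vanishes. -/
theorem biadditive_eq_zero [Infinite F] {Z : Type*} [AddCommGroup Z] (β : F → F → Z)
    (hl : ∀ s s' t, β (s + s') t = β s t + β s' t) (hr : ∀ s t t', β s (t + t') = β s t + β s t')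
    (hc : ∀ c s t, c ≠ 0 → β (c * s) (c * t) = β s t) (s t : F) : β s t = 0 := by
  obtain ⟨c, h0, h1, h2⟩ : ∃ c : F, c ≠ 0 ∧ c + 1 ≠ 0 ∧ c ^ 2 + c + 1 ≠ 0 := by
    classical
    open Polynomial in
    have hp : (X * (X + C 1) * (X ^ 2 + X + C 1) : F[X]) ≠ 0 :=
      (monic_X.mul (monic_X_add_C 1)).mul (by monicity!) |>.ne_zero
    obtain ⟨c, hc⟩ := Infinite.exists_notMem_finset
      (X * (X + C 1) * (X ^ 2 + X + C 1) : Polynomial F).roots.toFinset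
    rw [Multiset.mem_toFinset, mem_roots hp] at hc
    refine ⟨c, ?_, ?_, ?_⟩ <;> rintro h <;> apply hc <;> simp [h]
  -- Expanding the invariance under `c + 1` with the help of that under `c` gives `β (c r) t + β r t
  -- + β r (c t) = 0`, and `β r (c t) = β (c⁻¹ r) t`. So `β` vanishes on multiples of `c + 1 + c⁻¹`,
  -- which is invertible by the choice of `c`.
  have key (r : F) : β ((c ^ 2 + c + 1) / c * r) t = 0 := by
    have e := hc (c + 1) r t h1
    simp only [add_mul, one_mul, hl, hr, hc c r t h0] at e
    have e' := hc c (c⁻¹ * r) t h0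
    rw [mul_inv_cancel_left₀ h0] at e'
    have : (c ^ 2 + c + 1) / c * r = c * r + r + c⁻¹ * r := by field_simp
    rw [this, hl, hl, ← e']
    rw [← sub_eq_zero] at e
    rw [← e]
    abel
  have := key (c / (c ^ 2 + c + 1) * s)
  rwa [← mul_assoc, div_mul_div_cancel₀ h0, div_self h2, one_mul] at this

section WeylElements

variable {E : Type*} [Group E] (X Y : F → E)

/-- The element `X(c) Y(-c⁻¹) X(c)`. -/
def weyl (c : Fˣ) : E := X c * Y (-(c⁻¹ : Fˣ)) * X c

variable {X Y} (hX : ∀ s t, X (s + t) = X s * X t) (hY : ∀ s t, Y (s + t) = Y s * Y t)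
  (hwX : ∀ (c : Fˣ) t, weyl X Y c * X t * (weyl X Y c)⁻¹ = Y (-(t * (c⁻¹ : Fˣ) ^ 2)))
  (hwY : ∀ (c : Fˣ) t, weyl X Y c * Y t * (weyl X Y c)⁻¹ = X (-(t * c ^ 2)))

include hX hY in
theorem weyl_neg (c : Fˣ) : weyl X Y (-c) = (weyl X Y c)⁻¹ := by
  have hX0 : X 0 = 1 := by simpa using hX 0 0
  have hY0 : Y 0 = 1 := by simpa using hY 0 0
  have hXn (t) : X (-t) = (X t)⁻¹ := eq_inv_of_mul_eq_one_left (by rw [← hX, neg_add_cancel, hX0])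
  have hYn (t) : Y (-t) = (Y t)⁻¹ := eq_inv_of_mul_eq_one_left (by rw [← hY, neg_add_cancel, hY0])
  simp [weyl, hXn, hYn, mul_assoc]

-- Conjugation by `weyl X Y v` turns the `X`-factors of `weyl X Y s` into `Y`-factors and
-- conversely. The case `v = s` is the symmetry `weyl_eq`; the case `v = -b`, `s = -1` enters
-- `weyl_steinberg`.
include hwX hwY in
theorem weyl_conj (v s : Fˣ) :
    weyl X Y v * weyl X Y s * (weyl X Y v)⁻¹ =
      Y (-((v ^ 2 / s)⁻¹ : Fˣ)) * X (v ^ 2 / s : Fˣ) * Y (-((v ^ 2 / s)⁻¹ : Fˣ)) := by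
  have e : weyl X Y v * weyl X Y s * (weyl X Y v)⁻¹ =
      (weyl X Y v * X s * (weyl X Y v)⁻¹) * (weyl X Y v * Y (-(s⁻¹ : Fˣ)) * (weyl X Y v)⁻¹) *
        (weyl X Y v * X s * (weyl X Y v)⁻¹) := by
    generalize weyl X Y v = w
    simp only [weyl, mul_assoc, inv_mul_cancel_left]
  rw [e, hwX, hwY]
  congr 3
  push_cast
  field_simp

include hwX hwY in
theorem weyl_eq (c : Fˣ) : weyl X Y c = Y (-(c⁻¹ : Fˣ)) * X c * Y (-(c⁻¹ : Fˣ)) := by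
  have := weyl_conj hwX hwY c c
  rwa [mul_inv_cancel_right, show c ^ 2 / c = c by rw [pow_two, mul_div_cancel_right]] at this

include hX hY hwX hwY in
/-- The Steinberg relation for Weyl elements. -/
theorem weyl_steinberg (a b : Fˣ) (hab : (a : F) + b = 1) :
    weyl X Y a * weyl X Y (-1) * weyl X Y b = weyl X Y (a * b) := by
  have hX0 : X 0 = 1 := by simpa using hX 0 0
  have hY0 : Y 0 = 1 := by simpa using hY 0 0
  have hXn (t) : X (-t) = (X t)⁻¹ := eq_inv_of_mul_eq_one_left (by rw [← hX, neg_add_cancel, hX0])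
  have hYn (t) : Y (-t) = (Y t)⁻¹ := eq_inv_of_mul_eq_one_left (by rw [← hY, neg_add_cancel, hY0])
  have hYw (c : Fˣ) : Y (-(c⁻¹ : Fˣ)) = X (-c) * weyl X Y c * X (-c) := by
    simp [weyl, hXn, mul_assoc]
  have hwX' (c : Fˣ) (t) : X t * weyl X Y c = weyl X Y c * Y (-(t * (c⁻¹ : Fˣ) ^ 2)) := by
    have := hwX (-c) t
    rw [weyl_neg hX hY, inv_inv] at this
    rw [mul_assoc, inv_mul_eq_iff_eq_mul] at this
    simpa using this
  -- As `a + b = 1`, the sum of `a⁻¹` and `b⁻¹` is `(ab)⁻¹`. This is the additivity of `Y` at these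
  -- elements, each factor being rewritten by `hYw`.
  have h1 : X (-a) * weyl X Y a * X (-a) * (X (-b) * weyl X Y b * X (-b)) =
      X (-(a * b : Fˣ)) * weyl X Y (a * b) * X (-(a * b : Fˣ)) := by
    rw [← hYw, ← hYw, ← hYw, ← hY]
    congr 1
    push_cast
    field_simp
    linear_combination -hab
  have h2 : weyl X Y a * (X (-1) * weyl X Y b) =
      X (a ^ 2) * weyl X Y (a * b) * X (b ^ 2) := by
    have e1 : X (-1) = X (-a) * X (-b) := by rw [← hX]; congr 1; linear_combination hab
    have e2 : X (a ^ 2) = X a * X (-(a * b : Fˣ)) := by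
      rw [← hX]; congr 1; push_cast; linear_combination (a : F) * hab
    have e3 : X (b ^ 2) = X (-(a * b : Fˣ)) * X b := by
      rw [← hX]; congr 1; push_cast; linear_combination (b : F) * hab
    rw [e1, e2, e3]
    have := congrArg (fun z => X a * z * X b) h1
    simp only [hXn, mul_assoc, mul_inv_cancel_left, inv_mul_cancel, mul_one] at this ⊢
    exact this
  -- In `h2` move `X (-1)` and `X (a ^ 2)` to the right past the Weyl elements; they become `Y` at
  -- `b⁻²` and `-b⁻²`. Together with `X (b ^ 2)` they form the Weyl element of `b ^ 2` in the shape
  -- of `weyl_eq`.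
  have h3 : weyl X Y a * weyl X Y b = weyl X Y (a * b) * weyl X Y (b ^ 2) := by
    rw [weyl_eq hwX hwY (b ^ 2)]
    rw [hwX', hwX', ← mul_assoc, mul_assoc (weyl X Y (a * b))] at h2
    have e1 : -(-1 * ((b⁻¹ : Fˣ) : F) ^ 2) = -(-(((b ^ 2)⁻¹ : Fˣ) : F)) := by push_cast; ring
    have e2 : -((a : F) ^ 2 * (((a * b)⁻¹ : Fˣ) : F) ^ 2) = -(((b ^ 2)⁻¹ : Fˣ) : F) := by
      push_cast; field_simp
    rw [e1, e2, hYn (-_), ← eq_mul_inv_iff_mul_eq, inv_inv] at h2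
    rw [h2]
    push_cast
    simp only [mul_assoc]
  have h4 : weyl X Y (-1) * weyl X Y b = weyl X Y b * weyl X Y (-b ^ 2) := by
    have := weyl_conj hwX hwY (-b) (-1)
    rw [← weyl_eq hwX hwY, weyl_neg hX hY b, inv_inv] at this
    rw [mul_assoc, inv_mul_eq_iff_eq_mul] at this
    rw [this]
    rw [neg_sq, div_neg, div_one]
  rw [mul_assoc, h4, ← mul_assoc, h3, weyl_neg hX hY, mul_inv_cancel_right]

end WeylElements

/-- In a central extension the conjugate of a lift by a lift does not depend on the lifts acting. -/
theorem conj_eq_of_central {E G : Type*} [Group E] [Group G] {π : E →* G}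
    (hc : ∀ z, π z = 1 → ∀ e, z * e = e * z) {e e' : E} (h : π e = π e') (x : E) :
    e * x * e⁻¹ = e' * x * e'⁻¹ := by
  have hz := hc (e'⁻¹ * e) (by rw [map_mul, map_inv, h, inv_mul_cancel]) x
  have he : e = e' * (e'⁻¹ * e) := by group
  generalize e'⁻¹ * e = z at hz he
  rw [he, mul_assoc, mul_assoc, ← mul_assoc z, hz]
  group

/-- In a central extension commutators of lifts do not depend on the lifts. -/
theorem commutator_eq_of_central {E G : Type*} [Group E] [Group G] {π : E →* G}
    (hc : ∀ z, π z = 1 → ∀ e, z * e = e * z) {e e' f f' : E} (h : π e = π e') (h' : π f = π f') :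
    e * f * e⁻¹ * f⁻¹ = e' * f' * e'⁻¹ * f'⁻¹ := by
  rw [conj_eq_of_central hc h]
  have := conj_eq_of_central hc h' e'⁻¹
  calc e' * f * e'⁻¹ * f⁻¹ = e' * (f * e'⁻¹ * f⁻¹) := by group
    _ = e' * f' * e'⁻¹ * f'⁻¹ := by rw [this]; group

/-- A central extension of a group with a torus acting on a root subgroup `u` splits over `u`,
equivariantly under lifts of the torus. -/
theorem exists_lift_root [Infinite F] {E G : Type*} [Group E] [Group G] {π : E →* G}
    (hπ : Function.Surjective π) (hc : ∀ z, π z = 1 → ∀ e, z * e = e * z) {u : F → G}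
    {T : Fˣ × Fˣ →* G} (hu : ∀ s t, u (s + t) = u s * u t)
    (hT : ∀ p t, T p * u t * (T p)⁻¹ = u (p.1 * (p.2⁻¹ : Fˣ) * t)) :
    ∃ X : F → E, (∀ s t, X (s + t) = X s * X t) ∧ (∀ t, π (X t) = u t) ∧
      ∀ e p, π e = T p → ∀ t, e * X t * e⁻¹ = X (p.1 * (p.2⁻¹ : Fˣ) * t) := by
  have hu' (s t : F) : u s * u t = u t * u s := by rw [← hu, ← hu, add_comm]
  have hker {z : E} (h : π z = 1) : z ∈ π.ker := h
  let _ : CommGroup π.ker :=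
    { (inferInstance : Group π.ker) with mul_comm := fun z w => Subtype.ext (hc z z.2 w) }
  choose L hL using fun t => hπ (u t)
  -- Commutators of lifts are central and independent of the lifts. The vanishing of this biadditive
  -- pairing, which is invariant under the torus, says that the preimage of the root subgroup is
  -- commutative.
  let β (s t : F) : Additive π.ker := Additive.ofMul ⟨L s * L t * (L s)⁻¹ * (L t)⁻¹, hker <| by
    simp only [map_mul, map_inv, hL, hu' s t]; group⟩
  have hβ (s t : F) : ((β s t).toMul : E) = L s * L t * (L s)⁻¹ * (L t)⁻¹ := rfl
  have hβ0 (s t : F) : β s t = 0 := by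
    refine biadditive_eq_zero β (fun s s' t => ?_) (fun s t t' => ?_) (fun c s t hc0 => ?_) s t
    · refine congrArg Additive.ofMul (Subtype.ext ?_)
      change L (s + s') * L t * (L (s + s'))⁻¹ * (L t)⁻¹ =
        L s * L t * (L s)⁻¹ * (L t)⁻¹ * (L s' * L t * (L s')⁻¹ * (L t)⁻¹)
      rw [commutator_eq_of_central hc (e' := L s * L s') (f' := L t) (by simp [hL, hu]) rfl]
      have := hc _ (β s' t).toMul.2 (L t * (L s)⁻¹ * (L t)⁻¹)
      rw [hβ] at this
      calc _ = L s * ((L s' * L t * (L s')⁻¹ * (L t)⁻¹) * (L t * (L s)⁻¹ * (L t)⁻¹)) := by group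
        _ = _ := by rw [this]; group
    · refine congrArg Additive.ofMul (Subtype.ext ?_)
      change L s * L (t + t') * (L s)⁻¹ * (L (t + t'))⁻¹ =
        L s * L t * (L s)⁻¹ * (L t)⁻¹ * (L s * L t' * (L s)⁻¹ * (L t')⁻¹)
      rw [commutator_eq_of_central hc (e' := L s) (f' := L t * L t') rfl (by simp [hL, hu])]
      have := hc _ (β s t').toMul.2 (L t)⁻¹
      rw [hβ] at this
      calc _ = L s * L t * (L s)⁻¹ * ((L s * L t' * (L s)⁻¹ * (L t')⁻¹) * (L t)⁻¹) := by group
        _ = _ := by rw [this]; group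
    · refine congrArg Additive.ofMul (Subtype.ext ?_)
      obtain ⟨e, he⟩ := hπ (T (Units.mk0 c hc0, 1))
      have hconj (r : F) : π (L (c * r)) = π (e * L r * e⁻¹) := by
        rw [map_mul, map_mul, map_inv, he, hL, hL, hT]; simp
      change L (c * s) * L (c * t) * (L (c * s))⁻¹ * (L (c * t))⁻¹ = L s * L t * (L s)⁻¹ * (L t)⁻¹
      rw [commutator_eq_of_central hc (hconj s) (hconj t)]
      have := hc _ (β s t).toMul.2 e
      rw [hβ] at this
      calc _ = e * (L s * L t * (L s)⁻¹ * (L t)⁻¹) * e⁻¹ := by group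
        _ = _ := by rw [← this]; group
  have hcomm {x y : E} {s t : F} (hx : π x = u s) (hy : π y = u t) : x * y = y * x := by
    have h1 : x * y * x⁻¹ * y⁻¹ = L s * L t * (L s)⁻¹ * (L t)⁻¹ :=
      commutator_eq_of_central hc (hx.trans (hL s).symm) (hy.trans (hL t).symm)
    rw [← hβ, hβ0] at h1
    change _ = (1 : E) at h1
    rwa [mul_inv_eq_one, mul_inv_eq_iff_eq_mul] at h1
  obtain ⟨c, hc0, hc1⟩ : ∃ c : F, c ≠ 0 ∧ c - 1 ≠ 0 := by
    classical
    obtain ⟨c, hc⟩ := Infinite.exists_notMem_finset ({0, 1} : Finset F)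
    simp only [Finset.mem_insert, Finset.mem_singleton, not_or] at hc
    exact ⟨c, hc.1, sub_ne_zero.mpr hc.2⟩
  obtain ⟨d, hd⟩ := hπ (T (Units.mk0 c hc0, 1))
  have hdL (t : F) : π (d * L t * d⁻¹) = u (c * t) := by
    rw [map_mul, map_mul, map_inv, hd, hL, hT]; simp
  -- The commutator of `diag(c, 1)` with the root element of `t / (c - 1)` is the root element of
  -- `t`. Since commutators of lifts do not depend on the lifts, this lift is canonical, which is
  -- why it is additive and equivariant.
  refine ⟨fun t => d * L (t / (c - 1)) * d⁻¹ * (L (t / (c - 1)))⁻¹, fun s t => ?_, fun t => ?_,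
    fun e p he t => ?_⟩
  · simp only [add_div]
    generalize s / (c - 1) = s
    generalize t / (c - 1) = t
    rw [commutator_eq_of_central hc (e' := d) (f' := L s * L t) rfl (by simp [hL, hu])]
    have h1 : π (d * L t * d⁻¹ * (L t)⁻¹) = u (c * t + -t) := by
      have : (u t)⁻¹ = u (-t) := inv_eq_of_mul_eq_one_right <| by
        rw [← hu, add_neg_cancel]; simpa using hu 0 0
      rw [map_mul, hdL, map_inv, hL, this, ← hu]
    have h2 := hcomm h1 (hL s)
    calc _ = d * L s * d⁻¹ * (d * L t * d⁻¹ * (L t)⁻¹ * (L s)⁻¹) := by group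
      _ = d * L s * d⁻¹ * ((L s)⁻¹ * (d * L t * d⁻¹ * (L t)⁻¹)) := by
        rw [(eq_inv_mul_iff_mul_eq.mpr (by rw [← mul_assoc, ← h2, mul_inv_cancel_right]) :
          d * L t * d⁻¹ * (L t)⁻¹ * (L s)⁻¹ = (L s)⁻¹ * (d * L t * d⁻¹ * (L t)⁻¹))]
      _ = _ := by group
  · rw [map_mul, hdL, map_inv, hL, mul_inv_eq_iff_eq_mul, ← hu]
    congr 1
    field_simp
    ring
  · have h1 : π d = π (e * d * e⁻¹) := by
      rw [map_mul, map_mul, map_inv, he, hd, ← map_mul, ← map_inv, ← map_mul, mul_right_comm,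
        mul_inv_cancel, one_mul]
    have h2 : π (L (p.1 * (p.2⁻¹ : Fˣ) * t / (c - 1))) = π (e * L (t / (c - 1)) * e⁻¹) := by
      rw [map_mul, map_mul, map_inv, he, hL, hL, hT, mul_div_assoc]
    dsimp only
    rw [commutator_eq_of_central hc h1 h2]
    group

/-- In a central extension of a group of type `GL_2(F)`, the lifts of `diag(a, 1)` and
`diag(b, b⁻¹)` commute if `a + b = 1`. -/
theorem central_steinberg [Infinite F] {E G : Type*} [Group E] [Group G] {π : E →* G}
    (hπ : Function.Surjective π) (hc : ∀ z, π z = 1 → ∀ e, z * e = e * z) {u : F → G}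
    {T : Fˣ × Fˣ →* G} {J : G} (hu : ∀ s t, u (s + t) = u s * u t)
    (hT : ∀ p t, T p * u t * (T p)⁻¹ = u (p.1 * (p.2⁻¹ : Fˣ) * t))
    (hJT : ∀ p, T p * J = J * T p.swap) (hJ : J * J = T (-1, -1))
    (hw : ∀ c : Fˣ, u c * (J * u (c⁻¹ : Fˣ) * J⁻¹) * u c = T (c, c⁻¹) * J)
    {a b : Fˣ} (hab : (a : F) + b = 1) {e f : E} (he : π e = T (a, 1)) (hf : π f = T (b, b⁻¹)) :
    e * f = f * e := by
  obtain ⟨X, hX, hπX, hXT⟩ := exists_lift_root hπ hc hu hT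
  obtain ⟨j, hj⟩ := hπ J
  let Y (t : F) : E := j * X (-t) * j⁻¹
  have hY (s t : F) : Y (s + t) = Y s * Y t := by
    simp only [Y, neg_add, hX]; group
  have hYT (e : E) (p : Fˣ × Fˣ) (he : π e = T p) (t : F) :
      e * Y t * e⁻¹ = Y (p.2 * (p.1⁻¹ : Fˣ) * t) := by
    obtain ⟨e', he'⟩ := hπ (T p.swap)
    have h1 : π (e * j) = π (j * e') := by rw [map_mul, map_mul, he, he', hj, hJT]
    have h2 := hXT e' _ he' (-t)
    calc _ = e * j * X (-t) * (e * j)⁻¹ := by simp only [Y]; group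
      _ = j * e' * X (-t) * (j * e')⁻¹ := conj_eq_of_central hc h1 _
      _ = j * (e' * X (-t) * e'⁻¹) * j⁻¹ := by group
      _ = _ := by rw [h2]; simp [Y]
  have hπw (c : Fˣ) : π (weyl X Y c) = T (c, c⁻¹) * J := by
    simp only [weyl, Y, map_mul, map_inv, hπX, hj, neg_neg, hw]
  have hwX (c : Fˣ) (t : F) :
      weyl X Y c * X t * (weyl X Y c)⁻¹ = Y (-(t * (c⁻¹ : Fˣ) ^ 2)) := by
    obtain ⟨e, he⟩ := hπ (T (c, c⁻¹))
    rw [conj_eq_of_central hc (e' := e * j) (by rw [hπw, map_mul, he, hj])]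
    have := hYT e _ he (-t)
    calc _ = e * Y (-t) * e⁻¹ := by simp only [Y, neg_neg]; group
      _ = _ := by rw [this]; congr 1; push_cast; ring
  have hwY (c : Fˣ) (t : F) : weyl X Y c * Y t * (weyl X Y c)⁻¹ = X (-(t * c ^ 2)) := by
    obtain ⟨e, he⟩ := hπ (T (c, c⁻¹))
    rw [conj_eq_of_central hc (e' := e * j) (by rw [hπw, map_mul, he, hj])]
    have h1 : π (e * j * j) = T ((c, c⁻¹) * (-1, -1)) := by
      rw [mul_assoc, map_mul, map_mul, he, hj, hJ, map_mul]
    have := hXT _ _ h1 (-t)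
    calc _ = e * j * j * X (-t) * (e * j * j)⁻¹ := by simp only [Y]; group
      _ = _ := by rw [this]; congr 1; push_cast; simp; ring
  have hconj (c : Fˣ) : e * weyl X Y c * e⁻¹ = weyl X Y (a * c) := by
    calc _ = (e * X c * e⁻¹) * (e * Y (-(c⁻¹ : Fˣ)) * e⁻¹) * (e * X c * e⁻¹) := by
          simp only [weyl]; group
      _ = _ := by
        rw [hXT e _ he, hYT e _ he, weyl]
        simp [mul_comm]
  have hst : weyl X Y (a * b) = weyl X Y b * weyl X Y (-1) * weyl X Y a := by
    rw [mul_comm a b, weyl_steinberg hX hY hwX hwY b a (by rw [add_comm, hab])]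
  -- All lifts of `diag(b, b⁻¹)` act alike by conjugation, so `f` may be replaced by this product of
  -- Weyl elements.
  have hf' : π f = π (weyl X Y b * weyl X Y (-1)) := by
    have : T (-1, (-1)⁻¹) = J * J := by rw [hJ]; simp
    rw [hf, map_mul, hπw, hπw, this, mul_assoc, ← mul_assoc J, ← mul_assoc J, hJ, mul_assoc, hJ,
      ← map_mul, ← map_mul]
    simp
  have := conj_eq_of_central hc hf' e
  -- Conjugation by `e` multiplies the parameters by `a` and gives the Weyl elements of `ab` and
  -- `-a`. The Steinberg relation `hst` expands the first, and its factor for `a` cancels the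
  -- second.
  have h2 : e * (weyl X Y b * weyl X Y (-1)) * e⁻¹ = weyl X Y b * weyl X Y (-1) := by
    calc _ = (e * weyl X Y b * e⁻¹) * (e * weyl X Y (-1) * e⁻¹) := by group
      _ = _ := by
        rw [hconj, hconj, hst, mul_neg, mul_one, weyl_neg hX hY a, mul_inv_cancel_right]
  rw [mul_inv_eq_iff_eq_mul] at h2 this
  rw [← h2, mul_inv_cancel_right] at this
  exact this.symm

/-! ### The universal cocycle extension -/

/-- The central extension of `G` by the chains of degree two modulo boundaries whose cocycle is
`(g, h) ↦ [g | h]`. -/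
@[ext]
structure BarExt (k : Type u) [CommRing k] (G : Type u) [Group G] where
  /-- The component in the kernel. -/
  fst : BarQuot k G 2
  /-- The component in the group. -/
  snd : G

namespace BarExt

variable {k : Type u} [CommRing k] {G : Type u} [Group G]

variable (k) in
/-- The tautological cocycle. -/
def cocycle (g h : G) : BarQuot k G 2 := BarQuot.mk k G 2 (Bar.word k ![g, h])

/-- This is the vanishing of the boundary of `[g | h | l]` in the quotient. -/
theorem cocycle_add (g h l : G) :
    cocycle k g h + cocycle k (g * h) l = cocycle k h l + cocycle k g (h * l) := by
  have e := BarQuot.mk_d (Bar.word k ![g, h, l])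
  have h0 : Fin.contractNth 0 (· * ·) ![g, h, l] = ![g * h, l] :=
    Bar.contractNth_zero_cons g ![h, l]
  have h1 : Fin.contractNth 1 (· * ·) ![g, h, l] = ![g, h * l] := by
    refine (Bar.contractNth_succ_cons 0 g ![h, l]).trans ?_
    exact congrArg (fun x : Fin 1 → G => (Fin.cons g x : Fin 2 → G)) (Bar.contractNth_zero_cons h ![l])
  have h2 : Fin.contractNth 2 (· * ·) ![g, h, l] = ![g, h] := by
    funext i; fin_cases i <;> rfl
  have h3 : Fin.tail ![g, h, l] = ![h, l] := rfl
  rw [Bar.d_word, Fin.sum_univ_three, h0, h1, h2, h3] at e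
  simp only [Fin.val_zero, Fin.val_one, Fin.val_two, zero_add, neg_smul, one_smul, map_add,
    map_neg, Nat.reduceAdd, pow_succ, pow_zero, mul_neg, mul_one, neg_neg] at e
  change cocycle k h l + (-cocycle k (g * h) l + cocycle k g (h * l) + -cocycle k g h) = 0 at e
  rw [← sub_eq_zero, ← neg_eq_zero, ← e]
  abel

theorem cocycle_one_left (g : G) : cocycle k 1 g = cocycle k 1 1 := by
  have := cocycle_add (k := k) 1 1 g
  rw [one_mul, one_mul] at this
  exact (add_right_cancel this).symm

instance : Mul (BarExt k G) := ⟨fun x y => ⟨x.fst + y.fst + cocycle k x.snd y.snd, x.snd * y.snd⟩⟩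

/-- The bar complex is not normalized, so `cocycle k 1 1` need not vanish; this accounts for the
corrections in the unit and in the inverse. -/
instance : One (BarExt k G) := ⟨⟨-cocycle k 1 1, 1⟩⟩

instance : Inv (BarExt k G) :=
  ⟨fun x => ⟨-x.fst - cocycle k x.snd⁻¹ x.snd - cocycle k 1 1, x.snd⁻¹⟩⟩

theorem mul_def (x y : BarExt k G) :
    x * y = ⟨x.fst + y.fst + cocycle k x.snd y.snd, x.snd * y.snd⟩ := rfl

theorem one_def : (1 : BarExt k G) = ⟨-cocycle k 1 1, 1⟩ := rfl

theorem inv_def (x : BarExt k G) :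
    x⁻¹ = ⟨-x.fst - cocycle k x.snd⁻¹ x.snd - cocycle k 1 1, x.snd⁻¹⟩ := rfl

instance : Group (BarExt k G) :=
  Group.ofLeftAxioms
    (fun x y z => by
      simp only [mul_def]
      refine BarExt.ext ?_ (mul_assoc _ _ _)
      have := cocycle_add (k := k) x.snd y.snd z.snd
      calc _ = x.fst + y.fst + z.fst +
            (cocycle k x.snd y.snd + cocycle k (x.snd * y.snd) z.snd) := by dsimp only; abel
        _ = _ := by rw [this]; dsimp only; abel)
    (fun x => by
      simp only [mul_def, one_def]
      refine BarExt.ext ?_ (one_mul _)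
      simp [cocycle_one_left])
    fun x => by
      simp only [mul_def, one_def, inv_def]
      refine BarExt.ext ?_ (inv_mul_cancel _)
      dsimp only
      abel

variable (k G) in
/-- The projection of the extension. -/
def proj : BarExt k G →* G where
  toFun := snd
  map_one' := rfl
  map_mul' _ _ := rfl

theorem proj_surjective : Function.Surjective (proj k G) := fun g => ⟨⟨0, g⟩, rfl⟩

theorem central (z : BarExt k G) (hz : proj k G z = 1) (e : BarExt k G) : z * e = e * z := by
  have hz' : z.snd = 1 := hz
  have h1 : cocycle k e.snd 1 = cocycle k 1 1 := by
    have := cocycle_add (k := k) e.snd 1 1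
    rw [mul_one, mul_one, add_left_inj] at this
    exact this
  rw [mul_def, mul_def, hz', h1, cocycle_one_left, add_comm z.fst, one_mul, mul_one]

/-- The two products differ in the kernel by `[g | h] - [h | g]`, which is the alternating chain of
the pair. -/
theorem symb_eq_zero_of_commute {g h : G}
    (H : (⟨0, g⟩ : BarExt k G) * ⟨0, h⟩ = ⟨0, h⟩ * ⟨0, g⟩) : BarQuot.symb k ![g, h] = 0 := by
  have e : cocycle k g h = cocycle k h g := by simpa [mul_def] using congrArg fst H
  have : cChain k ![g, h] = Bar.word k ![g, h] - Bar.word k ![h, g] := by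
    have e0 : ![g, h] ∘ (Equiv.swap 0 1 : Equiv.Perm (Fin 2)) = ![h, g] := by
      funext i; fin_cases i <;> rfl
    have hu : (Finset.univ : Finset (Equiv.Perm (Fin 2))) = {1, Equiv.swap 0 1} := by decide
    rw [cChain, hu, Finset.sum_pair (by decide), e0, Equiv.Perm.sign_swap (by decide)]
    simp [sub_eq_add_neg]
  rw [BarQuot.symb, this, map_sub]
  exact sub_eq_zero.mpr e

end BarExt

end Steinberg

section

variable {F : Type u} [Field F]

/-- Diagonal matrices, as a homomorphism from the torus. -/
def diagHom (F : Type u) [Field F] (r : ℕ) : (Fin r → Fˣ) →* GL (Fin r) F where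
  toFun := diagGL
  map_one' := Units.ext (by simp [diagGL])
  map_mul' x y := Units.ext (by simp [diagGL, Matrix.diagonal_mul_diagonal])

/-- Elementary unipotent matrices of size two. -/
def unip (t : F) : GL (Fin 2) F where
  val := !![1, t; 0, 1]
  inv := !![1, -t; 0, 1]
  val_inv := by simp [Matrix.one_fin_two]
  inv_val := by simp [Matrix.one_fin_two]

variable (F) in
/-- The Weyl element of size two. -/
def weylMatrix : GL (Fin 2) F where
  val := !![0, 1; -1, 0]
  inv := !![0, -1; 1, 0]
  val_inv := by simp [Matrix.one_fin_two]
  inv_val := by simp [Matrix.one_fin_two]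

theorem diagGL_fin_two (p : Fin 2 → Fˣ) :
    (diagGL p : GL (Fin 2) F).val = !![(p 0 : F), 0; 0, (p 1 : F)] := by
  ext i j
  fin_cases i <;> fin_cases j <;> simp [diagGL]

/-- The torus of `GL_2`. -/
def torusTwo (F : Type u) [Field F] : Fˣ × Fˣ →* GL (Fin 2) F :=
  (diagHom F 2).comp
    { toFun := fun p => ![p.1, p.2]
      map_one' := by funext i; fin_cases i <;> rfl
      map_mul' := fun p q => by funext i; fin_cases i <;> rfl }

theorem torusTwo_val (p : Fˣ × Fˣ) :
    (torusTwo F p).val = !![(p.1 : F), 0; 0, (p.2 : F)] := diagGL_fin_two _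

/-- The Steinberg relation in `H_2(GL_2(F))`. -/
theorem symb_steinberg_two (k : Type u) [CommRing k] [Infinite F] {a b : Fˣ}
    (hab : (a : F) + b = 1) :
    BarQuot.symb k ![torusTwo F (a, 1), torusTwo F (b, b⁻¹)] = 0 := by
  refine BarExt.symb_eq_zero_of_commute (central_steinberg (F := F)
    (BarExt.proj_surjective (k := k)) BarExt.central (u := unip) (T := torusTwo F)
    (J := weylMatrix F) (fun s t => ?_) (fun p t => ?_) (fun p => ?_) ?_ (fun c => ?_) hab rfl rfl)
  · exact Units.ext (by simp [unip, add_comm])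
  · rw [mul_inv_eq_iff_eq_mul]
    refine Units.ext ?_
    simp only [Units.val_mul, torusTwo_val, unip, Matrix.mul_fin_two]
    simp
    field_simp
  · refine Units.ext ?_
    simp [torusTwo_val, weylMatrix]
  · refine Units.ext ?_
    simp only [Units.val_mul, torusTwo_val, weylMatrix]
    simp
  · refine Units.ext ?_
    have : ((weylMatrix F)⁻¹ : GL (Fin 2) F).val = !![0, -1; 1, 0] := rfl
    simp only [Units.val_mul, torusTwo_val, this]
    simp [weylMatrix, unip]

/-! ### The alternating map of a torus -/

/-- The element of the torus with given additive coordinates. -/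
def torusElt {r : ℕ} (v : Fin r → Ab F) : Fin r → Fˣ := fun j => (v j).toMul

theorem torusElt_add {r : ℕ} (v w : Fin r → Ab F) :
    torusElt (v + w) = torusElt v * torusElt w := rfl

variable (k : Type u) [CommRing k]

/-- The class of the alternating chain of a tuple of diagonal matrices. -/
def torusSymbFun (r n : ℕ) (x : Fin n → Fin r → Ab F) : BarQuot k (GL (Fin r) F) n :=
  BarQuot.symb k fun l => diagGL (torusElt (x l))

theorem torusSymbFun_eq (r n : ℕ) (x : Fin n → Fin r → Ab F) :
    torusSymbFun k r n x = BarQuot.map (diagHom F r) (BarQuot.symb k fun l => torusElt (x l)) :=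
  (BarQuot.map_symb (diagHom F r) fun l => torusElt (x l)).symm

theorem torusSymbFun_update_add {r n : ℕ} (x : Fin n → Fin r → Ab F) (i : Fin n)
    (v w : Fin r → Ab F) : torusSymbFun k r n (Function.update x i (v + w)) =
      torusSymbFun k r n (Function.update x i v) + torusSymbFun k r n (Function.update x i w) := by
  have e (v : Fin r → Ab F) : (fun l => torusElt (Function.update x i v l)) =
      Function.update (fun l => torusElt (x l)) i (torusElt v) :=
    Function.comp_update torusElt x i v
  simp only [torusSymbFun_eq, e, torusElt_add, BarQuot.symb_update_mul, map_add]

theorem torusSymbFun_update_smul {r n : ℕ} (x : Fin n → Fin r → Ab F) (i : Fin n) (m : ℤ)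
    (v : Fin r → Ab F) : torusSymbFun k r n (Function.update x i (m • v)) =
      m • torusSymbFun k r n (Function.update x i v) :=
  map_zsmul (AddMonoidHom.mk' (fun v => torusSymbFun k r n (Function.update x i v))
    (torusSymbFun_update_add k x i)) m v

variable (F) in
/-- The alternating map on a torus given by the classes of alternating chains. -/
def torusSymb (r n : ℕ) : (Fin r → Ab F) [⋀^Fin n]→ₗ[ℤ] BarQuot k (GL (Fin r) F) n where
  toFun := torusSymbFun k r n
  map_update_add' x i v w := by
    convert torusSymbFun_update_add k x i v w
  map_update_smul' x i m v := by
    convert torusSymbFun_update_smul k x i m v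
  map_eq_zero_of_eq' x i j h hij :=
    (congrArg _ (Bar.cChain_eq_zero _ hij (by rw [h]))).trans (map_zero _)

theorem torusSymb_apply {r n : ℕ} (x : Fin n → Fin r → Ab F) :
    torusSymb F k r n x = BarQuot.symb k fun l => diagGL (torusElt (x l)) := rfl

/-- The matrix of a permutation of the coordinates. -/
def permGL (F : Type u) [Field F] {r : ℕ} (σ : Equiv.Perm (Fin r)) : GL (Fin r) F where
  val := Matrix.of fun i j => if i = σ j then 1 else 0
  inv := Matrix.of fun i j => if σ i = j then 1 else 0
  val_inv := by
    ext i j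
    simp only [Matrix.mul_apply, Matrix.of_apply, ite_mul, one_mul, zero_mul, Matrix.one_apply]
    rw [Finset.sum_eq_single (σ.symm i)]
    · simp
    · intro l _ hl
      rw [if_neg]
      rintro rfl
      simp at hl
    · simp
  inv_val := by
    ext i j
    simp [Matrix.mul_apply, Matrix.one_apply]

/-- Permuting the coordinates of a diagonal matrix is conjugation by a permutation matrix, which
does not affect classes by `map_conj`. -/
theorem torusSymb_perm {r n : ℕ} (σ : Equiv.Perm (Fin r)) (x : Fin n → Fin r → Ab F) :
    torusSymb F k r n (fun l => x l ∘ σ) = torusSymb F k r n x := by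
  refine (BarQuot.map_conj (k := k) (A := Fin r → Fˣ) (f := diagHom F r)
    (f' := (diagHom F r).comp
      { toFun := fun d => d ∘ σ, map_one' := rfl, map_mul' := fun _ _ => rfl })
    (h := permGL F σ) (fun d => Units.ext ?_) fun l => torusElt (x l)).symm
  ext i j
  simp only [permGL, diagHom, diagGL, Units.val_mul, MonoidHom.comp_apply, MonoidHom.coe_mk,
    OneHom.coe_mk, Matrix.mul_diagonal, Matrix.diagonal_mul, Matrix.of_apply, Function.comp_apply]
  split_ifs with h
  · rw [h]; ring
  · simp

theorem exists_perm_pair {α : Type*} [DecidableEq α] {p q i j : α} (hpq : p ≠ q) (hij : i ≠ j) :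
    ∃ σ : Equiv.Perm α, σ p = i ∧ σ q = j := by
  refine ⟨Equiv.swap (Equiv.swap p i q) j * Equiv.swap p i, ?_, by simp⟩
  rw [Equiv.Perm.mul_apply, Equiv.swap_apply_left, Equiv.swap_apply_of_ne_of_ne _ hij]
  exact fun h => hpq ((Equiv.swap p i).injective (by rw [Equiv.swap_apply_left, ← h]))

-- The central letters are put in front of the last two one by one, with `symb_cons_eq_zero`.
variable {k} in
theorem BarQuot.symb_eq_zero_of_central {G : Type u} [Group G] : ∀ {n : ℕ} (y : Fin (n + 2) → G),
    (∀ (l : Fin n) g, y l.castSucc.castSucc * g = g * y l.castSucc.castSucc) →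
    symb k ![y (Fin.last n).castSucc, y (Fin.last (n + 1))] = 0 → symb k y = 0
  | 0, y, _, h => by
    have : y = ![y (Fin.last 0).castSucc, y (Fin.last 1)] := by
      funext i; fin_cases i <;> rfl
    rwa [this]
  | n + 1, y, hc, h => by
    rw [← Fin.cons_self_tail y]
    exact symb_cons_eq_zero (hc 0) (symb_eq_zero_of_central (Fin.tail y)
      (fun l g => hc l.succ g) h)

/-- The decomposition of the coordinates into the first two and the others. -/
def splitTwo (s : ℕ) : Fin 2 ⊕ Fin s ≃ Fin (s + 2) :=
  finSumFinEquiv.trans (finCongr (Nat.add_comm 2 s))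

theorem splitTwo_inl_zero (s : ℕ) : splitTwo s (Sum.inl 0) = 0 := rfl

theorem splitTwo_inl_one (s : ℕ) : splitTwo s (Sum.inl 1) = 1 := rfl

theorem splitTwo_inr_ne_zero (s : ℕ) (m : Fin s) : splitTwo s (Sum.inr m) ≠ 0 := by
  rw [← splitTwo_inl_zero]; simp

theorem splitTwo_inr_ne_one (s : ℕ) (m : Fin s) : splitTwo s (Sum.inr m) ≠ 1 := by
  rw [← splitTwo_inl_one]; simp

/-- The homomorphism `(M, c, z) ↦ diag(c M, z)`. -/
def blockTwo (F : Type u) [Field F] (s : ℕ) :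
    GL (Fin 2) F × (Fˣ × (Fin s → Fˣ)) →* GL (Fin (s + 2)) F :=
  MonoidHom.toHomUnits
    { toFun := fun g => Matrix.reindex (splitTwo s) (splitTwo s)
        (Matrix.fromBlocks ((g.2.1 : F) • g.1.val) 0 0 (Matrix.diagonal fun m => (g.2.2 m : F)))
      map_one' := by simp
      map_mul' := fun g g' => by
        simp [Matrix.submatrix_mul_equiv, Matrix.fromBlocks_multiply, smul_smul, mul_comm] }

theorem blockTwo_diag {s : ℕ} (p : Fin 2 → Fˣ) (c : Fˣ) (z : Fin s → Fˣ) {v : Fin (s + 2) → Fˣ}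
    (h0 : v 0 = c * p 0) (h1 : v 1 = c * p 1) (hz : ∀ m, v (splitTwo s (Sum.inr m)) = z m) :
    blockTwo F s (diagGL p, c, z) = diagGL v := by
  refine Units.ext ?_
  change Matrix.reindex (splitTwo s) (splitTwo s) (Matrix.fromBlocks
    ((c : F) • Matrix.diagonal fun m => (p m : F)) 0 0 (Matrix.diagonal fun m => (z m : F))) =
      Matrix.diagonal fun m => (v m : F)
  rw [← Matrix.diagonal_smul, Matrix.fromBlocks_diagonal, Matrix.reindex_apply,
    Matrix.submatrix_diagonal_equiv, Matrix.diagonal_eq_diagonal_iff]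
  intro m
  obtain ⟨m, rfl⟩ := (splitTwo s).surjective m
  rw [Function.comp_apply, Equiv.symm_apply_apply]
  rcases m with m | m
  · fin_cases m
    · simp [splitTwo_inl_zero, h0]
    · simp [splitTwo_inl_one, h1]
  · simp [hz]

/-- As all other arguments agree in the first two coordinates, the tuple lifts along `blockTwo`. In
the source of that homomorphism the other entries are central, while the entries `i` and `j` lie in
the factor `GL_2`, where `symb_steinberg_two` applies. -/
theorem torusSymb_steinberg [Infinite F] {s n : ℕ} {x : Fin n → Fin (s + 2) → Ab F} {i j : Fin n}
    (hij : i ≠ j) {a b : Fˣ} (hab : (a : F) + b = 1)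
    (hi : x i = Pi.single (0 : Fin (s + 2)) (Additive.ofMul a))
    (hj : x j = Pi.single (0 : Fin (s + 2)) (Additive.ofMul b) -
      Pi.single (1 : Fin (s + 2)) (Additive.ofMul b))
    (hx : ∀ l, l ≠ i → l ≠ j → x l 0 = x l 1) : torusSymb F k (s + 2) n x = 0 := by
  obtain ⟨n, rfl⟩ : ∃ m, n = m + 2 :=
    ⟨n - 2, by have := i.isLt; have := j.isLt; have := Fin.val_ne_of_ne hij; omega⟩
  obtain ⟨σ, hσi, hσj⟩ := exists_perm_pair
    (p := (Fin.last n).castSucc) (q := Fin.last (n + 1)) (by simp [Fin.ext_iff]) hij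
  let y (l : Fin (n + 2)) : GL (Fin 2) F × (Fˣ × (Fin s → Fˣ)) :=
    (if l = i then torusTwo F (a, 1) else if l = j then torusTwo F (b, b⁻¹) else 1,
      if l = i ∨ l = j then 1 else (x l 0).toMul, fun m => (x l (splitTwo s (Sum.inr m))).toMul)
  have hy0 : BarQuot.symb k (y ∘ σ) = 0 := by
    refine BarQuot.symb_eq_zero_of_central _ (fun l g => ?_) ?_
    · have h1 : σ l.castSucc.castSucc ≠ i := fun h => by
        rw [← hσi, σ.injective.eq_iff] at h; simp [Fin.ext_iff] at h; omega
      have h2 : σ l.castSucc.castSucc ≠ j := fun h => by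
        rw [← hσj, σ.injective.eq_iff] at h; simp [Fin.ext_iff] at h; omega
      refine Prod.ext ?_ (mul_comm _ _)
      simp [y, h1, h2]
    · have e : ![(y ∘ σ) (Fin.last n).castSucc, (y ∘ σ) (Fin.last (n + 1))] =
          MonoidHom.inl (GL (Fin 2) F) (Fˣ × (Fin s → Fˣ)) ∘
            ![torusTwo F (a, 1), torusTwo F (b, b⁻¹)] := by
        have hi' : (fun m => (x i (splitTwo s (Sum.inr m))).toMul) = 1 := by
          funext m; simp [hi, Pi.single_eq_of_ne (splitTwo_inr_ne_zero s m)]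
        have hj' : (fun m => (x j (splitTwo s (Sum.inr m))).toMul) = 1 := by
          funext m
          simp [hj, Pi.single_eq_of_ne (splitTwo_inr_ne_zero s m),
            Pi.single_eq_of_ne (splitTwo_inr_ne_one s m)]
        funext m
        fin_cases m
        · simp [y, hσi, hi', Prod.ext_iff]
        · simp [y, hσj, hj', Prod.ext_iff, hij.symm]
      rw [e, ← BarQuot.map_symb, symb_steinberg_two k hab, map_zero]
  rw [BarQuot.symb_comp_perm] at hy0
  have hy : BarQuot.symb k y = 0 := by
    rcases Int.units_eq_one_or (Equiv.Perm.sign σ) with h | h <;> simpa [h] using hy0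
  have e : (fun l => diagGL (torusElt (x l))) = blockTwo F s ∘ y := by
    funext l
    rw [eq_comm]
    by_cases h1 : l = i
    · subst h1
      simp only [Function.comp_apply, y, if_true, true_or]
      refine blockTwo_diag _ _ _ ?_ ?_ fun m => rfl <;> simp [hi, torusElt]
    by_cases h2 : l = j
    · subst h2
      simp only [Function.comp_apply, y, if_true, or_true, if_neg h1]
      refine blockTwo_diag _ _ _ ?_ ?_ fun m => rfl <;> simp [hj, torusElt]
    · simp only [Function.comp_apply, y, h1, h2, if_false, or_self]
      rw [← map_one (diagHom F 2)]
      refine blockTwo_diag _ _ _ ?_ ?_ fun m => rfl <;> simp [torusElt, hx l h1 h2]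
  rw [torusSymb_apply, e, ← BarQuot.map_symb, hy, map_zero]

end

/-! ### Symbols attached to alternating maps on a torus -/

section Symbols

variable {F : Type u} [Field F] {N : Type*} [AddCommGroup N] {r n p : ℕ}

/-- The cocharacter `v` of the torus. -/
def cochar (v : Fin r → ℤ) : Ab F →ₗ[ℤ] (Fin r → Ab F) :=
  (AddMonoidHom.mk' (fun a j => v j • a) fun a b => funext fun j => smul_add (v j) a b).toIntLinearMap

theorem cochar_apply (v : Fin r → ℤ) (a : Ab F) (j : Fin r) : cochar v a j = v j • a := rfl

theorem cochar_add (v w : Fin r → ℤ) (a : Ab F) : cochar (v + w) a = cochar v a + cochar w a :=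
  funext fun j => add_smul (v j) (w j) a

theorem cochar_smul (m : ℤ) (v : Fin r → ℤ) (a : Ab F) :
    cochar (m • v) a = m • cochar v a := funext fun j => mul_smul m (v j) a

theorem cochar_comp (v : Fin r → ℤ) (a : Ab F) (σ : Fin r → Fin r) :
    cochar v a ∘ σ = cochar (v ∘ σ) a := rfl

theorem cochar_single (i : Fin r) (a : Ab F) : cochar (Pi.single i 1) a = Pi.single i a := by
  funext j
  rw [cochar_apply]
  by_cases h : j = i
  · subst h; simp
  · simp [Pi.single_eq_of_ne h]

/-- The indicator function of the first `i` coordinates. -/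
def ones (r i : ℕ) : Fin r → ℤ := fun j => if j.val < i then 1 else 0

/-- The cocharacter underlying the matrices `C_{i+1, r}`. -/
def cvec (r i : ℕ) : Fin r → ℤ := fun j =>
  if j.val < i then 1 else if j.val = i then (if i = 0 then 1 else -(i : ℤ)) else 0

theorem cvec_eq {i : ℕ} (hi : i < r) :
    cvec r i = ones r i + (if i = 0 then 1 else -(i : ℤ)) • Pi.single ⟨i, hi⟩ 1 := by
  funext j
  simp only [cvec, ones, Pi.add_apply, Pi.smul_apply, Pi.single_apply, Fin.ext_iff]
  split_ifs <;> simp <;> omega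

theorem ones_zero (r : ℕ) : ones r 0 = 0 := by
  funext j; simp [ones]

theorem ones_succ {i : ℕ} (hi : i < r) :
    ones r (i + 1) = ones r i + Pi.single ⟨i, hi⟩ 1 := by
  funext j
  simp only [ones, Pi.add_apply, Pi.single_apply, Fin.ext_iff]
  split_ifs <;> omega

theorem ones_comp_swap {i : ℕ} {a b : Fin r} (h : a.val < i ↔ b.val < i) :
    ones r i ∘ Equiv.swap a b = ones r i := by
  funext j
  simp only [ones, Function.comp_apply, Equiv.swap_apply_def]
  split_ifs <;> simp_all <;> omega

theorem single_comp_swap (a b : Fin r) :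
    (Pi.single a 1 : Fin r → ℤ) ∘ Equiv.swap a b = Pi.single b 1 := by
  funext j
  simp only [Pi.single_apply, Function.comp_apply, Equiv.swap_apply_eq_iff, Equiv.swap_apply_left]

theorem cvec_comp_swap {i : ℕ} {a b : Fin r} (h : a.val < i ∧ b.val < i ∨ i < a.val ∧ i < b.val) :
    cvec r i ∘ Equiv.swap a b = cvec r i := by
  funext j
  simp only [cvec, Function.comp_apply, Equiv.swap_apply_def]
  split_ifs <;> simp_all <;> omega

/-- The alternating map as a bilinear function of two of its arguments. -/
def pairAt (τ : (Fin r → Ab F) [⋀^Fin n]→ₗ[ℤ] N) (x : Fin n → Fin r → Ab F) {i j : Fin n}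
    (hij : i ≠ j) : (Fin r → Ab F) →ₗ[ℤ] (Fin r → Ab F) →ₗ[ℤ] N :=
  LinearMap.mk₂ ℤ (fun v w => τ (Function.update (Function.update x i v) j w))
    (fun v v' w => by simp only [Function.update_comm hij, AlternatingMap.map_update_add])
    (fun m v w => by simp only [Function.update_comm hij, AlternatingMap.map_update_smul])
    (fun v w w' => AlternatingMap.map_update_add _ _ _ _ _)
    (fun m v w => AlternatingMap.map_update_smul _ _ _ _ _)

theorem pairAt_apply (τ : (Fin r → Ab F) [⋀^Fin n]→ₗ[ℤ] N) (x : Fin n → Fin r → Ab F) {i j : Fin n}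
    (hij : i ≠ j) (v w : Fin r → Ab F) :
    pairAt τ x hij v w = τ (Function.update (Function.update x i v) j w) := rfl

theorem pairAt_swap (τ : (Fin r → Ab F) [⋀^Fin n]→ₗ[ℤ] N) (x : Fin n → Fin r → Ab F) {i j : Fin n}
    (hij : i ≠ j) (v w : Fin r → Ab F) : pairAt τ x hij v w = -pairAt τ x hij w v := by
  rw [pairAt_apply, pairAt_apply, ← AlternatingMap.map_swap _ _ hij]
  congr 1
  funext l
  simp only [Function.comp_apply, Equiv.swap_apply_def, Function.update_apply]
  split_ifs <;> simp_all

/-- The cancellation behind the antisymmetry of symbols. -/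
theorem pair_antisymm (G : (Fin r → Ab F) →ₗ[ℤ] (Fin r → Ab F) →ₗ[ℤ] N) {a b : Fin r}
    (hG : ∀ v w, G v w = -G w v)
    (hs : ∀ v w, G (v ∘ Equiv.swap a b) (w ∘ Equiv.swap a b) = G v w)
    {o : Fin r → ℤ} (ho : o ∘ Equiv.swap a b = o) {m t : ℤ} (hmt : (m + t) • o = 0) (x y : Ab F) :
    G (cochar (o + t • Pi.single a 1) x)
        (cochar (o + Pi.single a 1 + (-(m + 1)) • Pi.single b 1) y) =
      -G (cochar (o + t • Pi.single a 1) y)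
        (cochar (o + Pi.single a 1 + (-(m + 1)) • Pi.single b 1) x) := by
  have e := single_comp_swap a b
  have h1 := hG (cochar o x) (cochar o y)
  have h2 := hs (cochar o x) (cochar (Pi.single a 1) y)
  have h2' := hs (cochar o y) (cochar (Pi.single a 1) x)
  have h3 := hG (cochar (Pi.single a 1) x) (cochar o y)
  have h3' := hG (cochar (Pi.single a 1) y) (cochar o x)
  have h4 := hG (cochar (Pi.single a 1) x) (cochar (Pi.single a 1) y)
  have h5 := hs (cochar (Pi.single a 1) x) (cochar (Pi.single b 1) y)
  have h5' := hG (cochar (Pi.single a 1) y) (cochar (Pi.single b 1) x)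
  -- The mixed terms in `o` and the `a`-th coordinate do not cancel by symmetry alone. They occur
  -- with the coefficient `m + t`, which annihilates `o`.
  have h6 : (m + t) • G (cochar o x) (cochar (Pi.single a 1) y) = 0 := by
    rw [← LinearMap.smul_apply, ← map_smul, ← cochar_smul, hmt]
    rw [show cochar (F := F) (0 : Fin r → ℤ) x = 0 from funext fun j => zero_smul ℤ x, map_zero,
      LinearMap.zero_apply]
  have h6' : (m + t) • G (cochar o y) (cochar (Pi.single a 1) x) = 0 := by
    rw [← LinearMap.smul_apply, ← map_smul, ← cochar_smul, hmt]
    rw [show cochar (F := F) (0 : Fin r → ℤ) y = 0 from funext fun j => zero_smul ℤ y, map_zero,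
      LinearMap.zero_apply]
  simp only [cochar_comp, e, ho] at h2 h2'
  rw [cochar_comp, cochar_comp, e, Equiv.swap_comm, single_comp_swap] at h5
  simp only [cochar_add, cochar_smul, map_add, map_smul, LinearMap.add_apply, LinearMap.smul_apply]
  linear_combination (norm := module) h1 - (m + 1) • h2 - (m + 1) • h2' + t • h3 + t • h3' + t • h4 +
    (t * (m + 1)) • h5 - (t * (m + 1)) • h5' - h6 - h6'

/-- An alternating map on a torus that is invariant under permutations of the first `p` coordinates
and satisfies the Steinberg relation in the first two coordinates. -/
structure IsSymbolic (p : ℕ) (τ : (Fin r → Ab F) [⋀^Fin n]→ₗ[ℤ] N) : Prop where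
  swap : ∀ i j : Fin r, i.val < p → j.val < p → ∀ x, τ (fun l => x l ∘ Equiv.swap i j) = τ x
  steinberg : 2 ≤ p → ∀ (i₀ i₁ : Fin r), i₀.val = 0 → i₁.val = 1 → ∀ (x : Fin n → Fin r → Ab F)
    (i j : Fin n), i ≠ j → ∀ a b : Fˣ, (a : F) + b = 1 → x i = Pi.single i₀ (Additive.ofMul a) →
    x j = Pi.single i₀ (Additive.ofMul b) - Pi.single i₁ (Additive.ofMul b) →
    (∀ l, l ≠ i → l ≠ j → x l i₀ = x l i₁) → τ x = 0

theorem isSymbolic_torusSymb [Infinite F] (k : Type u) [CommRing k] (r n p : ℕ) :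
    IsSymbolic p (torusSymb F k r n) where
  swap i j _ _ x := torusSymb_perm k _ x
  steinberg _ i₀ i₁ h₀ h₁ x i j hij a b hab hi hj hx := by
    obtain ⟨s, rfl⟩ : ∃ s, r = s + 2 := ⟨r - 2, by have := i₁.isLt; omega⟩
    obtain rfl : i₀ = 0 := Fin.ext h₀
    obtain rfl : i₁ = 1 := Fin.ext h₁
    exact torusSymb_steinberg k hij hab hi hj hx

/-- An argument that is constant on the first `p` coordinates is fixed by their permutations and
meets the side condition of the Steinberg relation, so it may be frozen. -/
theorem IsSymbolic.curryLeft {τ : (Fin r → Ab F) [⋀^Fin (n + 1)]→ₗ[ℤ] N} (h : IsSymbolic p τ)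
    {v : Fin r → ℤ} (hv : ∀ i j : Fin r, i.val < p → j.val < p → v i = v j) (a : Ab F) :
    IsSymbolic p (τ.curryLeft (cochar v a)) where
  swap i j hi hj x := by
    rw [AlternatingMap.curryLeft_apply_apply, AlternatingMap.curryLeft_apply_apply,
      ← h.swap i j hi hj (Matrix.vecCons _ x)]
    congr 1
    funext l
    rw [eq_comm]
    refine Fin.cases ?_ (fun l => rfl) l
    funext m
    simp only [Matrix.cons_val_zero, Function.comp_apply, Equiv.swap_apply_def, cochar_apply]
    split_ifs with h1 h2
    · rw [h1, hv i j hi hj]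
    · rw [h2, hv i j hi hj]
    · rfl
  steinberg hp i₀ i₁ h₀ h₁ x i j hij a' b hab hi hj hx := by
    refine h.steinberg hp i₀ i₁ h₀ h₁ (Matrix.vecCons (cochar v a) x) i.succ j.succ (by simpa) a' b
      hab hi hj fun l => ?_
    refine Fin.cases (fun _ _ => ?_) (fun l hli hlj => ?_) l
    · change v i₀ • a = v i₁ • a
      rw [hv i₀ i₁ (by omega) (by omega)]
    · exact hx l (fun e => hli (by rw [e])) (fun e => hlj (by rw [e]))

/-- The value of an alternating map on the matrices `C_{i, r}(c_i)`. -/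
def symbolValue (τ : (Fin r → Ab F) [⋀^Fin p]→ₗ[ℤ] N) (c : Fin p → Ab F) : N :=
  τ fun i => cochar (cvec r i) (c i)

/-- Let `o` be the indicator of the first `i` coordinates. The matrices in slots `i` and `i + 1`
have the cocharacters `o + t e_i` and `o + e_i - (i + 1) e_{i+1}`, and those in the other slots are
fixed by exchanging the coordinates `i` and `i + 1`. So `pair_antisymm` applies with `m = i`. -/
theorem symbolValue_swap (hpr : p ≤ r) {τ : (Fin r → Ab F) [⋀^Fin p]→ₗ[ℤ] N} (h : IsSymbolic p τ)
    (c : Fin p → Ab F) {i j : Fin p} (hij : j.val = i.val + 1) :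
    symbolValue τ (c ∘ Equiv.swap i j) = -symbolValue τ c := by
  have hne : i ≠ j := fun e => by rw [e] at hij; omega
  let x (l : Fin p) : Fin r → Ab F := cochar (cvec r l) (c l)
  have hx (y z : Ab F) :
      symbolValue τ (Function.update (Function.update c i y) j z) =
        pairAt τ x hne (cochar (cvec r i) y) (cochar (cvec r j) z) := by
    rw [pairAt_apply, symbolValue]
    congr 1
    funext l
    simp only [Function.update_apply, x]
    split_ifs with h1 h2
    · rw [h1]
    · rw [h2]
    · rfl
  have e1 : c ∘ Equiv.swap i j = Function.update (Function.update c i (c j)) j (c i) := by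
    funext l
    simp only [Function.comp_apply, Equiv.swap_apply_def, Function.update_apply]
    split_ifs <;> simp_all
  have e2 : c = Function.update (Function.update c i (c i)) j (c j) := by simp
  rw [e1]
  conv_rhs => rw [e2]
  have hir : i.val < r := by omega
  have hjr : j.val < r := by omega
  have hj : cvec r j = ones r i + Pi.single ⟨i, hir⟩ 1 +
      (-((i.val : ℤ) + 1)) • Pi.single ⟨j, hjr⟩ 1 := by
    have h1 : ones r j = ones r (i + 1) := by rw [hij]
    have h2 : ((j : ℕ) : ℤ) = i + 1 := by rw [hij]; push_cast; rfl
    rw [cvec_eq hjr, ← ones_succ hir, if_neg (by omega), h1, h2]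
  rw [hx, hx, cvec_eq hir, hj]
  refine pair_antisymm _ (pairAt_swap τ x hne) (fun v w => ?_)
    (ones_comp_swap (by simp [hij])) ?_ _ _
  · rw [pairAt_apply, pairAt_apply, ← h.swap ⟨i, hir⟩ ⟨j, hjr⟩ i.isLt j.isLt]
    congr 1
    funext l
    simp only [Function.update_apply, x]
    split_ifs with h1 h2
    · rw [Function.comp_assoc, ← Equiv.Perm.coe_mul, Equiv.swap_mul_self]; rfl
    · rw [Function.comp_assoc, ← Equiv.Perm.coe_mul, Equiv.swap_mul_self]; rfl
    · have h1' := Fin.val_ne_of_ne h1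
      have h2' := Fin.val_ne_of_ne h2
      rw [cochar_comp, cvec_comp_swap]
      dsimp only
      omega
  -- Here `t = -i`, except that `t = 1` for `i = 0`; in that case `o` vanishes.
  · split_ifs with h0
    · rw [h0, ones_zero, smul_zero]
    · rw [add_neg_cancel, zero_smul]

theorem symbolValue_perm (hpr : p ≤ r) {τ : (Fin r → Ab F) [⋀^Fin p]→ₗ[ℤ] N} (h : IsSymbolic p τ)
    (σ : Equiv.Perm (Fin p)) (c : Fin p → Ab F) :
    symbolValue τ (c ∘ σ) = Equiv.Perm.sign σ • symbolValue τ c := by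
  rcases p with _ | p
  · simp [Subsingleton.elim σ 1]
  have hσ : σ ∈ Submonoid.closure (Set.range fun i : Fin p => Equiv.swap i.castSucc i.succ) := by
    rw [Equiv.Perm.mclosure_swap_castSucc_succ]; trivial
  induction hσ using Submonoid.closure_induction generalizing c with
  | mem σ hσ =>
    obtain ⟨i, rfl⟩ := hσ
    rw [symbolValue_swap hpr h c (by simp), Equiv.Perm.sign_swap (Fin.castSucc_lt_succ).ne]
    simp
  | one => simp
  | mul σ τ' _ _ hσ hτ =>
    rw [Equiv.Perm.coe_mul, ← Function.comp_assoc, hτ, hσ, smul_smul, map_mul, mul_comm]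

/-- By antisymmetry the two entries may be moved to the first two slots. There the matrices are
`diag(c, 1, …)` and `diag(c, c⁻¹, 1, …)`, and all later ones are constant on the first two
coordinates. -/
theorem symbolValue_steinberg (hpr : p ≤ r) {τ : (Fin r → Ab F) [⋀^Fin p]→ₗ[ℤ] N}
    (h : IsSymbolic p τ) (c : Fin p → Fˣ) {i j : Fin p} (hij : j.val = i.val + 1)
    (hc : (c i : F) + c j = 1) : symbolValue τ (fun l => Additive.ofMul (c l)) = 0 := by
  have hp : 2 ≤ p := by omega
  obtain ⟨σ, hσi, hσj⟩ := exists_perm_pair (p := (⟨0, by omega⟩ : Fin p)) (q := ⟨1, by omega⟩)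
    (by simp) (show i ≠ j from fun e => by rw [e] at hij; omega)
  have key : symbolValue τ ((fun l => Additive.ofMul (c l)) ∘ σ) = 0 := by
    refine h.steinberg hp ⟨0, by omega⟩ ⟨1, by omega⟩ rfl rfl _ ⟨0, by omega⟩ ⟨1, by omega⟩
      (by simp) (c i) (c j) hc ?_ ?_ fun l hl0 hl1 => ?_
    · rw [Function.comp_apply, hσi, ← cochar_single]
      congr 2
      funext m
      simp only [cvec, Pi.single_apply, Fin.ext_iff]
      simp
    · rw [Function.comp_apply, hσj, ← cochar_single, ← cochar_single]
      funext m
      simp only [cvec, cochar_apply, Pi.single_apply, Fin.ext_iff, Pi.sub_apply]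
      have : (m.val < 1) = (m.val = 0) := by simp
      simp only [this]
      split_ifs <;> simp_all
    · have h0 : l.val ≠ 0 := fun e => hl0 (Fin.ext e)
      have h1 : l.val ≠ 1 := fun e => hl1 (Fin.ext e)
      simp only [cochar_apply, cvec]
      rw [if_pos (by omega), if_pos (by omega)]
  rw [symbolValue_perm hpr h] at key
  rcases Int.units_eq_one_or (Equiv.Perm.sign σ) with h | h <;> simpa [h] using key

/-- The homomorphism on Milnor `K`-theory attached to a symbolic alternating map. -/
def symbolHom (hpr : p ≤ r) (τ : (Fin r → Ab F) [⋀^Fin p]→ₗ[ℤ] N) (h : IsSymbolic p τ) :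
    KM F p →+ N :=
  KM.desc (PiTensorProduct.lift (τ.toMultilinearMap.compLinearMap
    fun i : Fin p => cochar (cvec r i))).toAddMonoidHom fun c _ _ hij hc =>
      (PiTensorProduct.lift.tprod _).trans (symbolValue_steinberg hpr h c hij hc)

theorem symbolHom_symbol (hpr : p ≤ r) (τ : (Fin r → Ab F) [⋀^Fin p]→ₗ[ℤ] N) (h : IsSymbolic p τ)
    (c : Fin p → Fˣ) :
    symbolHom hpr τ h (KM.symbol c) = symbolValue τ fun l => Additive.ofMul (c l) :=
  (KM.desc_symbol _ _ c).trans (PiTensorProduct.lift.tprod _)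

/-- Multiplication by `a` places it in the matrix `C_1` and shifts the `c_i`; here it sits in
`C_{p+1}` and the `c_i` keep their matrices. Rotating the symbol and rotating the arguments of `τ`
cost the same sign. -/
theorem symbolValue_cons (hpr : p + 1 ≤ r) {τ : (Fin r → Ab F) [⋀^Fin (p + 1)]→ₗ[ℤ] N}
    (h : IsSymbolic (p + 1) τ) (a : Ab F) (c : Fin p → Ab F) :
    symbolValue τ (Fin.cons a c : Fin (p + 1) → Ab F) =
      τ (Fin.cons (cochar (cvec r p) a) fun i : Fin p => cochar (cvec r i) (c i)) := by
  have h1 := symbolValue_perm hpr h (finRotate (p + 1)) (Fin.cons a c)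
  have h2 := τ.map_perm
    (Fin.cons (cochar (cvec r p) a) fun i : Fin p => cochar (cvec r i) (c i)) (finRotate (p + 1))
  have e : symbolValue τ ((Fin.cons a c : Fin (p + 1) → Ab F) ∘ finRotate (p + 1)) =
      τ ((Fin.cons (cochar (cvec r p) a) fun i : Fin p => cochar (cvec r i) (c i)) ∘
        finRotate (p + 1)) := by
    rw [symbolValue]
    congr 1
    have e1 := Fin.snoc_eq_cons_rotate c a
    have e2 := Fin.snoc_eq_cons_rotate (fun i : Fin p => cochar (cvec r i) (c i))
      (cochar (cvec r p) a)
    funext l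
    rw [Function.comp_apply, Function.comp_apply, ← congrFun e1 l, ← congrFun e2 l]
    refine Fin.lastCases ?_ (fun l => ?_) l <;> simp
  rw [h1, h2] at e
  exact smul_left_cancel _ e

end Symbols

/-! ### Maps on tensor products with Milnor K-groups, and their relations to the differentials. -/

section Pairings

variable {F : Type u} [Field F] {N : Type*} [AddCommGroup N] {r p : ℕ}

theorem IsSymbolic.mono {n p p' : ℕ} (hp : p' ≤ p) {τ : (Fin r → Ab F) [⋀^Fin n]→ₗ[ℤ] N}
    (h : IsSymbolic p τ) : IsSymbolic p' τ where
  swap i j hi hj x := h.swap i j (hi.trans_le hp) (hj.trans_le hp) x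
  steinberg hp' := h.steinberg (hp'.trans hp)

/-- The tuple underlying the matrices `C_{i, r}(c_i)`. -/
def symbolTuple (r : ℕ) (c : Fin p → Fˣ) : Fin p → Fin r → Ab F :=
  fun i => cochar (cvec r i) (Additive.ofMul (c i))

/-- The condition that `v` is constant on the first `p` coordinates. -/
def ConstBelow (p : ℕ) (v : Fin r → ℤ) : Prop :=
  ∀ i j : Fin r, i.val < p → j.val < p → v i = v j

/-- The homomorphism `a ⊗ {c_1, …, c_p} ↦ τ(v(a), C_1(c_1), …, C_p(c_p))`. -/
def psi (hpr : p ≤ r) (τ : (Fin r → Ab F) [⋀^Fin (p + 1)]→ₗ[ℤ] N) (h : IsSymbolic p τ)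
    (v : Fin r → ℤ) (hv : ConstBelow p v) : Ab F ⊗[ℤ] KM F p →+ N :=
  TensorProduct.liftAddHom
    (AddMonoidHom.mk' (fun a => symbolHom hpr (τ.curryLeft (cochar v a)) (h.curryLeft hv a))
      fun a b => by
        ext κ
        induction κ using KM.symbol_induction with
        | h1 c => simp [symbolHom_symbol, symbolValue]
        | h2 r x hx => simp only [map_zsmul, hx]
        | h3 x y hx hy =>
          exact (map_add _ x y).trans ((congrArg₂ (· + ·) hx hy).trans (map_add _ x y).symm))
    fun m a κ => by rw [map_zsmul, map_zsmul, AddMonoidHom.zsmul_apply]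

theorem psi_tmul (hpr : p ≤ r) (τ : (Fin r → Ab F) [⋀^Fin (p + 1)]→ₗ[ℤ] N) (h : IsSymbolic p τ)
    (v : Fin r → ℤ) (hv : ConstBelow p v) (a : Ab F) (c : Fin p → Fˣ) :
    psi hpr τ h v hv (a ⊗ₜ KM.symbol c) = τ (Fin.cons (cochar v a) (symbolTuple r c)) :=
  symbolHom_symbol hpr _ (h.curryLeft hv a) c

theorem tensor_hom_ext {f g : Ab F ⊗[ℤ] KM F p →+ N}
    (H : ∀ a c, f (a ⊗ₜ KM.symbol c) = g (a ⊗ₜ KM.symbol c)) (x) : f x = g x := by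
  induction x with
  | zero => simp
  | add x y hx hy => simp only [map_add, hx, hy]
  | tmul a κ =>
    induction κ using KM.symbol_induction with
    | h1 c => exact H a c
    | h2 r x hx => simp only [TensorProduct.tmul_smul, map_zsmul, hx]
    | h3 x y hx hy => simp only [TensorProduct.tmul_add, map_add, hx, hy]

theorem tensor₂_hom_ext {f g : Tensor₂ ℤ (Ab F) (KM F p) →+ N}
    (H : ∀ a b c, f (a ⊗ₜ (b ⊗ₜ KM.symbol c)) = g (a ⊗ₜ (b ⊗ₜ KM.symbol c))) (x) : f x = g x := by
  induction x using TensorProduct.induction_on with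
  | zero => simp
  | add x y hx hy => simp only [map_add, hx, hy]
  | tmul a x =>
    exact tensor_hom_ext (f := f.comp (TensorProduct.mk ℤ _ _ a).toAddMonoidHom)
      (g := g.comp (TensorProduct.mk ℤ _ _ a).toAddMonoidHom) (fun b c => H a b c) x

theorem tensor₃_hom_ext {f g : Ab F ⊗[ℤ] Tensor₂ ℤ (Ab F) (KM F p) →+ N}
    (H : ∀ a b c d, f (a ⊗ₜ (b ⊗ₜ (c ⊗ₜ KM.symbol d))) = g (a ⊗ₜ (b ⊗ₜ (c ⊗ₜ KM.symbol d))))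
    (x) : f x = g x := by
  induction x using TensorProduct.induction_on with
  | zero => simp
  | add x y hx hy => simp only [map_add, hx, hy]
  | tmul a x =>
    exact tensor₂_hom_ext (f := f.comp (TensorProduct.mk ℤ _ _ a).toAddMonoidHom)
      (g := g.comp (TensorProduct.mk ℤ _ _ a).toAddMonoidHom) (fun b c => H a b c) x

/-- The homomorphism `a ⊗ b ⊗ {c_1, …, c_p} ↦ τ(v(a), w(b), C_1(c_1), …, C_p(c_p))`. -/
def phi (hpr : p ≤ r) (τ : (Fin r → Ab F) [⋀^Fin (p + 2)]→ₗ[ℤ] N) (h : IsSymbolic p τ)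
    (v w : Fin r → ℤ) (hv : ConstBelow p v) (hw : ConstBelow p w) :
    Tensor₂ ℤ (Ab F) (KM F p) →+ N :=
  TensorProduct.liftAddHom
    (AddMonoidHom.mk'
      (fun a => psi hpr (τ.curryLeft (cochar v a)) (h.curryLeft hv a) w hw)
      fun a b => AddMonoidHom.ext <| tensor_hom_ext fun a c => by simp [psi_tmul])
    fun m a κ => by rw [map_zsmul, map_zsmul, AddMonoidHom.zsmul_apply]

theorem phi_tmul (hpr : p ≤ r) (τ : (Fin r → Ab F) [⋀^Fin (p + 2)]→ₗ[ℤ] N) (h : IsSymbolic p τ)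
    (v w : Fin r → ℤ) (hv : ConstBelow p v) (hw : ConstBelow p w) (a b : Ab F) (c : Fin p → Fˣ) :
    phi hpr τ h v w hv hw (a ⊗ₜ (b ⊗ₜ KM.symbol c)) =
      τ (Fin.cons (cochar v a) (Fin.cons (cochar w b) (symbolTuple r c))) :=
  psi_tmul hpr _ (h.curryLeft hv a) w hw b c

/-- The symmetrization of `phi`. -/
def symPhi (hpr : p ≤ r) (τ : (Fin r → Ab F) [⋀^Fin (p + 2)]→ₗ[ℤ] N) (h : IsSymbolic p τ)
    (v w : Fin r → ℤ) (hv : ConstBelow p v) (hw : ConstBelow p w) :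
    Tensor₂ ℤ (Ab F) (KM F p) →+ N :=
  phi hpr τ h v w hv hw +
    (phi hpr τ h v w hv hw).comp (TensorProduct.leftComm ℤ (Ab F) (Ab F) (KM F p)).toAddEquiv

/-- An alternating map as a bilinear function of its first two arguments. -/
def pairCons (τ : (Fin r → Ab F) [⋀^Fin (p + 2)]→ₗ[ℤ] N) (x : Fin p → Fin r → Ab F) :
    (Fin r → Ab F) →ₗ[ℤ] (Fin r → Ab F) →ₗ[ℤ] N :=
  pairAt τ (Fin.cons 0 (Fin.cons 0 x)) (zero_ne_one : (0 : Fin (p + 2)) ≠ 1)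

theorem pairCons_apply (τ : (Fin r → Ab F) [⋀^Fin (p + 2)]→ₗ[ℤ] N) (x : Fin p → Fin r → Ab F)
    (v w : Fin r → Ab F) : pairCons τ x v w = τ (Fin.cons v (Fin.cons w x)) := by
  refine congrArg τ ?_
  rw [Fin.update_cons_zero, show (1 : Fin (p + 2)) = Fin.succ 0 from rfl, ← Fin.cons_update,
    Fin.update_cons_zero]

theorem pairCons_swap (τ : (Fin r → Ab F) [⋀^Fin (p + 2)]→ₗ[ℤ] N) (x : Fin p → Fin r → Ab F)
    (v w : Fin r → Ab F) : pairCons τ x v w = -pairCons τ x w v := pairAt_swap _ _ _ _ _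

theorem symPhi_tmul (hpr : p ≤ r) (τ : (Fin r → Ab F) [⋀^Fin (p + 2)]→ₗ[ℤ] N) (h : IsSymbolic p τ)
    (v w : Fin r → ℤ) (hv : ConstBelow p v) (hw : ConstBelow p w) (a b : Ab F) (c : Fin p → Fˣ) :
    symPhi hpr τ h v w hv hw (a ⊗ₜ (b ⊗ₜ KM.symbol c)) =
      pairCons τ (symbolTuple r c) (cochar v a) (cochar w b) +
        pairCons τ (symbolTuple r c) (cochar v b) (cochar w a) := by
  rw [pairCons_apply, pairCons_apply, ← phi_tmul hpr τ h v w hv hw a b c,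
    ← phi_tmul hpr τ h v w hv hw b a c]
  rfl

/-- By `symbolValue_cons`, the factor that the differential multiplies into the symbol becomes the
argument of `C_{p+1}`. -/
theorem psi_delta₂ (hpr : p + 1 ≤ r) (τ : (Fin r → Ab F) [⋀^Fin (p + 2)]→ₗ[ℤ] N)
    (h : IsSymbolic (p + 1) τ) (v : Fin r → ℤ) (hv : ConstBelow (p + 1) v) (a b : Ab F)
    (c : Fin p → Fˣ) :
    psi hpr τ h v hv (δ₂ F p (a ⊗ₜ (b ⊗ₜ KM.symbol c))) =
      pairCons τ (symbolTuple r c) (cochar v b) (cochar (cvec r p) a) +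
        pairCons τ (symbolTuple r c) (cochar v a) (cochar (cvec r p) b) := by
  have key (a b : Ab F) : psi hpr τ h v hv (b ⊗ₜ KM.mul F p a (KM.symbol c)) =
      pairCons τ (symbolTuple r c) (cochar v b) (cochar (cvec r p) a) := by
    rw [KM.mul_symbol, psi_tmul, pairCons_apply]
    have := symbolValue_cons hpr (h.curryLeft hv b) a fun i => Additive.ofMul (c i)
    refine Eq.trans ?_ this
    rw [symbolValue, AlternatingMap.curryLeft_apply_apply]
    refine congrArg τ (congrArg (Fin.cons _) (funext fun l => ?_))
    refine Fin.cases ?_ (fun l => ?_) l <;> simp [symbolTuple]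
  rw [delta₂_tmul, map_add, key, key]

theorem cvec_eq_ones {q : ℕ} (hq : q + 1 < r) :
    ones r (q + 1) = cvec r (q + 1) + ((q : ℤ) + 1) • Pi.single ⟨q + 1, hq⟩ 1 := by
  rw [cvec_eq hq, if_neg (by omega), add_assoc, ← add_smul]
  simp

theorem constBelow_ones {i : ℕ} (h : p ≤ i) : ConstBelow p (ones r i) := fun a b ha hb => by
  rw [ones, ones, if_pos (by omega), if_pos (by omega)]

theorem constBelow_single {i : Fin r} (h : p ≤ i.val) :
    ConstBelow p (Pi.single i 1 : Fin r → ℤ) := fun a b ha hb => by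
  rw [Pi.single_eq_of_ne (fun e => by rw [e] at ha; omega),
    Pi.single_eq_of_ne (fun e => by rw [e] at hb; omega)]

variable {q : ℕ}

section

variable (τ : (Fin (q + 2) → Ab F) [⋀^Fin (q + 3)]→ₗ[ℤ] N) (h : IsSymbolic (q + 2) τ)

/-- The homomorphism underlying the chains `w(x)`, up to sign. -/
def wHom : Tensor₂ ℤ (Ab F) (KM F (q + 1)) →+ N :=
  symPhi (by omega) τ (h.mono (by omega)) (Pi.single (Fin.last (q + 1)) 1) (ones _ (q + 1))
    (constBelow_single (by simp)) (constBelow_ones le_rfl)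

/-- The homomorphism of which `wHom` is a multiple on the kernel of `δ₂`. -/
def wHom' : Tensor₂ ℤ (Ab F) (KM F (q + 1)) →+ N :=
  symPhi (by omega) τ (h.mono (by omega)) (ones _ (q + 2)) (Pi.single (Fin.last (q + 1)) 1)
    (constBelow_ones (by omega)) (constBelow_single (by simp))

/-- The pairing with scalar matrices. -/
def scalarHom : Ab F ⊗[ℤ] KM F (q + 2) →+ N :=
  psi le_rfl τ h (ones _ (q + 2)) (constBelow_ones le_rfl)

/-- With `C = cvec (q + 2) (q + 1)` and `e` the last coordinate, `ones (q + 1)` is `C + (q + 1) e`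
and `ones (q + 2)` is `C + (q + 2) e`. Let `S` be the symmetrization of `G(e(a), C(b))`. Since
symmetrized terms of type `(C, C)` and `(e, e)` cancel, `wHom` is `S`, `wHom'` is `-S`, and
`scalarHom` after `δ₂` is `(q + 2) S`. The same computation proves `smul_wHom`. -/
theorem wHom_eq (x : Tensor₂ ℤ (Ab F) (KM F (q + 1))) :
    wHom τ h x = scalarHom τ h (δ₂ F (q + 1) x) + ((q : ℤ) + 1) • wHom' τ h x := by
  refine tensor₂_hom_ext (f := wHom τ h) (g := (scalarHom τ h).comp (δ₂ F (q + 1)).toAddMonoidHom +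
    ((q : ℤ) + 1) • wHom' τ h) (fun a b c => ?_) x
  rw [AddMonoidHom.add_apply, AddMonoidHom.zsmul_apply, wHom', wHom, symPhi_tmul, symPhi_tmul]
  change _ = scalarHom τ h (δ₂ F (q + 1) (a ⊗ₜ (b ⊗ₜ KM.symbol c))) + _
  rw [scalarHom, psi_delta₂]
  generalize hG : pairCons τ (symbolTuple (q + 2) c) = G
  have hs (v w : Fin (q + 2) → Ab F) : G v w = -G w v := by rw [← hG, pairCons_swap]
  have hl : (⟨q + 1, by omega⟩ : Fin (q + 2)) = Fin.last (q + 1) := rfl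
  rw [ones_succ (show q + 1 < q + 2 by omega), cvec_eq_ones (show q + 1 < q + 2 by omega), hl]
  simp only [cochar_add, cochar_smul, map_add, map_smul, LinearMap.add_apply, LinearMap.smul_apply]
  generalize (cochar (cvec (q + 2) (q + 1))) a = ca
  generalize (cochar (cvec (q + 2) (q + 1))) b = cb
  generalize (cochar (Pi.single (Fin.last (q + 1)) 1)) a = ea
  generalize (cochar (Pi.single (Fin.last (q + 1)) 1)) b = eb
  linear_combination (norm := module) (-1 : ℤ) • hs ca cb - ((q : ℤ) + 1) • hs ca eb -
    ((q : ℤ) + 1) • hs cb ea - (((q : ℤ) + 1) * (q + 1)) • hs ea eb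

theorem smul_wHom (x : Tensor₂ ℤ (Ab F) (KM F (q + 1))) :
    ((q : ℤ) + 2) • wHom τ h x = scalarHom τ h (δ₂ F (q + 1) x) := by
  refine tensor₂_hom_ext (f := ((q : ℤ) + 2) • wHom τ h)
    (g := (scalarHom τ h).comp (δ₂ F (q + 1)).toAddMonoidHom) (fun a b c => ?_) x
  rw [AddMonoidHom.zsmul_apply, wHom, symPhi_tmul]
  change _ = scalarHom τ h (δ₂ F (q + 1) (a ⊗ₜ (b ⊗ₜ KM.symbol c)))
  rw [scalarHom, psi_delta₂]
  generalize hG : pairCons τ (symbolTuple (q + 2) c) = G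
  have hs (v w : Fin (q + 2) → Ab F) : G v w = -G w v := by rw [← hG, pairCons_swap]
  have hl : (⟨q + 1, by omega⟩ : Fin (q + 2)) = Fin.last (q + 1) := rfl
  rw [ones_succ (show q + 1 < q + 2 by omega), cvec_eq_ones (show q + 1 < q + 2 by omega), hl]
  simp only [cochar_add, cochar_smul, map_add, map_smul, LinearMap.add_apply, LinearMap.smul_apply]
  generalize (cochar (cvec (q + 2) (q + 1))) a = ca
  generalize (cochar (cvec (q + 2) (q + 1))) b = cb
  generalize (cochar (Pi.single (Fin.last (q + 1)) 1)) a = ea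
  generalize (cochar (Pi.single (Fin.last (q + 1)) 1)) b = eb
  linear_combination (norm := module) (-1 : ℤ) • hs ca cb +
    (((q : ℤ) + 2) * (q + 1)) • hs ea eb

/-- The value is a sum of `T(u, e, C_{q+1})` over all six orders of `a, b, c`, where `C_{q+1}` has
the cocharacter `o + t e'`. Each term of its expansion is odd under exchanging two of the three
elements, because `T` alternates and is invariant under exchanging the last two coordinates. -/
theorem wHom'_delta₃ (y : Ab F ⊗[ℤ] Tensor₂ ℤ (Ab F) (KM F q)) : wHom' τ h (δ₃ F q y) = 0 := by
  refine tensor₃_hom_ext (f := (wHom' τ h).comp (δ₃ F q).toAddMonoidHom) (g := 0)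
    (fun a b c d => ?_) y
  change wHom' τ h (δ₃ F q (a ⊗ₜ (b ⊗ₜ (c ⊗ₜ KM.symbol d)))) = 0
  let T (v w z : Fin (q + 2) → Ab F) : N :=
    τ (Fin.cons v (Fin.cons w (Fin.cons z (symbolTuple (q + 2) d))))
  have h12 (v w z) : T v w z = -T w v z := by
    simp only [T, ← pairCons_apply]
    exact pairCons_swap _ _ _ _
  have h23 (v w z) : T v w z = -T v z w := by
    have := pairCons_swap (τ.curryLeft v) (symbolTuple (q + 2) d) w z
    rw [pairCons_apply, pairCons_apply] at this
    exact this
  have hadd (v v' w z) : T (v + v') w z = T v w z + T v' w z := by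
    simp only [T, ← pairCons_apply, map_add, LinearMap.add_apply]
  have hadd3 (v w z z') : T v w (z + z') = T v w z + T v w z' := by
    rw [h23, h12, h23, hadd, h23 v w z, h12 v z w, h23 z, h23 v w z', h12 v z' w, h23 z']
    abel
  have hsmul3 (m : ℤ) (v w z) : T v w (m • z) = m • T v w z :=
    map_zsmul (AddMonoidHom.mk' (T v w) (hadd3 v w)) m z
  have hq : q < q + 2 := by omega
  -- The remaining arguments `C_1, …, C_q` are trivial in the last two coordinates.
  have hsw (v w z : Fin (q + 2) → Ab F) :
      T (v ∘ Equiv.swap ⟨q, hq⟩ (Fin.last (q + 1))) (w ∘ Equiv.swap ⟨q, hq⟩ (Fin.last (q + 1)))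
        (z ∘ Equiv.swap ⟨q, hq⟩ (Fin.last (q + 1))) = T v w z := by
    refine Eq.trans ?_ (h.swap ⟨q, hq⟩ (Fin.last (q + 1)) (by simp) (by simp) _)
    refine congrArg τ (funext fun l => ?_)
    refine Fin.cases rfl (fun l => Fin.cases rfl (fun l => Fin.cases rfl (fun l => ?_) l) l) l
    have hl := l.isLt
    simp only [Fin.cons_succ, symbolTuple, cochar_comp]
    rw [cvec_comp_swap (by simp)]
  let u (a : Ab F) : Fin (q + 2) → Ab F := cochar (ones _ (q + 2)) a
  let e (a : Ab F) : Fin (q + 2) → Ab F := cochar (Pi.single (Fin.last (q + 1)) 1) a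
  let e' (a : Ab F) : Fin (q + 2) → Ab F := cochar (Pi.single ⟨q, hq⟩ 1) a
  let o (a : Ab F) : Fin (q + 2) → Ab F := cochar (ones _ q) a
  have hu (a : Ab F) : u a = o a + e' a + e a := by
    simp only [u, o, e, e', ← cochar_add]
    rw [ones_succ (show q + 1 < q + 2 by omega), ones_succ (show q < q + 2 by omega)]
    rfl
  have hus (a : Ab F) : u a ∘ Equiv.swap ⟨q, hq⟩ (Fin.last (q + 1)) = u a := by
    simp only [u, cochar_comp]
    rw [ones_comp_swap (by simp)]
  have hos (a : Ab F) : o a ∘ Equiv.swap ⟨q, hq⟩ (Fin.last (q + 1)) = o a := by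
    simp only [o, cochar_comp]
    rw [ones_comp_swap (by simp)]
  have hes' (a : Ab F) : e' a ∘ Equiv.swap ⟨q, hq⟩ (Fin.last (q + 1)) = e a := by
    simp only [e', e, cochar_comp, single_comp_swap]
  have hes (a : Ab F) : e a ∘ Equiv.swap ⟨q, hq⟩ (Fin.last (q + 1)) = e' a := by
    simp only [e', e, cochar_comp]
    rw [Equiv.swap_comm, single_comp_swap]
  -- This and the next three relations are the antisymmetries that cancel the sum in pairs.
  have he' (a b c : Ab F) : T (u a) (e b) (e' c) = -T (u a) (e c) (e' b) := by
    rw [h23, ← hsw (u a) (e' c) (e b), hus, hes, hes']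
  have hoo (a b c : Ab F) : T (o a) (e b) (o c) = -T (o c) (e b) (o a) := by
    rw [h12, h23, h12, neg_neg]
  have hee (a b c : Ab F) : T (e a) (e b) (o c) = -T (e b) (e a) (o c) := h12 _ _ _
  have he'e (a b c : Ab F) : T (e' a) (e b) (o c) = -T (e' b) (e a) (o c) := by
    rw [h12, ← hsw (e b), hos, hes, hes']
  have huo (a b c : Ab F) : T (u a) (e b) (o c) =
      T (o a) (e b) (o c) + T (e' a) (e b) (o c) + T (e a) (e b) (o c) := by
    rw [hu, hadd, hadd]
  have key (a b c : Ab F) : wHom' τ h (a ⊗ₜ (b ⊗ₜ KM.mul F q c (KM.symbol d))) =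
      T (u a) (e b) (cochar (cvec _ q) c) + T (u b) (e a) (cochar (cvec _ q) c) := by
    have hc (a b : Ab F) : τ (Fin.cons (u a) (Fin.cons (e b)
        (symbolTuple (q + 2) (Fin.cons c.toMul d : Fin (q + 1) → Fˣ)))) =
          T (u a) (e b) (cochar (cvec _ q) c) := by
      have := symbolValue_cons (r := q + 2) (p := q) (by omega)
        (((h.mono (p' := q + 1) (by omega)).curryLeft (v := ones (q + 2) (q + 2))
          (constBelow_ones (by omega)) a).curryLeft (v := Pi.single (Fin.last (q + 1)) 1)
          (constBelow_single (by simp)) b) c fun i => Additive.ofMul (d i)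
      refine Eq.trans (congrArg τ (congrArg (Fin.cons _) (congrArg (Fin.cons _)
        (funext fun l => ?_)))) this
      refine Fin.cases ?_ (fun l => ?_) l <;> simp [symbolTuple]
    rw [KM.mul_symbol, wHom', symPhi_tmul, pairCons_apply, pairCons_apply]
    exact congrArg₂ (· + ·) (hc a b) (hc b a)
  rw [delta₃_tmul, map_add, map_add, key, key, key, cvec_eq hq]
  generalize (if q = 0 then (1 : ℤ) else -(q : ℤ)) = t
  have hC (a : Ab F) : cochar (ones (q + 2) q + t • Pi.single ⟨q, hq⟩ 1) a = o a + t • e' a := by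
    rw [cochar_add, cochar_smul]
  simp only [hC, hadd3, hsmul3, huo]
  linear_combination (norm := module) t • he' b c a + t • he' c b a + t • he' a c b +
    hoo b c a + hoo c b a + hoo b a c + hee a b c + hee a c b + hee b c a + he'e a b c +
    he'e a c b + he'e b c a

end

end Pairings

/-! ### Behaviour under stabilization and under field homomorphisms. -/

section Naturality

variable {F : Type u} [Field F] {N : Type*} [AddCommGroup N] {q : ℕ}

/-- The identity behind the vanishing under stabilization. -/
theorem symPhi_eq_psi (τ : (Fin (q + 3) → Ab F) [⋀^Fin (q + 3)]→ₗ[ℤ] N) (h : IsSymbolic (q + 3) τ)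
    (x : Tensor₂ ℤ (Ab F) (KM F (q + 1))) :
    symPhi (p := q + 1) (by omega) τ (h.mono (by omega))
        (Pi.single (⟨q + 1, by omega⟩ : Fin (q + 3)) 1) (ones _ (q + 1))
        (constBelow_single (by simp)) (constBelow_ones le_rfl) x =
      psi (p := q + 2) (by omega) τ (h.mono (by omega))
        (Pi.single (Fin.last (q + 2)) 1) (constBelow_single (by simp)) (δ₂ F (q + 1) x) := by
  have hv : ConstBelow (q + 2) (Pi.single (Fin.last (q + 2)) 1 : Fin (q + 3) → ℤ) :=
    constBelow_single (by simp)
  refine tensor₂_hom_ext (g := (psi (p := q + 2) (by omega) τ (h.mono (by omega))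
        (Pi.single (Fin.last (q + 2)) 1) hv).comp
          (δ₂ F (q + 1)).toAddMonoidHom) (fun a b c => ?_) x
  change _ = psi (p := q + 2) (by omega) τ (h.mono (by omega)) (Pi.single (Fin.last (q + 2)) 1) hv
    (δ₂ F (q + 1) (a ⊗ₜ (b ⊗ₜ KM.symbol c)))
  rw [symPhi_tmul, psi_delta₂ (p := q + 1)]
  generalize hG : pairCons τ (symbolTuple (q + 3) c) = G
  have hs (v w : Fin (q + 3) → Ab F) : G v w = -G w v := by rw [← hG, pairCons_swap]
  have h1 : q + 1 < q + 3 := by omega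
  -- The arguments `C_1, …, C_{q+1}` are trivial in the last two coordinates of `GL_{q+3}`.
  have hsw (v w : Fin (q + 3) → Ab F) :
      G (v ∘ Equiv.swap ⟨q + 1, h1⟩ (Fin.last (q + 2)))
        (w ∘ Equiv.swap ⟨q + 1, h1⟩ (Fin.last (q + 2))) = G v w := by
    rw [← hG, pairCons_apply, pairCons_apply]
    refine Eq.trans ?_ (h.swap ⟨q + 1, h1⟩ (Fin.last (q + 2)) (by simp) (by simp) _)
    refine congrArg τ (funext fun l => ?_)
    refine Fin.cases rfl (fun l => Fin.cases rfl (fun l => ?_) l) l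
    have hl := l.isLt
    simp only [Fin.cons_succ, symbolTuple, cochar_comp]
    rw [cvec_comp_swap (by simp; omega)]
  have ho (a b : Ab F) :
      G (cochar (Pi.single ⟨q + 1, h1⟩ 1) b) (cochar (ones _ (q + 1)) a) =
        G (cochar (Pi.single (Fin.last (q + 2)) 1) b) (cochar (ones _ (q + 1)) a) := by
    rw [← hsw, cochar_comp, cochar_comp, single_comp_swap, ones_comp_swap (by simp)]
  -- Replacing `ones (q + 1)` by `C_{q+2}` produces pairings of the last two coordinates; this
  -- antisymmetry in `a` and `b` removes them.
  have he (a b : Ab F) :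
      G (cochar (Pi.single (Fin.last (q + 2)) 1) a) (cochar (Pi.single ⟨q + 1, h1⟩ 1) b) =
        -G (cochar (Pi.single (Fin.last (q + 2)) 1) b) (cochar (Pi.single ⟨q + 1, h1⟩ 1) a) := by
    rw [hs, ← hsw, cochar_comp, cochar_comp, single_comp_swap, Equiv.swap_comm, single_comp_swap]
  have e := he a b
  rw [ho, ho]
  simp only [cvec_eq_ones h1, cochar_add, cochar_smul, map_add, map_smul]
  linear_combination (norm := module) ((q : ℤ) + 1) • e

variable (k : Type u) [CommRing k]

theorem stab_diagGL {r : ℕ} (d : Fin r → Fˣ) :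
    stab F r (diagGL d) = diagGL (Fin.snoc d 1 : Fin (r + 1) → Fˣ) := by
  refine Units.ext ?_
  change Matrix.reindex finSumFinEquiv finSumFinEquiv
    (Matrix.fromBlocks (Matrix.diagonal fun i => (d i : F)) 0 0 1) = Matrix.diagonal _
  rw [← Matrix.diagonal_one, Matrix.fromBlocks_diagonal, Matrix.reindex_apply,
    Matrix.submatrix_diagonal_equiv, Matrix.diagonal_eq_diagonal_iff]
  intro m
  refine Fin.lastCases ?_ (fun m => ?_) m
  · simp
  · simp [finSumFinEquiv_symm_apply_castSucc]

theorem map_stab_torusSymb {r n : ℕ} (x : Fin n → Fin r → Ab F) :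
    BarQuot.map (stab F r) (torusSymb F k r n x) =
      torusSymb F k (r + 1) n fun l => (Fin.snoc (x l) 0 : Fin (r + 1) → Ab F) := by
  rw [torusSymb_apply, BarQuot.map_symb, torusSymb_apply]
  congr 1
  funext l
  rw [Function.comp_apply, stab_diagGL]
  congr 1

theorem snoc_cochar {r : ℕ} (v : Fin r → ℤ) (a : Ab F) :
    (Fin.snoc (cochar v a) 0 : Fin (r + 1) → Ab F) =
      cochar (Fin.snoc v 0 : Fin (r + 1) → ℤ) a := by
  funext m
  refine Fin.lastCases ?_ (fun m => ?_) m <;> simp [cochar_apply]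

theorem snoc_cvec {r i : ℕ} (hi : i < r) :
    (Fin.snoc (cvec r i) 0 : Fin (r + 1) → ℤ) = cvec (r + 1) i := by
  funext m
  refine Fin.lastCases ?_ (fun m => ?_) m
  · simp only [Fin.snoc_last, cvec, Fin.val_last]
    rw [if_neg (by omega), if_neg (by omega)]
  · simp [cvec]

theorem snoc_ones {r i : ℕ} (hi : i ≤ r) :
    (Fin.snoc (ones r i) 0 : Fin (r + 1) → ℤ) = ones (r + 1) i := by
  funext m
  refine Fin.lastCases ?_ (fun m => ?_) m
  · simp only [Fin.snoc_last, ones, Fin.val_last]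
    rw [if_neg (by omega)]
  · simp [ones]

theorem snoc_single {r : ℕ} (i : Fin r) :
    (Fin.snoc (Pi.single i 1 : Fin r → ℤ) 0 : Fin (r + 1) → ℤ) = Pi.single i.castSucc 1 := by
  funext m
  refine Fin.lastCases ?_ (fun m => ?_) m
  · rw [Fin.snoc_last, Pi.single_eq_of_ne (Fin.castSucc_lt_last i).ne']
  · simp [Pi.single_apply]

theorem map_torusSymb {F' : Type u} [Field F'] (f : F →+* F') {r n : ℕ} (x : Fin n → Fin r → Ab F) :
    BarQuot.map (Matrix.GeneralLinearGroup.map f) (torusSymb F k r n x) =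
      torusSymb F' k r n fun l m => abMap f (x l m) := by
  rw [torusSymb_apply, BarQuot.map_symb, torusSymb_apply]
  congr 1
  funext l
  refine Units.ext (Matrix.ext fun i j => ?_)
  by_cases hij : i = j
  · subst hij
    simp [diagGL, torusElt, abMap, Matrix.GeneralLinearGroup.map]
  · simp [diagGL, Matrix.GeneralLinearGroup.map, hij]

variable [Infinite F]

/-- The chains `w(x)` modulo boundaries, up to sign. -/
abbrev wBar (F : Type u) [Field F] [Infinite F] (q : ℕ) :
    Tensor₂ ℤ (Ab F) (KM F (q + 1)) →+ BarQuot k (GL (Fin (q + 2)) F) (q + 3) :=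
  wHom (torusSymb F k (q + 2) (q + 3)) (isSymbolic_torusSymb k _ _ _)

/-- The map of which `wBar` is a multiple on the kernel of `δ₂`. -/
abbrev wBar' (F : Type u) [Field F] [Infinite F] (q : ℕ) :
    Tensor₂ ℤ (Ab F) (KM F (q + 1)) →+ BarQuot k (GL (Fin (q + 2)) F) (q + 3) :=
  wHom' (torusSymb F k (q + 2) (q + 3)) (isSymbolic_torusSymb k _ _ _)

/-- Stabilization appends a zero to every cocharacter, so the image is the left side of
`symPhi_eq_psi`, a function of `δ₂ x`. -/
theorem map_stab_wBar (x : Tensor₂ ℤ (Ab F) (KM F (q + 1))) (hx : δ₂ F (q + 1) x = 0) :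
    BarQuot.map (stab F (q + 2)) (wBar k F q x) = 0 := by
  have := symPhi_eq_psi (torusSymb F k (q + 3) (q + 3)) (isSymbolic_torusSymb k _ _ _) x
  rw [hx, map_zero] at this
  rw [← this]
  refine tensor₂_hom_ext (f := (BarQuot.map (stab F (q + 2))).toAddMonoidHom.comp (wBar k F q))
    (fun a b c => ?_) x
  change BarQuot.map (stab F (q + 2)) (wBar k F q (a ⊗ₜ (b ⊗ₜ KM.symbol c))) = _
  have key (a b : Ab F) : BarQuot.map (stab F (q + 2)) (torusSymb F k (q + 2) (q + 3)
      (Fin.cons (cochar (Pi.single (Fin.last (q + 1)) 1) a)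
        (Fin.cons (cochar (ones _ (q + 1)) b) (symbolTuple (q + 2) c)))) =
      torusSymb F k (q + 3) (q + 3)
      (Fin.cons (cochar (Pi.single ⟨q + 1, by omega⟩ 1) a)
        (Fin.cons (cochar (ones _ (q + 1)) b) (symbolTuple (q + 3) c))) := by
    rw [map_stab_torusSymb]
    congr 1
    funext l
    refine Fin.cases ?_ (fun l => Fin.cases ?_ (fun l => ?_) l) l
    · simp only [Fin.cons_zero, snoc_cochar, snoc_single]
      rfl
    · simp only [Fin.cons_succ, Fin.cons_zero, snoc_cochar]
      rw [snoc_ones (by omega)]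
    · simp only [Fin.cons_succ, symbolTuple, snoc_cochar]
      rw [snoc_cvec (by omega)]
  rw [wBar, wHom, symPhi_tmul, symPhi_tmul, map_add]
  simp only [pairCons_apply, key]

theorem wBar_eq (x : Tensor₂ ℤ (Ab F) (KM F (q + 1))) (hx : δ₂ F (q + 1) x = 0) :
    wBar k F q x = ((q : ℤ) + 1) • wBar' k F q x := by
  rw [wBar, wHom_eq, hx, map_zero, zero_add]

theorem smul_wBar (x : Tensor₂ ℤ (Ab F) (KM F (q + 1))) (hx : δ₂ F (q + 1) x = 0) :
    ((q : ℤ) + 2) • wBar k F q x = 0 := by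
  rw [wBar, smul_wHom, hx, map_zero]

variable {F' : Type u} [Field F'] [Infinite F']

theorem map_wBar (f : F →+* F') (x : Tensor₂ ℤ (Ab F) (KM F (q + 1))) :
    BarQuot.map (Matrix.GeneralLinearGroup.map f) (wBar k F q x) =
      wBar k F' q (TensorProduct.map (abMap f) (TensorProduct.map (abMap f) (KM.map f (q + 1))) x)
    := by
  refine tensor₂_hom_ext
    (f := (BarQuot.map (Matrix.GeneralLinearGroup.map f)).toAddMonoidHom.comp (wBar k F q))
    (g := (wBar k F' q).comp (TensorProduct.map (abMap f) (TensorProduct.map (abMap f)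
      (KM.map f (q + 1)))).toAddMonoidHom) (fun a b c => ?_) x
  change BarQuot.map (Matrix.GeneralLinearGroup.map f) (wBar k F q (a ⊗ₜ (b ⊗ₜ KM.symbol c))) =
    wBar k F' q (TensorProduct.map (abMap f) (TensorProduct.map (abMap f) (KM.map f (q + 1)))
      (a ⊗ₜ (b ⊗ₜ KM.symbol c)))
  have hc (v : Fin (q + 2) → ℤ) (a : Ab F) :
      (fun m => abMap f (cochar v a m)) = cochar v (abMap f a) :=
    funext fun m => map_zsmul (abMap f) (v m) a
  have key (a b : Ab F) : BarQuot.map (Matrix.GeneralLinearGroup.map f)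
      (torusSymb F k (q + 2) (q + 3) (Fin.cons (cochar (Pi.single (Fin.last (q + 1)) 1) a)
        (Fin.cons (cochar (ones _ (q + 1)) b) (symbolTuple (q + 2) c)))) =
      torusSymb F' k (q + 2) (q + 3)
      (Fin.cons (cochar (Pi.single (Fin.last (q + 1)) 1) (abMap f a))
        (Fin.cons (cochar (ones _ (q + 1)) (abMap f b)) (symbolTuple (q + 2)
          fun l => Units.map (f : F →* F') (c l)))) := by
    rw [map_torusSymb]
    congr 1
    funext l
    refine Fin.cases ?_ (fun l => Fin.cases ?_ (fun l => ?_) l) l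
    · simp only [Fin.cons_zero, hc]
    · simp only [Fin.cons_succ, Fin.cons_zero, hc]
    · simp only [Fin.cons_succ, symbolTuple, hc]
      rfl
  rw [TensorProduct.map_tmul, TensorProduct.map_tmul, KM.map_symbol, wBar, wHom, symPhi_tmul, wBar,
    wHom, symPhi_tmul, map_add]
  simp only [pairCons_apply, key]

end Naturality

/-! ### Homology classes as chains modulo boundaries -/

section Homology

variable (k : Type u) [CommRing k] (G : Type u) [Group G] (n : ℕ)

/-- The embedding of group homology into chains modulo boundaries. -/
def homologyToQuot : groupHomology (Rep.trivial k G k) n →ₗ[k] BarQuot k G n :=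
  ((groupHomology.inhomogeneousChains (Rep.trivial k G k)).homologyι n ≫
    (groupHomology.inhomogeneousChains (Rep.trivial k G k)).descOpcycles
      (ModuleCat.ofHom (BarQuot.mk k G n)) (n + 1) (by simp) (by
        rw [groupHomology.inhomogeneousChains.d_def]
        exact ModuleCat.hom_ext (LinearMap.ext fun y => BarQuot.mk_d y))).hom

variable {k G n}

theorem homologyToQuot_π (y : groupHomology.cycles (Rep.trivial k G k) n) :
    homologyToQuot k G n (groupHomology.π (Rep.trivial k G k) n y) =
      BarQuot.mk k G n (groupHomology.iCycles (Rep.trivial k G k) n y) := by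
  have h : groupHomology.π (Rep.trivial k G k) n ≫ ModuleCat.ofHom (homologyToQuot k G n) =
      groupHomology.iCycles (Rep.trivial k G k) n ≫ ModuleCat.ofHom (BarQuot.mk k G n) := by
    change (groupHomology.inhomogeneousChains (Rep.trivial k G k)).homologyπ n ≫
      ((groupHomology.inhomogeneousChains (Rep.trivial k G k)).homologyι n ≫
        (groupHomology.inhomogeneousChains (Rep.trivial k G k)).descOpcycles _ _ _ _) = _
    rw [HomologicalComplex.homology_π_ι_assoc, HomologicalComplex.p_descOpcycles]
  exact ConcreteCategory.congr_hom h y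

/-- Thanks to this, every identity between homology classes can be checked in chains modulo
boundaries, where `torusSymb` takes its values. -/
theorem homologyToQuot_injective : Function.Injective (homologyToQuot k G n) := by
  rw [injective_iff_map_eq_zero]
  intro h hh
  induction h using groupHomology_induction_on with
  | h y =>
    rw [homologyToQuot_π] at hh
    obtain ⟨z, hz⟩ := BarQuot.mk_eq_zero.mp hh
    have e : groupHomology.toCycles (Rep.trivial k G k) (n + 1) n z = y := by
      apply (ModuleCat.mono_iff_injective (groupHomology.iCycles (Rep.trivial k G k) n)).mp
        inferInstance
      refine Eq.trans ?_ hz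
      have := ConcreteCategory.congr_hom
        ((groupHomology.inhomogeneousChains (Rep.trivial k G k)).toCycles_i (n + 1) n) z
      rw [groupHomology.inhomogeneousChains.d_def] at this
      exact this
    rw [← e]
    exact ConcreteCategory.congr_hom
      ((groupHomology.inhomogeneousChains (Rep.trivial k G k)).toCycles_comp_homologyπ (n + 1) n) z

theorem isRepresentedBy_of_homologyToQuot {z : Bar k G (n + 1)} (hz : Bar.d k G n z = 0)
    {h : groupHomology (Rep.trivial k G k) (n + 1)}
    (hh : homologyToQuot k G (n + 1) h = BarQuot.mk k G (n + 1) z) : IsRepresentedBy h z := by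
  have hd : (groupHomology.inhomogeneousChains (Rep.trivial k G k)).d (n + 1) n z = 0 := by
    rw [groupHomology.inhomogeneousChains.d_def]
    exact hz
  have e := groupHomology.iCycles_mk (A := Rep.trivial k G k) (by simp) z hd
  refine ⟨groupHomology.cyclesMk (n + 1) n (by simp) z hd, e, homologyToQuot_injective ?_⟩
  rw [hh, homologyToQuot_π, e]

theorem mk_mem_range_homologyToQuot {z : Bar k G (n + 1)} (hz : Bar.d k G n z = 0) :
    BarQuot.mk k G (n + 1) z ∈ LinearMap.range (homologyToQuot k G (n + 1)) := by
  have hd : (groupHomology.inhomogeneousChains (Rep.trivial k G k)).d (n + 1) n z = 0 := by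
    rw [groupHomology.inhomogeneousChains.d_def]
    exact hz
  refine ⟨groupHomology.π (Rep.trivial k G k) (n + 1)
    (groupHomology.cyclesMk (n + 1) n (by simp) z hd), ?_⟩
  rw [homologyToQuot_π, groupHomology.iCycles_mk]

theorem homologyToQuot_map {H : Type u} [Group H] (φ : G →* H)
    (h : groupHomology (Rep.trivial k G k) n) :
    homologyToQuot k H n (homologyMap k φ n h) = BarQuot.map φ (homologyToQuot k G n h) := by
  induction h using groupHomology_induction_on with
  | h y =>
    have e1 : homologyMap k φ n (groupHomology.π (Rep.trivial k G k) n y) =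
        groupHomology.π (Rep.trivial k H k) n
          (groupHomology.cyclesMap (A := Rep.trivial k G k) (B := Rep.trivial k H k) φ
            (𝟙 (Rep.trivial k G k)) n y) :=
      groupHomology.π_map_apply (A := Rep.trivial k G k) (B := Rep.trivial k H k) φ
        (𝟙 (Rep.trivial k G k)) n y
    have e2 := ConcreteCategory.congr_hom (HomologicalComplex.cyclesMap_i (groupHomology.chainsMap
      (A := Rep.trivial k G k) (B := Rep.trivial k H k) φ (𝟙 (Rep.trivial k G k))) n) y
    rw [e1, homologyToQuot_π, homologyToQuot_π, BarQuot.map_mk]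
    refine congrArg (BarQuot.mk k H n) (e2.trans ?_)
    refine DFunLike.congr_fun (Bar.hom_ext (k := k) (f := ((groupHomology.chainsMap
      (A := Rep.trivial k G k) (B := Rep.trivial k H k) φ (𝟙 (Rep.trivial k G k))).f n).hom)
      (g := Bar.map k φ n) fun x => ?_) _
    rw [Bar.map_word]
    exact groupHomology.chainsMap_f_single (A := Rep.trivial k G k) (B := Rep.trivial k H k) φ
      (𝟙 (Rep.trivial k G k)) n x 1

end Homology

/-! ### Descent to `B_{q+3}(F)` with values in the kernel of stabilization. -/

section Lift

/-- Applied to the subgroup of classes of cycles, this shows that `wBar'` comes from homology. -/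
theorem symPhi_mem {F : Type u} [Field F] {N : Type*} [AddCommGroup N] {r p : ℕ} (hpr : p ≤ r)
    (τ : (Fin r → Ab F) [⋀^Fin (p + 2)]→ₗ[ℤ] N) (h : IsSymbolic p τ)
    (v w : Fin r → ℤ) (hv : ConstBelow p v) (hw : ConstBelow p w) (S : AddSubgroup N)
    (hS : ∀ y, τ y ∈ S) (x : Tensor₂ ℤ (Ab F) (KM F p)) : symPhi hpr τ h v w hv hw x ∈ S := by
  rw [← QuotientAddGroup.eq_zero_iff]
  refine tensor₂_hom_ext (f := (QuotientAddGroup.mk' S).comp (symPhi hpr τ h v w hv hw)) (g := 0)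
    (fun a b c => (QuotientAddGroup.eq_zero_iff _).mpr ?_) x
  rw [symPhi_tmul, pairCons_apply, pairCons_apply]
  exact add_mem (hS _) (hS _)

theorem d_cChain_diagGL {F : Type u} [Field F] (k : Type u) [CommRing k] {r n : ℕ}
    (t : Fin (n + 1) → Fin r → Fˣ) :
    Bar.d k (GL (Fin r) F) n (cChain k fun l => diagGL (t l)) = 0 := by
  have : (cChain k fun l => diagGL (t l)) = Bar.map k (diagHom F r) (n + 1) (cChain k t) :=
    (Bar.map_cChain (diagHom F r) t).symm
  rw [this, ← Bar.map_d, Bar.d_cChain_of_comm, map_zero]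

variable (k : Type u) [CommRing k] (F : Type u) [Field F]

theorem torusSymb_mem_range {r n : ℕ} (x : Fin (n + 1) → Fin r → Ab F) :
    torusSymb F k r (n + 1) x ∈
      LinearMap.range (homologyToQuot k (GL (Fin r) F) (n + 1)) :=
  mk_mem_range_homologyToQuot (d_cChain_diagGL k fun l => torusElt (x l))

theorem incl_injective (n : ℕ) : Function.Injective (StabKer.incl k F n) :=
  Subtype.val_injective

variable [Infinite F] (q : ℕ)

/-- The homology classes of which the classes of the chains `w(x)` are multiples. -/
def reducedTensor : Tensor₂ ℤ (Ab F) (KM F (q + 1)) →+ HGL k F (q + 2) (q + 3) :=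
  (LinearEquiv.ofInjective (homologyToQuot k (GL (Fin (q + 2)) F) (q + 3))
    homologyToQuot_injective).symm.toLinearMap.toAddMonoidHom.comp <|
    (-wBar' k F q).codRestrict
      (LinearMap.range (homologyToQuot k (GL (Fin (q + 2)) F) (q + 3))).toAddSubgroup fun x =>
      neg_mem <| symPhi_mem _ _ _ _ _ _ _ _ (torusSymb_mem_range k F) x

theorem homologyToQuot_reducedTensor (x : Tensor₂ ℤ (Ab F) (KM F (q + 1))) :
    homologyToQuot k _ (q + 3) (reducedTensor k F q x) = -wBar' k F q x :=
  congrArg Subtype.val (LinearEquiv.apply_symm_apply (LinearEquiv.ofInjective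
    (homologyToQuot k (GL (Fin (q + 2)) F) (q + 3)) homologyToQuot_injective) _)

/-- The map induced by `reducedTensor` on `B_{q+3}(F)`. -/
def reducedHom : BMilnor F q →+ HGL k F (q + 2) (q + 3) :=
  (Submodule.liftQ _ ((reducedTensor k F q).toIntLinearMap ∘ₗ
    (LinearMap.ker (δ₂ F (q + 1))).subtype) <| by
      rintro ⟨x, hx⟩ ⟨y, rfl⟩
      refine homologyToQuot_injective ?_
      refine (homologyToQuot_reducedTensor k F q _).trans ?_
      rw [map_zero, neg_eq_zero]
      exact wHom'_delta₃ _ _ y).toAddMonoidHom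

/-- The class in `B_{q+3}(F)` of an element of the kernel of `δ₂`. -/
abbrev BMilnor.mk {F : Type u} [Field F] {q : ℕ} (x : LinearMap.ker (δ₂ F (q + 1))) :
    BMilnor F q := Submodule.Quotient.mk x

theorem homologyToQuot_reducedHom (x : LinearMap.ker (δ₂ F (q + 1))) :
    homologyToQuot k _ (q + 3) (reducedHom k F q (BMilnor.mk x)) = -wBar' k F q x :=
  homologyToQuot_reducedTensor k F q x

theorem homologyToQuot_smul_reducedHom (x : LinearMap.ker (δ₂ F (q + 1))) :
    homologyToQuot k _ (q + 3) (((q : ℤ) + 1) • reducedHom k F q (BMilnor.mk x)) =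
      -wBar k F q x := by
  rw [map_zsmul, homologyToQuot_reducedHom, wBar_eq k x.1 x.2, smul_neg]

/-- The homomorphism `φ_{q+3}`. -/
def phiHom : BMilnor F q →+ StabKer k F (q + 3) :=
  -- The factor is `n - 2`. For this multiple the class is that of `w(x)`, to which `map_stab_wBar`
  -- applies.
  AddMonoidHom.codRestrict (((q : ℤ) + 1) • reducedHom k F q)
    (LinearMap.ker (homologyMap k (stab F (q + 2)) (q + 3))) fun x => by
      obtain ⟨x, rfl⟩ := Submodule.Quotient.mk_surjective _ x
      refine LinearMap.mem_ker.mpr (homologyToQuot_injective ?_)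
      rw [homologyToQuot_map, AddMonoidHom.zsmul_apply, homologyToQuot_smul_reducedHom, map_neg,
        map_stab_wBar k x.1 x.2, neg_zero, map_zero]

theorem incl_phiHom (x : BMilnor F q) :
    StabKer.incl k F (q + 3) (phiHom k F q x) = ((q : ℤ) + 1) • reducedHom k F q x := rfl

theorem homologyToQuot_phiHom (x : LinearMap.ker (δ₂ F (q + 1))) :
    homologyToQuot k _ (q + 3) (StabKer.incl k F (q + 3) (phiHom k F q (BMilnor.mk x))) =
      -wBar k F q x := homologyToQuot_smul_reducedHom k F q x

theorem smul_phiHom (x : BMilnor F q) : (q + 2) • phiHom k F q x = 0 := by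
  obtain ⟨x, rfl⟩ := Submodule.Quotient.mk_surjective _ x
  refine incl_injective k F (q + 3) (homologyToQuot_injective ?_)
  rw [map_nsmul, map_nsmul, homologyToQuot_phiHom, map_zero, map_zero, ← natCast_zsmul, smul_neg]
  push_cast
  rw [smul_wBar k x.1 x.2, neg_zero]

/-- The map is `n - 2` times a homomorphism on the whole group, so it kills whatever multiplication
by `n - 2` kills. -/
theorem phiHom_eq_zero {x : BMilnor F q} (hx : ((q : ℤ) + 1) • x = 0) : phiHom k F q x = 0 := by
  refine incl_injective k F (q + 3) ?_
  rw [incl_phiHom, ← map_zsmul, hx, map_zero, map_zero]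

variable {F} {F' : Type u} [Field F'] [Infinite F']

theorem homologyMap_phiHom (f : F →+* F') (x : BMilnor F q) :
    homologyMap k (Matrix.GeneralLinearGroup.map f) (q + 3)
        (StabKer.incl k F (q + 3) (phiHom k F q x)) =
      StabKer.incl k F' (q + 3) (phiHom k F' q (BMilnor.map f q x)) := by
  obtain ⟨x, rfl⟩ := Submodule.Quotient.mk_surjective _ x
  refine homologyToQuot_injective ?_
  refine (homologyToQuot_map _ _).trans ?_
  rw [homologyToQuot_phiHom]
  refine Eq.trans ?_ (homologyToQuot_phiHom k F' q _).symm
  rw [map_neg, map_wBar]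
  rfl

end Lift

/-! ### Comparison with the explicit chains `w(x)`. -/

section Chains

variable (k : Type u) [CommRing k] {F : Type u} [Field F]

theorem commutingTuple_eq {q : ℕ} (a b : Fˣ) (c : Fin (q + 1) → Fˣ) :
    commutingTuple a b c = fun l => diagGL (torusElt
      ((Fin.cons (cochar (Pi.single (Fin.last (q + 1)) 1) (Additive.ofMul b))
        (Fin.cons (cochar (ones _ (q + 1)) (Additive.ofMul a)) (symbolTuple (q + 2) c)) :
          Fin (q + 3) → Fin (q + 2) → Ab F) l)) := by
  funext l
  refine Fin.cases ?_ (fun l => Fin.cases ?_ (fun l => ?_) l) l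
  · simp only [commutingTuple, Fin.cons_zero]
    congr 1
    funext j
    simp only [torusElt, cochar_apply, Pi.single_apply]
    split_ifs <;> simp
  · simp only [commutingTuple, Fin.cons_zero, Fin.cons_succ]
    congr 1
    funext j
    have hj := j.isLt
    simp only [torusElt, cochar_apply, ones, Fin.ext_iff, Fin.val_last]
    split_ifs <;> first | omega | simp
  · simp only [commutingTuple, Fin.cons_succ, symbolTuple, hurewiczMatrix]
    congr 1
    funext j
    simp only [torusElt, cochar_apply, cvec]
    split_ifs <;> simp

theorem mk_cChain_commutingTuple {q : ℕ} (a b : Fˣ) (c : Fin (q + 1) → Fˣ) :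
    BarQuot.mk k (GL (Fin (q + 2)) F) (q + 3) (cChain k (commutingTuple a b c)) =
      pairCons (torusSymb F k (q + 2) (q + 3)) (symbolTuple (q + 2) c)
        (cochar (Pi.single (Fin.last (q + 1)) 1) (Additive.ofMul b))
        (cochar (ones _ (q + 1)) (Additive.ofMul a)) := by
  rw [pairCons_apply, torusSymb_apply, commutingTuple_eq]
  rfl

theorem d_wChain {q m : ℕ} (a b : Fin m → Fˣ) (c : Fin m → Fin (q + 1) → Fˣ) :
    Bar.d k (GL (Fin (q + 2)) F) (q + 2) (wChain k a b c) = 0 := by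
  simp only [wChain, map_neg, map_sum, map_add, commutingTuple_eq, d_cChain_diagGL]
  simp

variable [Infinite F]

theorem mk_wChain {q m : ℕ} (a b : Fin m → Fˣ) (c : Fin m → Fin (q + 1) → Fˣ) :
    BarQuot.mk k (GL (Fin (q + 2)) F) (q + 3) (wChain k a b c) =
      -wBar k F q (milnorSum a b c) := by
  simp only [wChain, milnorSum, map_neg, map_sum, map_add, mk_cChain_commutingTuple]
  congr 1
  refine Finset.sum_congr rfl fun i _ => ?_
  rw [wBar, wHom, symPhi_tmul]
  -- The tuple for `(a, b)` begins with the matrix of `b`, so the two terms of the symmetrization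
  -- appear in the opposite order.
  exact add_comm _ _

end Chains

/-! ### The families `φ_n` and `κ_n`, and the theorem. -/

section Families

/-- The homomorphisms `φ_n`. -/
def phiMap (k : Type u) [CommRing k] :
    ∀ (n : ℕ) (F : Type u) [Field F] [Infinite F], BGroup F n →+ StabKer k F n
  | 0, _, _, _ => 0
  | 1, _, _, _ => 0
  | 2, _, _, _ => 0
  | q + 3, F, _, _ => phiHom k F q

variable (k : Type u) [CommRing k]

theorem homologyMap_phiMap {F F' : Type u} [Field F] [Infinite F] [Field F'] [Infinite F']
    (f : F →+* F') : ∀ (n : ℕ) (x : BGroup F n),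
      homologyMap k (Matrix.GeneralLinearGroup.map f) n (StabKer.incl k F n (phiMap k n F x)) =
        StabKer.incl k F' n (phiMap k n F' (BGroup.map f n x))
  | 0, _ => (congrArg _ (map_zero _)).trans ((map_zero _).trans (map_zero _).symm)
  | 1, _ => (congrArg _ (map_zero _)).trans ((map_zero _).trans (map_zero _).symm)
  | 2, _ => (congrArg _ (map_zero _)).trans ((map_zero _).trans (map_zero _).symm)
  | q + 3, x => homologyMap_phiHom k q f x

theorem smul_phiMap {F : Type u} [Field F] [Infinite F] :
    ∀ (n : ℕ) (x : BGroup F n), (n - 1) • phiMap k n F x = 0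
  | 0, _ => smul_zero _
  | 1, _ => smul_zero _
  | 2, _ => smul_zero _
  | q + 3, x => smul_phiHom k F q x

theorem phiMap_eq_zero {F : Type u} [Field F] [Infinite F] :
    ∀ {n : ℕ} {x : BGroup F n}, BGroup.mulSubTwo F n x = 0 → phiMap k n F x = 0
  | 0, _, _ => rfl
  | 1, _, _ => rfl
  | 2, _, _ => rfl
  | q + 3, x, hx => by
    refine phiHom_eq_zero k F q (x := x) (Eq.trans ?_ hx)
    have : ((q + 3 : ℕ) : ℤ) - 2 = (q : ℤ) + 1 := by push_cast; ring
    rw [BGroup.mulSubTwo, zsmulAddGroupHom_apply, this]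
    rfl

/-- A homomorphism that kills the kernel of a surjection descends, and `phiMap_eq_zero` supplies the
inclusion of kernels. -/
theorem exists_phiMap_eq_comp (n : ℕ) (F : Type u) [Field F] [Infinite F] :
    ∃ ψ : (BGroup.mulSubTwo F n).range →+ StabKer k F n,
      phiMap k n F = ψ.comp (BGroup.mulSubTwo F n).rangeRestrict := by
  have hs := AddMonoidHom.rangeRestrict_surjective (BGroup.mulSubTwo F n)
  have hk : (BGroup.mulSubTwo F n).rangeRestrict.ker ≤ (phiMap k n F).ker := fun x hx =>
    phiMap_eq_zero k (congrArg Subtype.val hx)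
  exact ⟨_, (AddMonoidHom.liftOfRightInverse_comp _ _ (Function.rightInverse_surjInv hs)
    ⟨phiMap k n F, hk⟩).symm⟩

/-- The scalar `(-1)^{n-2} / (n-2)!`. -/
def kappaScalar (n : ℕ) : ZInv.{u} (n - 2).factorial :=
  (-1) ^ (n - 2) * ZInv.inv (n - 2).factorial

/-- The homomorphisms `κ_n`. -/
def kappaMap (n : ℕ) (F : Type u) [Field F] [Infinite F] :
    TensorProduct ℤ (ZInv.{u} (n - 2).factorial) (BGroup F n) →ₗ[ZInv.{u} (n - 2).factorial]
      StabKer (ZInv.{u} (n - 2).factorial) F n :=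
  kappaScalar n • LinearMap.liftBaseChange _ (phiMap _ n F).toIntLinearMap

theorem kappaMap_tmul (n : ℕ) (F : Type u) [Field F] [Infinite F]
    (s : ZInv.{u} (n - 2).factorial) (x : BGroup F n) :
    kappaMap n F (s ⊗ₜ x) = kappaScalar n • s • phiMap _ n F x := rfl

theorem kappaMap_eq_zero {n : ℕ} {F : Type u} [Field F] [Infinite F]
    (h : phiMap (ZInv.{u} (n - 2).factorial) n F = 0) : kappaMap n F = 0 := by
  refine LinearMap.ext fun x => ?_
  induction x with
  | zero => rw [map_zero, map_zero]
  | add x y hx hy => rw [map_add, map_add, hx, hy]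
  | tmul s x =>
    rw [kappaMap_tmul, h, AddMonoidHom.zero_apply, smul_zero, smul_zero, LinearMap.zero_apply]

theorem isRepresentedBy_smul_phiMap {F : Type u} [Field F] [Infinite F] {q m : ℕ} (a b : Fin m → Fˣ)
    (c : Fin m → Fin (q + 1) → Fˣ) (hx : δ₂ F (q + 1) (milnorSum a b c) = 0) (s : k) :
    IsRepresentedBy (G := GL (Fin (q + 2)) F)
      (StabKer.incl k F (q + 3) (s • phiMap k (q + 3) F (BGroup.mk (milnorSum a b c) hx)))
      (s • wChain k a b c) := by
  refine isRepresentedBy_of_homologyToQuot (n := q + 2) ?_ ?_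
  · rw [map_smul, d_wChain, smul_zero]
  · rw [map_smul, map_smul, map_smul]
    exact congrArg (s • ·) ((homologyToQuot_phiHom k F q _).trans (mk_wChain k a b c).symm)

theorem isRepresentedBy_phiMap {F : Type u} [Field F] [Infinite F] {q m : ℕ} (a b : Fin m → Fˣ)
    (c : Fin m → Fin (q + 1) → Fˣ) (hx : δ₂ F (q + 1) (milnorSum a b c) = 0) :
    IsRepresentedBy (G := GL (Fin (q + 2)) F)
      (StabKer.incl k F (q + 3) (phiMap k (q + 3) F (BGroup.mk (milnorSum a b c) hx)))
      (wChain k a b c) := by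
  have := isRepresentedBy_smul_phiMap k a b c hx 1
  rwa [one_smul, one_smul] at this

end Families
end
end GLHom

theorem proposition5p1 :
    -- (i) the maps `φ_n`
    (∃ φ : ∀ (n : ℕ) (F : Type u) [Field F] [Infinite F],
        GLHom.BGroup F n →+ GLHom.StabKer GLHom.ZCoeff.{u} F n,
      -- naturality in the field
      (∀ (n : ℕ) (F F' : Type u) [Field F] [Infinite F] [Field F'] [Infinite F'] (f : F →+* F')
        (x : GLHom.BGroup F n), 1 ≤ n →
        GLHom.homologyMap GLHom.ZCoeff.{u} (Matrix.GeneralLinearGroup.map f) n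
            (GLHom.StabKer.incl GLHom.ZCoeff.{u} F n (φ n F x)) =
          GLHom.StabKer.incl GLHom.ZCoeff.{u} F' n (φ n F' (GLHom.BGroup.map f n x))) ∧
      -- explicit description
      (∀ (F : Type u) [Field F] [Infinite F], φ 1 F = 0 ∧ φ 2 F = 0 ∧
        ∀ (q m : ℕ) (a b : Fin m → Fˣ) (c : Fin m → Fin (q + 1) → Fˣ)
          (hx : GLHom.δ₂ F (q + 1) (GLHom.milnorSum a b c) = 0),
          GLHom.IsRepresentedBy (G := GL (Fin (q + 2)) F)
            (GLHom.StabKer.incl GLHom.ZCoeff.{u} F (q + 3)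
              (φ (q + 3) F (GLHom.BGroup.mk (GLHom.milnorSum a b c) hx)))
            (GLHom.wChain GLHom.ZCoeff.{u} a b c)) ∧
      -- factorization through `n - 2 : B_n(F) → (n - 2) B_n(F)`, and torsion
      ∀ (n : ℕ) (F : Type u) [Field F] [Infinite F], 1 ≤ n →
        (∃ ψ : (GLHom.BGroup.mulSubTwo F n).range →+ GLHom.StabKer GLHom.ZCoeff.{u} F n,
          φ n F = ψ.comp (GLHom.BGroup.mulSubTwo F n).rangeRestrict) ∧
        ∀ x : GLHom.BGroup F n, (n - 1) • φ n F x = 0) ∧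
    -- (ii) the maps `κ_n`
    (∃ κ : ∀ (n : ℕ) (F : Type u) [Field F] [Infinite F],
        TensorProduct ℤ (GLHom.ZInv.{u} (n - 2).factorial) (GLHom.BGroup F n)
          →ₗ[GLHom.ZInv.{u} (n - 2).factorial]
          GLHom.StabKer (GLHom.ZInv.{u} (n - 2).factorial) F n,
      -- naturality in the field
      (∀ (n : ℕ) (F F' : Type u) [Field F] [Infinite F] [Field F'] [Infinite F'] (f : F →+* F')
        (x : TensorProduct ℤ (GLHom.ZInv.{u} (n - 2).factorial) (GLHom.BGroup F n)), 1 ≤ n →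
        GLHom.homologyMap (GLHom.ZInv.{u} (n - 2).factorial) (Matrix.GeneralLinearGroup.map f) n
            (GLHom.StabKer.incl (GLHom.ZInv.{u} (n - 2).factorial) F n (κ n F x)) =
          GLHom.StabKer.incl (GLHom.ZInv.{u} (n - 2).factorial) F' n
            (κ n F' ((GLHom.BGroup.map f n).toIntLinearMap.lTensor
              (GLHom.ZInv.{u} (n - 2).factorial) x))) ∧
      -- explicit description
      (∀ (F : Type u) [Field F] [Infinite F], κ 1 F = 0 ∧ κ 2 F = 0 ∧
        ∀ (q m : ℕ) (a b : Fin m → Fˣ) (c : Fin m → Fin (q + 1) → Fˣ)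
          (hx : GLHom.δ₂ F (q + 1) (GLHom.milnorSum a b c) = 0),
          GLHom.IsRepresentedBy (G := GL (Fin (q + 2)) F)
            (GLHom.StabKer.incl (GLHom.ZInv.{u} (q + 1).factorial) F (q + 3)
              (κ (q + 3) F (1 ⊗ₜ GLHom.BGroup.mk (GLHom.milnorSum a b c) hx)))
            (((-1) ^ (q + 1) * GLHom.ZInv.inv (q + 1).factorial) •
              GLHom.wChain (GLHom.ZInv.{u} (q + 1).factorial) a b c)) ∧
      -- torsion
      ∀ (n : ℕ) (F : Type u) [Field F] [Infinite F], 1 ≤ n →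
        ∀ x : TensorProduct ℤ (GLHom.ZInv.{u} (n - 2).factorial) (GLHom.BGroup F n),
          (n - 1) • κ n F x = 0) := by
  refine ⟨⟨GLHom.phiMap GLHom.ZCoeff.{u}, fun n F F' _ _ _ _ f x _ =>
    GLHom.homologyMap_phiMap _ f n x, fun F _ _ => ⟨rfl, rfl, fun q m a b c hx => ?_⟩,
    fun n F _ _ _ => ⟨GLHom.exists_phiMap_eq_comp _ n F, GLHom.smul_phiMap _ n⟩⟩,
    GLHom.kappaMap, fun n F F' _ _ _ _ f x _ => ?_, fun F _ _ =>
      ⟨GLHom.kappaMap_eq_zero rfl, GLHom.kappaMap_eq_zero rfl, fun q m a b c hx => ?_⟩,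
    fun n F _ _ _ x => ?_⟩
  · exact GLHom.isRepresentedBy_phiMap _ a b c hx
  · induction x with
    | zero => simp only [map_zero]
    | add x y hx hy => simp only [map_add, hx, hy]
    | tmul s x =>
      rw [LinearMap.lTensor_tmul, GLHom.kappaMap_tmul, GLHom.kappaMap_tmul]
      simp only [map_smul, GLHom.homologyMap_phiMap]
      rfl
  -- For `n = q + 3` the natural number `n - 2` reduces to `q + 1`, so `kappaScalar` is this scalar
  -- by definition.
  · have := GLHom.isRepresentedBy_smul_phiMap (GLHom.ZInv.{u} (q + 1).factorial) a b c hx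
      ((-1) ^ (q + 1) * GLHom.ZInv.inv (q + 1).factorial)
    convert this using 3
    exact (GLHom.kappaMap_tmul _ _ _ _).trans (congrArg _ (one_smul _ _))
  · induction x with
    | zero => rw [map_zero, smul_zero]
    | add x y hx hy => rw [map_add, smul_add, hx, hy, add_zero]
    | tmul s x =>
      rw [GLHom.kappaMap_tmul, smul_comm, smul_comm _ s, GLHom.smul_phiMap, smul_zero, smul_zero]
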